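/- **Conventions.** A finite double groupoid $\mathcal T$ consists of finite nonempty sets $\mathcal B$ (boxes), $\mathcal H$ (horizontal edges), $\mathcal V$ (vertical edges), $\mathcal P$ (points) and four groupoid structures: $\mathcal B\rightrightarrows\mathcal H$ (source = top $t$, target = bottom $b$; composition $\begin{smallmatrix}A\\ C\end{smallmatrix}$ of boxes with $b(A)=t(C)$), $\mathcal B\rightrightarrows\mathcal V$ (source = left $l$, target = right $r$; composition $AC$ of boxes with $r(A)=l(C)$), $\mathcal H\rightrightarrows\mathcal P$ (source $l$, target $r$) and $\mathcal V\rightrightarrows\mathcal P$ (source $t$, target $b$), such that the corners of a box agree ($tl=lt$, $tr=rt$, $bl=lb$, $br=rb$), $t,b:\mathcal B\to\mathcal H$ and $l,r:\mathcal B\to\mathcal V$ preserve compositions and identities, the identity maps $\mathcal H\to\mathcal B$, $\mathcal V\to\mathcal B$ preserve compositions and agree on the identities of points, and the interchange law $\begin{smallmatrix}AC\\ DE\end{smallmatrix}=\bigl(\begin{smallmatrix}A\\ D\end{smallmatrix}\bigr)\bigl(\begin{smallmatrix}C\\ E\end{smallmatrix}\bigr)$ holds whenever all compositions are defined. It is *vacant*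 if for all $x\in\mathcal H$, $g\in\mathcal V$ with $r(x)=t(g)$ there is exactly one box with top $x$ and right side $g$. Let $\Bbbk$ be a field. A *normalized 2-cocycle* on $\mathcal T$ with values in $\Bbbk^\times$ is a pair $(\sigma,\tau)$, where $\sigma$ is a normalized 2-cocycle on the groupoid $\mathcal B\rightrightarrows\mathcal H$ (a function $\sigma(A,C)\in\Bbbk^\times$ of vertically composable pairs, equal to $1$ if one argument is a vertical identity, with $\sigma(A,C)\,\sigma(\begin{smallmatrix}A\\ C\end{smallmatrix},D)=\sigma(C,D)\,\sigma(A,\begin{smallmatrix}C\\ D\end{smallmatrix})$), $\tau$ is likewise a normalized 2-cocycle on $\mathcal B\rightrightarrows\mathcal V$, and $$\sigma(AC,DE)\,\tau\bigl(\begin{smallmatrix}A\\ D\end{smallmatrix},\begin{smallmatrix}C\\ E\end{smallmatrix}\bigr)=\tau(A,C)\,\tau(D,E)\,\sigma(A,D)\,\sigma(C,E)$$ for all composable $2\times2$ arrangements $\begin{smallmatrix}A&C\\ D&E\end{smallmatrix}$. For a finite vacant double groupoid $\mathcal T$ and a normalized 2-cocycle $(\sigma,\tau)$, let $\Bbbk^\tau_\sigma\mathcal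 T$ be the weak bialgebra over $\Bbbk$ with basis $\mathcal B$, multiplication $A\cdot C=\sigma(A,C)\begin{smallmatrix}A\\ C\end{smallmatrix}$ if $b(A)=t(C)$ and $0$ otherwise, unit the sum of all vertical identities (the identities of $\mathcal B\rightrightarrows\mathcal H$), comultiplication $\Delta(A)=\sum_{XY=A}\tau(X,Y)\,X\otimes Y$ (sum over the horizontally composable pairs with $XY=A$), and counit $\varepsilon(A)=1$ if $A$ is a horizontal identity (an identity of $\mathcal B\rightrightarrows\mathcal V$) and $0$ otherwise. Let $\operatorname{Rep}\Bbbk^\tau_\sigma\mathcal T$ be the category of its finite-dimensional modules, with the monoidal structure $X\otimes Y:=\Delta(1)(X\otimes_{\Bbbk}Y)$, on which $h$ acts through $\Delta(h)$; the associativity constraint is that of vector spaces, and the unit object is the target subalgebra, i.e. the image of $\varepsilon_t(h)=(\varepsilon\otimes\mathrm{id})(\Delta(1)(h\otimes1))$, with action $h\cdot z=\varepsilon_t(hz)$ (and the usual unit constraints $z\otimes x\mapsto zx$ and $x\otimes z\mapsto (\mathrm{id}\otimes\varepsilon)(\Delta(1)(1\otimes z))\,x$). A *multifusion category* over $\Bbbk$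 is a semisimple $\Bbbk$-linear rigid tensor category (an abelian $\Bbbk$-linear category in which every object is a finite direct sum of simple objects, with a $\Bbbk$-bilinear monoidal structure for which every object has a left and a right dual) with finitely many isomorphism classes of simple objects and finite-dimensional spaces of morphisms. It is a *fusion category* if in addition its unit object is simple. A groupoid is *connected* if there is an arrow between any two of its objects. **Proposition.** Let $\mathcal T$ be a finite vacant double groupoid, $\Bbbk$ a field, and $(\sigma,\tau)$ a normalized 2-cocycle on $\mathcal T$ with values in $\Bbbk^\times$. (i) The unit object of $\operatorname{Rep}\Bbbk^\tau_\sigma\mathcal T$ is simple if and only if the groupoid $\mathcal V\rightrightarrows\mathcal P$ is connected. (ii) If $\operatorname{char}\Bbbk=0$, then $\operatorname{Rep}\Bbbk^\tau_\sigma\mathcal T$ is a multifusion category; it is a fusion category if and only if $\mathcal V\rightrightarrows\mathcal P$ is connected. -/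

import Mathlib

open CategoryTheory
open scoped TensorProduct MonoidalCategory

universe u

noncomputable section

/-! ### Weak bialgebras -/

/-- A weak bialgebra: an algebra and a coalgebra whose comultiplication is multiplicative
(but need not preserve the unit), with the weak unit and weak counit axioms. -/
class WeakBialgebra (k A : Type u) [Field k] [Ring A] [Algebra k A] extends Coalgebra k A where
  /-- `Δ(ab) = Δ(a)Δ(b)` -/
  comul_mul : ∀ a b : A, comul (a * b) = comul a * comul b
  /-- `Δ²(1) = (Δ(1) ⊗ 1)(1 ⊗ Δ(1))` -/
  comul_comul_one : comul.lTensor A (comul (1 : A)) =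
    TensorProduct.assoc k A A A (comul (1 : A) ⊗ₜ[k] (1 : A)) * ((1 : A) ⊗ₜ[k] comul (1 : A))
  /-- `Δ²(1) = (1 ⊗ Δ(1))(Δ(1) ⊗ 1)` -/
  comul_comul_one' : comul.lTensor A (comul (1 : A)) =
    ((1 : A) ⊗ₜ[k] comul (1 : A)) * TensorProduct.assoc k A A A (comul (1 : A) ⊗ₜ[k] (1 : A))
  /-- `ε(abc) = ε(a b₁) ε(b₂ c)` -/
  counit_mul_mul : ∀ a b c : A, counit (a * b * c) = LinearMap.mul' k k
    (TensorProduct.map (counit ∘ₗ LinearMap.mulLeft k a) (counit ∘ₗ LinearMap.mulRight k c)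
      (comul b))
  /-- `ε(abc) = ε(a b₂) ε(b₁ c)` -/
  counit_mul_mul' : ∀ a b c : A, counit (a * b * c) = LinearMap.mul' k k
    (TensorProduct.map (counit ∘ₗ LinearMap.mulRight k c) (counit ∘ₗ LinearMap.mulLeft k a)
      (comul b))

namespace WeakBialgebra

open Coalgebra

variable (k A : Type u) [Field k] [Ring A] [Algebra k A] [WeakBialgebra k A]

/-- `ε ⊗ id`. -/
def counitL : A ⊗[k] A →ₗ[k] A := TensorProduct.lid k A ∘ₗ counit.rTensor A

/-- `id ⊗ ε`. -/
def counitR : A ⊗[k] A →ₗ[k] A := TensorProduct.rid k A ∘ₗ counit.lTensor A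

/-- The target map `ε_t(h) = (ε ⊗ id)(Δ(1)(h ⊗ 1))`. -/
def εt : A →ₗ[k] A :=
  counitL k A ∘ₗ LinearMap.mulLeft k (comul (1 : A)) ∘ₗ (TensorProduct.mk k A A).flip 1

/-- The map `h ↦ (id ⊗ ε)(Δ(1)(1 ⊗ h))`. -/
def εr : A →ₗ[k] A :=
  counitR k A ∘ₗ LinearMap.mulLeft k (comul (1 : A)) ∘ₗ TensorProduct.mk k A A 1

variable {A}

lemma counitL_tmul (a b : A) : counitL k A (a ⊗ₜ b) = counit (R := k) a • b := by
  simp [counitL]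

lemma counitR_tmul (a b : A) : counitR k A (a ⊗ₜ b) = counit (R := k) b • a := by
  simp [counitR]

lemma εt_apply (h : A) : εt k A h = counitL k A (comul (1 : A) * (h ⊗ₜ 1)) := rfl

lemma εr_apply (h : A) : εr k A h = counitR k A (comul (1 : A) * (1 ⊗ₜ h)) := rfl

lemma counit_mul_counitL (x b : A) (t : A ⊗[k] A) :
    counit (R := k) (x * counitL k A (t * (b ⊗ₜ 1))) = LinearMap.mul' k k
    (TensorProduct.map (counit ∘ₗ LinearMap.mulRight k b) (counit ∘ₗ LinearMap.mulLeft k x) t) := by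
  induction t with
  | zero => simp
  | add s t hs ht => rw [add_mul, map_add, mul_add, map_add, hs, ht, map_add, map_add]
  | tmul a c => simp [counitL_tmul]

lemma counit_mul_εt (x b : A) : counit (R := k) (x * εt k A b) = counit (x * b) := by
  rw [εt_apply, counit_mul_counitL, ← counit_mul_mul', mul_one]

lemma counit_εt (b : A) : counit (R := k) (εt k A b) = counit b := by
  simpa using counit_mul_εt k 1 b

lemma εt_one : εt k A 1 = 1 := by
  rw [εt_apply, ← Algebra.TensorProduct.one_def, mul_one, counitL]
  simp

lemma εr_one : εr k A 1 = 1 := by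
  rw [εr_apply, ← Algebra.TensorProduct.one_def, mul_one, counitR]
  simp

lemma εt_mul_εt (a b : A) : εt k A (a * εt k A b) = εt k A (a * b) := by
  have key : ∀ t : A ⊗[k] A, counitL k A (t * ((a * εt k A b) ⊗ₜ 1)) =
      counitL k A (t * ((a * b) ⊗ₜ 1)) := by
    intro t
    induction t with
    | zero => simp
    | add s t hs ht => simp only [add_mul, map_add, hs, ht]
    | tmul x y =>
      simp only [Algebra.TensorProduct.tmul_mul_tmul, counitL_tmul, ← mul_assoc, counit_mul_εt]
  exact key _

lemma εt_εt (b : A) : εt k A (εt k A b) = εt k A b := by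
  simpa using εt_mul_εt k 1 b

lemma counitL_comul (a : A) : counitL k A (comul a) = a := by simp [counitL]
lemma counitR_comul (a : A) : counitR k A (comul a) = a := by simp [counitR]

lemma comul_mul_comul_one (h : A) : comul (R := k) h * comul (1 : A) = comul h := by
  rw [← comul_mul, mul_one]

lemma comul_one_mul_comul (h : A) : comul (R := k) (1 : A) * comul h = comul h := by
  rw [← comul_mul, one_mul]

lemma coassoc_one : TensorProduct.assoc k A A A (comul.rTensor A (comul (1 : A))) =
    comul.lTensor A (comul (1 : A)) := coassoc_apply _

/-- `ε(h₁ b) h₂ = h ε_t(b)` -/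
lemma counitL_comul_mul (h b : A) : counitL k A (comul h * (b ⊗ₜ 1)) = h * εt k A b := by
  -- `x ⊗ y ⊗ z ↦ ε(x b) (ε ⊗ id)(t (y ⊗ z))`
  let Ψ (t : A ⊗[k] A) : A ⊗[k] (A ⊗[k] A) →ₗ[k] A :=
    TensorProduct.lid k A ∘ₗ TensorProduct.map (counit ∘ₗ LinearMap.mulRight k b)
      (counitL k A ∘ₗ LinearMap.mulLeft k t)
  have h1 : ∀ s : A ⊗[k] A, Ψ (comul h) (comul.lTensor A s) =
      h * counitL k A (s * (b ⊗ₜ 1)) := by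
    intro s
    induction s with
    | zero => simp
    | add s t hs ht => simp only [add_mul, map_add, hs, ht, mul_add]
    | tmul x y => simp [Ψ, ← comul_mul, counitL_comul, counitL_tmul]
  have h2 : ∀ t s : A ⊗[k] A, Ψ t (TensorProduct.assoc k A A A (comul.rTensor A s)) =
      counitL k A (t * s * (b ⊗ₜ 1)) := by
    intro t s
    induction s with
    | zero => simp
    | add s t hs ht => simp only [add_mul, map_add, hs, ht, mul_add]
    | tmul x y =>
      induction t with
      | zero => simp [Ψ]
      | add s t hs ht =>
        have : Ψ (s + t) = Ψ s + Ψ t := by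
          ext; simp [Ψ, add_mul, TensorProduct.tmul_add]
        simp only [this, LinearMap.add_apply, hs, ht, add_mul, map_add]
      | tmul p q =>
        simp only [Algebra.TensorProduct.tmul_mul_tmul, counitL_tmul, mul_one, counit_mul_mul',
          LinearMap.rTensor_tmul]
        generalize comul (R := k) x = r
        induction r with
        | zero => simp
        | add s t hs ht => simp only [TensorProduct.add_tmul, map_add, hs, ht, add_smul]
        | tmul c d => simp [Ψ, counitL_tmul, smul_smul, mul_comm]
  rw [← comul_mul_comul_one, ← h2, coassoc_one, h1, εt_apply]

/-- `ε(h₂ b) h₁ = h ε_r(b)` -/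
lemma counitR_comul_mul (h b : A) : counitR k A (comul h * (1 ⊗ₜ b)) = h * εr k A b := by
  let Ψ (t : A ⊗[k] A) : (A ⊗[k] A) ⊗[k] A →ₗ[k] A :=
    TensorProduct.rid k A ∘ₗ TensorProduct.map
      (counitR k A ∘ₗ LinearMap.mulLeft k t) (counit ∘ₗ LinearMap.mulRight k b)
  have h1 : ∀ s : A ⊗[k] A, Ψ (comul h) (comul.rTensor A s) =
      h * counitR k A (s * (1 ⊗ₜ b)) := by
    intro s
    induction s with
    | zero => simp
    | add s t hs ht => simp only [add_mul, map_add, hs, ht, mul_add]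
    | tmul x y => simp [Ψ, ← comul_mul, counitR_comul, counitR_tmul]
  have h2 : ∀ t s : A ⊗[k] A, Ψ t ((TensorProduct.assoc k A A A).symm (comul.lTensor A s)) =
      counitR k A (t * s * (1 ⊗ₜ b)) := by
    intro t s
    induction s with
    | zero => simp
    | add s t hs ht => simp only [add_mul, map_add, hs, ht, mul_add]
    | tmul x y =>
      induction t with
      | zero => simp [Ψ]
      | add s t hs ht =>
        have : Ψ (s + t) = Ψ s + Ψ t := by
          ext; simp [Ψ, add_mul]
        simp only [this, LinearMap.add_apply, hs, ht, add_mul, map_add]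
      | tmul p q =>
        simp only [Algebra.TensorProduct.tmul_mul_tmul, counitR_tmul, mul_one, counit_mul_mul,
          LinearMap.lTensor_tmul]
        generalize comul (R := k) y = r
        induction r with
        | zero => simp
        | add s t hs ht => simp only [TensorProduct.tmul_add, map_add, hs, ht, add_smul]
        | tmul c d => simp [Ψ, counitR_tmul, smul_smul, mul_comm]
  rw [← comul_mul_comul_one, ← h2, ← coassoc_one, LinearEquiv.symm_apply_apply, h1, εr_apply]

/-- `ε(y h₁) h₂ = ε(y 1₁) 1₂ h` -/
lemma counitL_mul_comul (y h : A) :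
    counitL k A ((y ⊗ₜ 1) * comul h) = counitL k A ((y ⊗ₜ 1) * comul (1 : A)) * h := by
  let Ψ (t : A ⊗[k] A) : A ⊗[k] (A ⊗[k] A) →ₗ[k] A :=
    TensorProduct.lid k A ∘ₗ TensorProduct.map (counit ∘ₗ LinearMap.mulLeft k y)
      (counitL k A ∘ₗ LinearMap.mulRight k t)
  have h1 : ∀ s : A ⊗[k] A, Ψ (comul h) (comul.lTensor A s) =
      counitL k A ((y ⊗ₜ 1) * s) * h := by
    intro s
    induction s with
    | zero => simp
    | add s t hs ht => simp only [add_mul, map_add, hs, ht, mul_add]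
    | tmul x y => simp [Ψ, ← comul_mul, counitL_comul, counitL_tmul]
  have h2 : ∀ t s : A ⊗[k] A, Ψ t (TensorProduct.assoc k A A A (comul.rTensor A s)) =
      counitL k A ((y ⊗ₜ 1) * (s * t)) := by
    intro t s
    induction s with
    | zero => simp
    | add s t hs ht => simp only [add_mul, map_add, hs, ht, mul_add]
    | tmul x z =>
      induction t with
      | zero => simp [Ψ]
      | add s t hs ht =>
        have : Ψ (s + t) = Ψ s + Ψ t := by
          ext; simp [Ψ, mul_add, TensorProduct.tmul_add]
        simp only [this, LinearMap.add_apply, hs, ht, mul_add, map_add]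
      | tmul p q =>
        simp only [Algebra.TensorProduct.tmul_mul_tmul, counitL_tmul, one_mul, ← mul_assoc,
          counit_mul_mul, LinearMap.rTensor_tmul]
        generalize comul (R := k) x = r
        induction r with
        | zero => simp
        | add s t hs ht => simp only [TensorProduct.add_tmul, map_add, hs, ht, add_smul]
        | tmul c d => simp [Ψ, counitL_tmul, smul_smul, mul_comm]
  rw [← comul_one_mul_comul, ← h2, coassoc_one, h1]

/-- `ε(1₁ b) (1₂ ⊗ 1₃) = 1₁ ε_t(b) ⊗ 1₂` -/
lemma comul_εt (b : A) : comul (R := k) (εt k A b) = comul (1 : A) * (εt k A b ⊗ₜ 1) := by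
  let Ψ : A ⊗[k] (A ⊗[k] A) →ₗ[k] A ⊗[k] A :=
    TensorProduct.lid k (A ⊗[k] A) ∘ₗ (counit ∘ₗ LinearMap.mulRight k b).rTensor _
  have h1 : ∀ s : A ⊗[k] A, Ψ (comul.lTensor A s) = comul (counitL k A (s * (b ⊗ₜ 1))) := by
    intro s
    induction s with
    | zero => simp
    | add s t hs ht => simp only [add_mul, map_add, hs, ht]
    | tmul x y => simp [Ψ, counitL_tmul]
  have h2 : ∀ t s : A ⊗[k] A, Ψ ((1 ⊗ₜ t) * TensorProduct.assoc k A A A (s ⊗ₜ 1)) =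
      t * (counitL k A (s * (b ⊗ₜ 1)) ⊗ₜ 1) := by
    intro t s
    induction s with
    | zero => simp
    | add s t hs ht =>
      simp only [add_mul, map_add, hs, ht, mul_add, TensorProduct.add_tmul]
    | tmul x y =>
      simp [Ψ, counitL_tmul, ← TensorProduct.smul_tmul']
  rw [εt_apply, ← h1, comul_comul_one', h2]

/-- `1₁ ⊗ ε_t(1₂ z) = 1₁ ε_r(z) ⊗ 1₂` -/
lemma lTensor_εt_comul_one (z : A) :
    (εt k A ∘ₗ LinearMap.mulRight k z).lTensor A (comul (1 : A)) =
      comul (1 : A) * (εr k A z ⊗ₜ 1) := by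
  let Ψ : A ⊗[k] (A ⊗[k] A) →ₗ[k] A ⊗[k] A :=
    (counitL k A ∘ₗ LinearMap.mulRight k (z ⊗ₜ 1)).lTensor A
  have h1 : ∀ s t : A ⊗[k] A, Ψ ((1 ⊗ₜ t) * TensorProduct.assoc k A A A (s ⊗ₜ 1)) =
      (counitL k A ∘ₗ LinearMap.mulLeft k t ∘ₗ (TensorProduct.mk k A A).flip 1 ∘ₗ
        LinearMap.mulRight k z).lTensor A s := by
    intro s t
    induction s with
    | zero => simp
    | add s t hs ht => simp only [TensorProduct.add_tmul, map_add, mul_add, hs, ht]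
    | tmul x y => simp [Ψ, mul_assoc]
  have h2 : ∀ s : A ⊗[k] A, Ψ (TensorProduct.assoc k A A A (comul.rTensor A s)) =
      s * (εr k A z ⊗ₜ 1) := by
    intro s
    induction s with
    | zero => simp
    | add s t hs ht => simp only [map_add, add_mul, hs, ht]
    | tmul x y =>
      have : ∀ r : A ⊗[k] A, Ψ (TensorProduct.assoc k A A A (r ⊗ₜ y)) =
          counitR k A (r * (1 ⊗ₜ z)) ⊗ₜ y := by
        intro r
        induction r with
        | zero => simp
        | add s t hs ht => simp only [TensorProduct.add_tmul, map_add, add_mul, hs, ht]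
        | tmul p q =>
          simp [Ψ, counitL_tmul, counitR_tmul, TensorProduct.smul_tmul']
      rw [LinearMap.rTensor_tmul, this, counitR_comul_mul]
      simp
  have h3 := h1 (comul 1) (comul 1)
  rw [← comul_comul_one', ← coassoc_one, h2] at h3
  exact h3.symm

/-- `ε_t(h₁) ⊗ h₂ = ε_t(1₁) ⊗ 1₂ h` -/
lemma rTensor_εt_comul (h : A) :
    (εt k A).rTensor A (comul h) =
      (LinearMap.mulRight k h).lTensor A ((εt k A).rTensor A (comul (1 : A))) := by
  have key : ∀ s t : A ⊗[k] A,
      (counitL k A ∘ₗ LinearMap.mulLeft k s ∘ₗ (TensorProduct.mk k A A).flip 1).rTensor A t =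
      (TensorProduct.comm k A A) ((counitL k A ∘ₗ LinearMap.mulRight k t ∘ₗ
        (TensorProduct.mk k A A).flip 1).rTensor A s) := by
    intro s t
    induction s with
    | zero => simp
    | add s s' hs hs' =>
      rw [map_add, map_add, ← hs, ← hs', ← LinearMap.add_apply, ← LinearMap.rTensor_add]
      congr 2; ext; simp [add_mul]
    | tmul p q =>
      induction t with
      | zero => simp
      | add s s' hs hs' =>
        simp only [map_add, hs, hs']
        simp [mul_add, TensorProduct.add_tmul]
      | tmul a b => simp [counitL_tmul, TensorProduct.tmul_smul, TensorProduct.smul_tmul']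
  have k2 : ∀ s : A ⊗[k] A, (TensorProduct.comm k A A) ((counitL k A ∘ₗ LinearMap.mulRight k (comul h)
      ∘ₗ (TensorProduct.mk k A A).flip 1).rTensor A s) = (LinearMap.mulRight k h).lTensor A
      ((TensorProduct.comm k A A) ((counitL k A ∘ₗ LinearMap.mulRight k (comul (1 : A))
      ∘ₗ (TensorProduct.mk k A A).flip 1).rTensor A s)) := by
    intro s
    induction s with
    | zero => simp
    | add s t hs ht => simp only [map_add, hs, ht]
    | tmul x y => simp [counitL_mul_comul k x h]
  have h1 := key (comul 1) (comul h)
  rw [k2, ← key] at h1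
  exact h1

end WeakBialgebra

/-! ### Finite-dimensional representations of an algebra -/

/-- A finite-dimensional representation of a `k`-algebra `A`. -/
structure FinRep (k A : Type u) [Field k] [Ring A] [Algebra k A] : Type (u + 1) where
  /-- the underlying vector space -/
  V : Type u
  [addCommGroup : AddCommGroup V]
  [module : Module k V]
  [finiteDimensional : FiniteDimensional k V]
  /-- the action of `A` -/
  ρ : A →ₐ[k] Module.End k V

namespace FinRep

attribute [instance] addCommGroup module finiteDimensional

section category

variable {k A : Type u} [Field k] [Ring A] [Algebra k A]

/-- `A`-linear maps. -/
@[ext]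
structure Hom (X Y : FinRep k A) : Type u where
  /-- the underlying linear map -/
  hom : X.V →ₗ[k] Y.V
  comm : ∀ (a : A) (v : X.V), hom (X.ρ a v) = Y.ρ a (hom v)

instance : Category (FinRep k A) where
  Hom X Y := Hom X Y
  id X := ⟨LinearMap.id, fun _ _ => rfl⟩
  comp f g := ⟨g.hom ∘ₗ f.hom, fun a v => by simp [f.comm, g.comm]⟩

@[ext]
lemma hom_ext {X Y : FinRep k A} {f g : X ⟶ Y} (h : f.hom = g.hom) : f = g := Hom.ext h

@[simp] lemma id_hom (X : FinRep k A) : Hom.hom (𝟙 X) = LinearMap.id := rfl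

@[simp] lemma comp_hom {X Y Z : FinRep k A} (f : X ⟶ Y) (g : Y ⟶ Z) :
    Hom.hom (f ≫ g) = g.hom ∘ₗ f.hom := rfl

variable (X Y : FinRep k A)

instance : Zero (X ⟶ Y) := ⟨⟨0, by simp⟩⟩
instance : Add (X ⟶ Y) := ⟨fun f g => ⟨f.hom + g.hom, by simp [f.comm, g.comm]⟩⟩
instance : Neg (X ⟶ Y) := ⟨fun f => ⟨-f.hom, by simp [f.comm]⟩⟩
instance : Sub (X ⟶ Y) := ⟨fun f g => ⟨f.hom - g.hom, by simp [f.comm, g.comm]⟩⟩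
instance : SMul ℕ (X ⟶ Y) := ⟨fun n f => ⟨n • f.hom, by simp [f.comm]⟩⟩
instance : SMul ℤ (X ⟶ Y) := ⟨fun n f => ⟨n • f.hom, by simp [f.comm]⟩⟩
instance : SMul k (X ⟶ Y) := ⟨fun c f => ⟨c • f.hom, by simp [f.comm]⟩⟩

variable {X Y}

lemma hom_injective : Function.Injective (fun f : X ⟶ Y => f.hom) := fun _ _ h => hom_ext h

@[simp] lemma zero_hom : Hom.hom (0 : X ⟶ Y) = 0 := rfl
@[simp] lemma add_hom (f g : X ⟶ Y) : Hom.hom (f + g) = f.hom + g.hom := rfl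
@[simp] lemma smul_hom (c : k) (f : X ⟶ Y) : Hom.hom (c • f) = c • f.hom := rfl

instance : AddCommGroup (X ⟶ Y) :=
  hom_injective.addCommGroup _ rfl (fun _ _ => rfl) (fun _ => rfl) (fun _ _ => rfl)
    (fun _ _ => rfl) (fun _ _ => rfl)

instance : Module k (X ⟶ Y) :=
  hom_injective.module k ⟨⟨fun f : X ⟶ Y => f.hom, rfl⟩, fun _ _ => rfl⟩ (fun _ _ => rfl)

instance : Preadditive (FinRep k A) where
  add_comp _ _ _ f f' g := hom_ext (LinearMap.comp_add _ _ g.hom)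
  comp_add _ _ _ f g g' := hom_ext (LinearMap.add_comp _ _ _)

instance : Linear k (FinRep k A) where
  smul_comp _ _ _ r f g := hom_ext (LinearMap.comp_smul _ _ _)
  comp_smul _ _ _ f r g := hom_ext (LinearMap.smul_comp _ _ _)

/-- An isomorphism of representations from mutually inverse linear maps. -/
def mkIso (f : X ⟶ Y) (g : Y.V →ₗ[k] X.V) (h₁ : g ∘ₗ f.hom = LinearMap.id)
    (h₂ : f.hom ∘ₗ g = LinearMap.id) : X ≅ Y where
  hom := f
  inv := ⟨g, fun a v => by
    have e₁ : ∀ x, g (f.hom x) = x := fun x => LinearMap.congr_fun h₁ x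
    have e₂ : ∀ y, f.hom (g y) = y := fun y => LinearMap.congr_fun h₂ y
    rw [← e₁ (X.ρ a (g v)), f.comm, e₂]⟩
  hom_inv_id := hom_ext h₁
  inv_hom_id := hom_ext h₂

end category

/-! ### The tensor product of representations of a weak bialgebra -/

section monoidal

open Coalgebra WeakBialgebra

variable {k A : Type u} [Field k] [Ring A] [Algebra k A]

/-- The action of `A ⊗ A` on `X ⊗ Y` (tensor product of vector spaces). -/
def act₂ (X Y : FinRep k A) : A ⊗[k] A →ₐ[k] Module.End k (X.V ⊗[k] Y.V) :=
  Module.endTensorEndAlgHom.comp (Algebra.TensorProduct.map X.ρ Y.ρ)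

@[simp] lemma act₂_tmul (X Y : FinRep k A) (a b : A) :
    act₂ X Y (a ⊗ₜ b) = TensorProduct.map (X.ρ a) (Y.ρ b) := by
  rw [act₂, AlgHom.comp_apply, Algebra.TensorProduct.map_tmul]
  exact Module.endTensorEndAlgHom_apply _ _

lemma act₂_natural {X X' Y Y' : FinRep k A} (f : X ⟶ X') (g : Y ⟶ Y') (t : A ⊗[k] A)
    (w : X.V ⊗[k] Y.V) : TensorProduct.map f.hom g.hom (act₂ X Y t w) =
      act₂ X' Y' t (TensorProduct.map f.hom g.hom w) := by
  induction w with
  | zero => simp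
  | add w w' h h' => simp only [map_add, h, h']
  | tmul x y =>
    induction t with
    | zero => simp
    | add w w' h h' => simp only [map_add, LinearMap.add_apply, h, h']
    | tmul a b => simp [f.comm, g.comm]

lemma act₂_mul_apply (X Y : FinRep k A) (s t : A ⊗[k] A) (w : X.V ⊗[k] Y.V) :
    act₂ X Y s (act₂ X Y t w) = act₂ X Y (s * t) w := by
  rw [map_mul]; rfl

/-- The action of `A ⊗ (A ⊗ A)` on `X ⊗ (Y ⊗ Z)`. -/
def act₃ (X Y Z : FinRep k A) : A ⊗[k] (A ⊗[k] A) →ₐ[k] Module.End k (X.V ⊗[k] (Y.V ⊗[k] Z.V)) :=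
  Module.endTensorEndAlgHom.comp (Algebra.TensorProduct.map X.ρ (act₂ Y Z))

lemma act₃_tmul (X Y Z : FinRep k A) (a : A) (t : A ⊗[k] A) :
    act₃ X Y Z (a ⊗ₜ t) = TensorProduct.map (X.ρ a) (act₂ Y Z t) := by
  rw [act₃, AlgHom.comp_apply, Algebra.TensorProduct.map_tmul]
  exact Module.endTensorEndAlgHom_apply _ _

variable [WeakBialgebra k A]

/-- The vector space `Δ(1)(X ⊗ Y)` underlying the tensor product of two representations. -/
def tensorSpace (X Y : FinRep k A) : Submodule k (X.V ⊗[k] Y.V) :=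
  LinearMap.range (act₂ X Y (comul (1 : A)))

/-- The projection of `X ⊗ Y` onto `Δ(1)(X ⊗ Y)` given by the action of `Δ(1)`. -/
def tensorProj (X Y : FinRep k A) : X.V ⊗[k] Y.V →ₗ[k] tensorSpace X Y :=
  (act₂ X Y (comul (1 : A))).rangeRestrict

lemma act₂_one_coe (X Y : FinRep k A) (w : tensorSpace X Y) :
    act₂ X Y (comul (1 : A)) w = w := by
  obtain ⟨_, w, rfl⟩ := w
  exact (act₂_mul_apply _ _ _ _ _).trans (by rw [comul_one_mul_comul])

/-- The tensor product of two representations: `Δ(1)(X ⊗ Y)`, on which `h` acts by `Δ(h)`. -/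
def tensor (X Y : FinRep k A) : FinRep k A where
  V := tensorSpace X Y
  ρ := AlgHom.ofLinearMap
    { toFun := fun h => tensorProj X Y ∘ₗ act₂ X Y (comul h) ∘ₗ (tensorSpace X Y).subtype
      map_add' := fun a b => by ext; simp
      map_smul' := fun c a => by ext; simp }
    (LinearMap.ext fun w => Subtype.ext (by
      change act₂ X Y (comul 1) (act₂ X Y (comul 1) w) = w
      rw [act₂_one_coe, act₂_one_coe]))
    (fun a b => LinearMap.ext fun w => Subtype.ext (by
      change act₂ X Y (comul 1) (act₂ X Y (comul (a * b)) w) = act₂ X Y (comul 1)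
        (act₂ X Y (comul a) (act₂ X Y (comul 1) (act₂ X Y (comul b) w)))
      simp only [act₂_mul_apply, ← comul_mul, one_mul]))

/-- The inclusion of `Δ(1)(X ⊗ Y)` in `X ⊗ Y`. -/
def ι (X Y : FinRep k A) : (tensor X Y).V →ₗ[k] X.V ⊗[k] Y.V := (tensorSpace X Y).subtype

/-- The projection of `X ⊗ Y` onto `Δ(1)(X ⊗ Y)`. -/
def π (X Y : FinRep k A) : X.V ⊗[k] Y.V →ₗ[k] (tensor X Y).V := tensorProj X Y

lemma ι_injective (X Y : FinRep k A) : Function.Injective (ι X Y) := Subtype.val_injective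

lemma ι_π (X Y : FinRep k A) (w : X.V ⊗[k] Y.V) : ι X Y (π X Y w) = act₂ X Y (comul (1 : A)) w :=
  rfl

lemma act₂_one_ι (X Y : FinRep k A) (w : (tensor X Y).V) :
    act₂ X Y (comul (1 : A)) (ι X Y w) = ι X Y w := act₂_one_coe X Y w

lemma π_ι (X Y : FinRep k A) (w : (tensor X Y).V) : π X Y (ι X Y w) = w :=
  ι_injective X Y (act₂_one_ι X Y w)

lemma ι_ρ (X Y : FinRep k A) (a : A) (w : (tensor X Y).V) :
    ι X Y ((tensor X Y).ρ a w) = act₂ X Y (comul a) (ι X Y w) := by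
  change act₂ X Y (comul (1 : A)) (act₂ X Y (comul a) (ι X Y w)) = _
  rw [act₂_mul_apply, comul_one_mul_comul]

/-- The tensor product of two morphisms: the restriction of `f ⊗ g`. -/
def tensorMap {X X' Y Y' : FinRep k A} (f : X ⟶ X') (g : Y ⟶ Y') : tensor X Y ⟶ tensor X' Y' where
  hom := π X' Y' ∘ₗ TensorProduct.map f.hom g.hom ∘ₗ ι X Y
  comm a v := by
    apply ι_injective
    rw [ι_ρ]
    simp only [LinearMap.comp_apply, ι_π, ι_ρ, act₂_natural, act₂_mul_apply, ← comul_mul, one_mul,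
      mul_one]

lemma ι_tensorMap {X X' Y Y' : FinRep k A} (f : X ⟶ X') (g : Y ⟶ Y') (w : (tensor X Y).V) :
    ι X' Y' ((tensorMap f g).hom w) = TensorProduct.map f.hom g.hom (ι X Y w) := by
  change act₂ X' Y' (comul (1 : A)) (TensorProduct.map f.hom g.hom (ι X Y w)) = _
  rw [← act₂_natural, act₂_one_ι]

/-! #### The associator -/

/-- `(X ⊗ Y) ⊗ Z` inside the tensor product of the three vector spaces. -/
def jL (X Y Z : FinRep k A) : (tensor (tensor X Y) Z).V →ₗ[k] (X.V ⊗[k] Y.V) ⊗[k] Z.V :=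
  (ι X Y).rTensor Z.V ∘ₗ ι (tensor X Y) Z

/-- `X ⊗ (Y ⊗ Z)` inside the tensor product of the three vector spaces. -/
def jR (X Y Z : FinRep k A) : (tensor X (tensor Y Z)).V →ₗ[k] X.V ⊗[k] (Y.V ⊗[k] Z.V) :=
  (ι Y Z).lTensor X.V ∘ₗ ι X (tensor Y Z)

/-- The projection onto `(X ⊗ Y) ⊗ Z`. -/
def pL (X Y Z : FinRep k A) : (X.V ⊗[k] Y.V) ⊗[k] Z.V →ₗ[k] (tensor (tensor X Y) Z).V :=
  π (tensor X Y) Z ∘ₗ (π X Y).rTensor Z.V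

/-- The projection onto `X ⊗ (Y ⊗ Z)`. -/
def pR (X Y Z : FinRep k A) : X.V ⊗[k] (Y.V ⊗[k] Z.V) →ₗ[k] (tensor X (tensor Y Z)).V :=
  π X (tensor Y Z) ∘ₗ (π Y Z).lTensor X.V

variable (X Y Z : FinRep k A)

lemma π_comp_ι : π X Y ∘ₗ ι X Y = LinearMap.id := LinearMap.ext (π_ι X Y)

lemma pL_jL (w) : pL X Y Z (jL X Y Z w) = w := by
  change π (tensor X Y) Z ((π X Y).rTensor Z.V ((ι X Y).rTensor Z.V (ι (tensor X Y) Z w))) = w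
  rw [← LinearMap.rTensor_comp_apply, π_comp_ι, LinearMap.rTensor_id_apply, π_ι]

lemma pR_jR (w) : pR X Y Z (jR X Y Z w) = w := by
  change π X (tensor Y Z) ((π Y Z).lTensor X.V ((ι Y Z).lTensor X.V (ι X (tensor Y Z) w))) = w
  rw [← LinearMap.lTensor_comp_apply, π_comp_ι, LinearMap.lTensor_id_apply, π_ι]

lemma lTensor_ι_act₂ (t : A ⊗[k] A) (w : X.V ⊗[k] (tensor Y Z).V) :
    (ι Y Z).lTensor X.V (act₂ X (tensor Y Z) t w) =
      act₃ X Y Z (comul.lTensor A t) ((ι Y Z).lTensor X.V w) := by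
  induction w with
  | zero => simp
  | add w w' h h' => simp only [map_add, h, h']
  | tmul x y =>
    induction t with
    | zero => simp
    | add w w' h h' => simp only [map_add, LinearMap.add_apply, h, h']
    | tmul a b =>
      simp only [act₂_tmul, TensorProduct.map_tmul, LinearMap.lTensor_tmul, act₃_tmul]
      rw [ι_ρ]

lemma rTensor_ι_act₂ (t : A ⊗[k] A) (w : (tensor X Y).V ⊗[k] Z.V) :
    TensorProduct.assoc k _ _ _ ((ι X Y).rTensor Z.V (act₂ (tensor X Y) Z t w)) =
      act₃ X Y Z (TensorProduct.assoc k _ _ _ (comul.rTensor A t))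
        (TensorProduct.assoc k _ _ _ ((ι X Y).rTensor Z.V w)) := by
  induction w with
  | zero => simp
  | add w w' h h' => simp only [map_add, h, h']
  | tmul x z =>
    induction t with
    | zero => simp
    | add w w' h h' => simp only [map_add, LinearMap.add_apply, h, h']
    | tmul a b =>
      simp only [act₂_tmul, TensorProduct.map_tmul, LinearMap.rTensor_tmul]
      rw [ι_ρ]
      generalize comul (R := k) a = r
      generalize ι X Y x = v
      induction r with
      | zero => simp
      | add w w' h h' => simp only [map_add, LinearMap.add_apply, TensorProduct.add_tmul, h, h']
      | tmul p q =>
        induction v with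
        | zero => simp
        | add w w' h h' => simp only [map_add, TensorProduct.add_tmul, h, h']
        | tmul x y => simp [act₃_tmul]

lemma jR_pR (w) : jR X Y Z (pR X Y Z w) = act₃ X Y Z (comul.lTensor A (comul (1 : A))) w := by
  change (ι Y Z).lTensor X.V (act₂ X (tensor Y Z) (comul (1 : A)) ((π Y Z).lTensor X.V w)) = _
  rw [lTensor_ι_act₂]
  generalize comul (R := k) (1 : A) = t
  induction w with
  | zero => simp
  | add w w' h h' => simp only [map_add, h, h']
  | tmul x y =>
    induction t with
    | zero => simp
    | add w w' h h' => simp only [map_add, LinearMap.add_apply, h, h']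
    | tmul a b =>
      simp only [LinearMap.lTensor_tmul, act₃_tmul, TensorProduct.map_tmul, ι_π, act₂_mul_apply,
        comul_mul_comul_one]

lemma jL_pL (w) : TensorProduct.assoc k _ _ _ (jL X Y Z (pL X Y Z w)) =
    act₃ X Y Z (comul.lTensor A (comul (1 : A))) (TensorProduct.assoc k _ _ _ w) := by
  change TensorProduct.assoc k _ _ _
    ((ι X Y).rTensor Z.V (act₂ (tensor X Y) Z (comul (1 : A)) ((π X Y).rTensor Z.V w))) = _
  rw [← coassoc_one]
  generalize comul (R := k) (1 : A) = t
  induction w with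
  | zero => simp
  | add w w' h h' => simp only [map_add, h, h']
  | tmul v z =>
    induction t with
    | zero => simp
    | add w w' h h' => simp only [map_add, LinearMap.add_apply, h, h']
    | tmul a b =>
      simp only [LinearMap.rTensor_tmul, act₂_tmul, TensorProduct.map_tmul]
      rw [ι_ρ, ι_π, act₂_mul_apply, comul_mul_comul_one]
      generalize comul (R := k) a = r
      induction r with
      | zero => simp
      | add w w' h h' => simp only [map_add, LinearMap.add_apply, TensorProduct.add_tmul, h, h']
      | tmul p q =>
        induction v with
        | zero => simp
        | add w w' h h' => simp only [map_add, TensorProduct.add_tmul, h, h']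
        | tmul x y => simp [act₃_tmul]

lemma jR_pR_jL (w) : jR X Y Z (pR X Y Z (TensorProduct.assoc k _ _ _ (jL X Y Z w))) =
    TensorProduct.assoc k _ _ _ (jL X Y Z w) := by
  rw [jR_pR, ← jL_pL, pL_jL]

lemma jL_pL_jR (w) : jL X Y Z (pL X Y Z ((TensorProduct.assoc k _ _ _).symm (jR X Y Z w))) =
    (TensorProduct.assoc k _ _ _).symm (jR X Y Z w) := by
  rw [LinearEquiv.eq_symm_apply, jL_pL, LinearEquiv.apply_symm_apply, ← jR_pR, pR_jR]

lemma jR_injective : Function.Injective (jR X Y Z) :=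
  Function.LeftInverse.injective (pR_jR X Y Z)

lemma jL_ρ (a : A) (w : (tensor (tensor X Y) Z).V) :
    TensorProduct.assoc k _ _ _ (jL X Y Z ((tensor (tensor X Y) Z).ρ a w)) =
    act₃ X Y Z (comul.lTensor A (comul a)) (TensorProduct.assoc k _ _ _ (jL X Y Z w)) := by
  change TensorProduct.assoc k _ _ _ ((ι X Y).rTensor Z.V
    (ι (tensor X Y) Z ((tensor (tensor X Y) Z).ρ a w))) = _
  rw [ι_ρ, rTensor_ι_act₂, coassoc_apply]
  rfl

lemma jR_ρ (a : A) (w : (tensor X (tensor Y Z)).V) : jR X Y Z ((tensor X (tensor Y Z)).ρ a w) =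
    act₃ X Y Z (comul.lTensor A (comul a)) (jR X Y Z w) := by
  change (ι Y Z).lTensor X.V (ι X (tensor Y Z) ((tensor X (tensor Y Z)).ρ a w)) = _
  rw [ι_ρ, lTensor_ι_act₂]
  rfl

/-- The associator, induced by that of vector spaces. -/
def assocIso : tensor (tensor X Y) Z ≅ tensor X (tensor Y Z) :=
  mkIso
    { hom := pR X Y Z ∘ₗ (TensorProduct.assoc k _ _ _).toLinearMap ∘ₗ jL X Y Z
      comm := fun a w => jR_injective X Y Z (by
        rw [jR_ρ]
        simp only [LinearMap.comp_apply, LinearEquiv.coe_coe]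
        rw [jR_pR_jL, jL_ρ, jR_pR_jL]) }
    (pL X Y Z ∘ₗ (TensorProduct.assoc k _ _ _).symm.toLinearMap ∘ₗ jR X Y Z)
    (LinearMap.ext fun w => by
      simp only [LinearMap.comp_apply, LinearEquiv.coe_coe, LinearMap.id_apply]
      rw [jR_pR_jL, LinearEquiv.symm_apply_apply, pL_jL])
    (LinearMap.ext fun w => by
      simp only [LinearMap.comp_apply, LinearEquiv.coe_coe, LinearMap.id_apply]
      rw [jL_pL_jR, LinearEquiv.apply_symm_apply, pR_jR])

lemma jR_assocIso (w) : jR X Y Z ((assocIso X Y Z).hom.hom w) =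
    TensorProduct.assoc k _ _ _ (jL X Y Z w) :=
  jR_pR_jL X Y Z w

/-! #### The unit object -/

variable (k A) in
/-- The target subalgebra of `A`, as a subspace: the image of `ε_t`. -/
def targetSpace : Submodule k A := LinearMap.range (εt k A)

lemma εt_coe (z : targetSpace k A) : εt k A z = z := by
  obtain ⟨_, a, rfl⟩ := z
  exact εt_εt k a

variable [FiniteDimensional k A]

variable (k A) in
/-- The unit object: the target subalgebra of `A` with the action `h · z = ε_t(hz)`. -/
def tensorUnit : FinRep k A where
  V := targetSpace k A
  ρ := AlgHom.ofLinearMap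
    { toFun := fun h =>
        (εt k A).rangeRestrict ∘ₗ LinearMap.mulLeft k h ∘ₗ (targetSpace k A).subtype
      map_add' := fun a b => LinearMap.ext fun z => Subtype.ext (by
        change εt k A ((a + b) * z) = εt k A (a * z) + εt k A (b * z)
        rw [add_mul, map_add])
      map_smul' := fun c a => LinearMap.ext fun z => Subtype.ext (by
        change εt k A ((c • a) * z) = c • εt k A (a * z)
        rw [smul_mul_assoc, map_smul]) }
    (LinearMap.ext fun z => Subtype.ext (by
      change εt k A (1 * z) = z
      rw [one_mul, εt_coe]))
    (fun a b => LinearMap.ext fun z => Subtype.ext (by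
      change εt k A (a * b * z) = εt k A (a * εt k A (b * z))
      rw [εt_mul_εt, mul_assoc]))

variable (k A) in
/-- The inclusion of the unit object in `A`. -/
def incl : (tensorUnit k A).V →ₗ[k] A := (targetSpace k A).subtype

variable (k A) in
/-- The target map with values in the unit object. -/
def εt' : A →ₗ[k] (tensorUnit k A).V := (εt k A).rangeRestrict

lemma εt_incl (z : (tensorUnit k A).V) : εt k A (incl k A z) = incl k A z := εt_coe z

lemma εt'_εt (a : A) : εt' k A (εt k A a) = εt' k A a := Subtype.ext (εt_εt k a)

lemma tensorUnit_ρ (a : A) (z : (tensorUnit k A).V) :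
    (tensorUnit k A).ρ a z = εt' k A (a * incl k A z) := rfl

/-- `z ⊗ x ↦ z x` -/
def leftAct : (tensorUnit k A).V ⊗[k] X.V →ₗ[k] X.V :=
  TensorProduct.lift (X.ρ.toLinearMap ∘ₗ incl k A)

/-- `x ⊗ z ↦ ε(1₂ z) 1₁ x` -/
def rightAct : X.V ⊗[k] (tensorUnit k A).V →ₗ[k] X.V :=
  TensorProduct.lift (X.ρ.toLinearMap ∘ₗ εr k A ∘ₗ incl k A).flip

lemma leftAct_tmul (z : (tensorUnit k A).V) (x : X.V) :
    leftAct X (z ⊗ₜ x) = X.ρ (incl k A z) x := rfl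

lemma rightAct_tmul (z : (tensorUnit k A).V) (x : X.V) :
    rightAct X (x ⊗ₜ z) = X.ρ (εr k A (incl k A z)) x := rfl

variable (k A) in
/-- The restriction of the counit to the target subalgebra. -/
def unitCounit : (tensorUnit k A).V →ₗ[k] k := counit ∘ₗ incl k A

/-- `z ⊗ x ↦ ε(z) x` -/
def leftCounit : (tensorUnit k A).V ⊗[k] X.V →ₗ[k] X.V :=
  TensorProduct.lid k X.V ∘ₗ (unitCounit k A).rTensor X.V

/-- `x ⊗ z ↦ ε(z) x` -/
def rightCounit : X.V ⊗[k] (tensorUnit k A).V →ₗ[k] X.V :=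
  TensorProduct.rid k X.V ∘ₗ (unitCounit k A).lTensor X.V

lemma unitCounit_ρ (a : A) (z : (tensorUnit k A).V) :
    unitCounit k A ((tensorUnit k A).ρ a z) = counit (R := k) (a * incl k A z) :=
  counit_εt k _

lemma leftCounit_act₂ (h : A) (w : (tensorUnit k A).V ⊗[k] X.V) :
    leftCounit X (act₂ (tensorUnit k A) X (comul h) w) = X.ρ h (leftAct X w) := by
  induction w with
  | zero => simp
  | add w w' h h' => simp only [map_add, h, h']
  | tmul z x =>
    have key : ∀ t : A ⊗[k] A, leftCounit X (act₂ (tensorUnit k A) X t (z ⊗ₜ x)) =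
        X.ρ (counitL k A (t * (incl k A z ⊗ₜ 1))) x := by
      intro t
      induction t with
      | zero => simp
      | add w w' h h' => simp only [map_add, add_mul, LinearMap.add_apply, h, h']
      | tmul a b => simp [leftCounit, unitCounit_ρ, counitL_tmul]
    rw [key, counitL_comul_mul, leftAct_tmul, map_mul]
    rw [εt_incl]; rfl

lemma rightCounit_act₂ (h : A) (w : X.V ⊗[k] (tensorUnit k A).V) :
    rightCounit X (act₂ X (tensorUnit k A) (comul h) w) = X.ρ h (rightAct X w) := by
  induction w with
  | zero => simp
  | add w w' h h' => simp only [map_add, h, h']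
  | tmul x z =>
    have key : ∀ t : A ⊗[k] A, rightCounit X (act₂ X (tensorUnit k A) t (x ⊗ₜ z)) =
        X.ρ (counitR k A (t * (1 ⊗ₜ incl k A z))) x := by
      intro t
      induction t with
      | zero => simp
      | add w w' h h' => simp only [map_add, add_mul, LinearMap.add_apply, h, h']
      | tmul a b => simp [rightCounit, unitCounit_ρ, counitR_tmul]
    rw [key, counitR_comul_mul, rightAct_tmul, map_mul]
    rfl

lemma leftAct_ι (w) : leftAct X (ι (tensorUnit k A) X w) = leftCounit X (ι (tensorUnit k A) X w) := by
  have h := leftCounit_act₂ X 1 (ι (tensorUnit k A) X w)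
  rw [act₂_one_ι, map_one] at h
  exact h.symm

lemma rightAct_ι (w) :
    rightAct X (ι X (tensorUnit k A) w) = rightCounit X (ι X (tensorUnit k A) w) := by
  have h := rightCounit_act₂ X 1 (ι X (tensorUnit k A) w)
  rw [act₂_one_ι, map_one] at h
  exact h.symm

variable (k A) in
/-- The unit element of the target subalgebra. -/
def oneT : (tensorUnit k A).V := εt' k A 1

lemma incl_oneT : incl k A (oneT k A) = 1 := εt_one k

lemma oneT_ρ (a : A) : (tensorUnit k A).ρ a (oneT k A) = εt' k A a :=
  by rw [tensorUnit_ρ, incl_oneT, mul_one]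

lemma act₂_oneT_left (w : (tensorUnit k A).V ⊗[k] X.V) :
    act₂ (tensorUnit k A) X (comul (1 : A)) (oneT k A ⊗ₜ leftAct X w) =
      act₂ (tensorUnit k A) X (comul (1 : A)) w := by
  induction w with
  | zero => simp
  | add w w' h h' => simp only [map_add, TensorProduct.tmul_add, h, h']
  | tmul z x =>
    -- `a ⊗ b ↦ a ⊗ b x`
    let Q : (tensorUnit k A).V ⊗[k] A →ₗ[k] (tensorUnit k A).V ⊗[k] X.V :=
      (X.ρ.toLinearMap.flip x).lTensor _
    have k1 : ∀ t : A ⊗[k] A, act₂ (tensorUnit k A) X t (oneT k A ⊗ₜ leftAct X (z ⊗ₜ x)) =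
        Q ((εt' k A).rTensor A ((LinearMap.mulRight k (incl k A z)).lTensor A
          ((εt k A).rTensor A t))) := by
      intro t
      induction t with
      | zero => simp
      | add w w' h h' => simp only [map_add, LinearMap.add_apply, h, h']
      | tmul a b =>
        simp only [act₂_tmul, TensorProduct.map_tmul, oneT_ρ, leftAct_tmul,
          LinearMap.rTensor_tmul, LinearMap.lTensor_tmul, εt'_εt, LinearMap.mulRight_apply]
        change _ = εt' k A a ⊗ₜ X.ρ (b * _) x
        rw [map_mul]; rfl
    have k2 : ∀ t : A ⊗[k] A, act₂ (tensorUnit k A) X t (z ⊗ₜ x) =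
        Q ((εt' k A).rTensor A ((εt k A).rTensor A (t * (incl k A z ⊗ₜ 1)))) := by
      intro t
      induction t with
      | zero => simp
      | add w w' h h' => simp only [map_add, add_mul, LinearMap.add_apply, h, h']
      | tmul a b =>
        simp only [Algebra.TensorProduct.tmul_mul_tmul, act₂_tmul, TensorProduct.map_tmul,
          LinearMap.rTensor_tmul, εt'_εt, mul_one]
        rfl
    have hz : comul (R := k) (incl k A z) =
        comul (1 : A) * (incl k A z ⊗ₜ 1) := by
      rw [← εt_incl, ← comul_εt]
    rw [k1, k2, ← hz, ← rTensor_εt_comul]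

lemma act₂_oneT_right (w : X.V ⊗[k] (tensorUnit k A).V) :
    act₂ X (tensorUnit k A) (comul (1 : A)) (rightAct X w ⊗ₜ oneT k A) =
      act₂ X (tensorUnit k A) (comul (1 : A)) w := by
  induction w with
  | zero => simp
  | add w w' h h' => simp only [map_add, TensorProduct.add_tmul, h, h']
  | tmul x z =>
    let Q : A ⊗[k] A →ₗ[k] X.V ⊗[k] (tensorUnit k A).V :=
      TensorProduct.map (X.ρ.toLinearMap.flip x) (εt' k A)
    have k1 : ∀ t : A ⊗[k] A, act₂ X (tensorUnit k A) t (rightAct X (x ⊗ₜ z) ⊗ₜ oneT k A) =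
        Q (t * (εr k A (incl k A z) ⊗ₜ 1)) := by
      intro t
      induction t with
      | zero => simp
      | add w w' h h' => simp only [map_add, add_mul, LinearMap.add_apply, h, h']
      | tmul a b =>
        simp only [act₂_tmul, TensorProduct.map_tmul, oneT_ρ, rightAct_tmul,
          Algebra.TensorProduct.tmul_mul_tmul, mul_one]
        change _ = X.ρ (a * _) x ⊗ₜ εt' k A b
        rw [map_mul]; rfl
    have k2 : ∀ t : A ⊗[k] A, act₂ X (tensorUnit k A) t (x ⊗ₜ z) =
        Q ((εt k A ∘ₗ LinearMap.mulRight k (incl k A z)).lTensor A t) := by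
      intro t
      induction t with
      | zero => simp
      | add w w' h h' => simp only [map_add, LinearMap.add_apply, h, h']
      | tmul a b =>
        simp only [act₂_tmul, TensorProduct.map_tmul, LinearMap.lTensor_tmul, Q,
          LinearMap.comp_apply, LinearMap.mulRight_apply, εt'_εt]
        rfl
    rw [k1, k2, lTensor_εt_comul_one]

/-- The left unit constraint `z ⊗ x ↦ z x`. -/
def leftIso : tensor (tensorUnit k A) X ≅ X :=
  mkIso
    { hom := leftAct X ∘ₗ ι (tensorUnit k A) X
      comm := fun a w => by
        simp only [LinearMap.comp_apply]
        rw [leftAct_ι, ι_ρ, leftCounit_act₂] }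
    (π (tensorUnit k A) X ∘ₗ TensorProduct.mk k _ _ (oneT k A))
    (LinearMap.ext fun w => ι_injective _ _ (by
      simp only [LinearMap.comp_apply, LinearMap.id_apply, TensorProduct.mk_apply]
      rw [ι_π, act₂_oneT_left, act₂_one_ι]))
    (LinearMap.ext fun x => by
      simp only [LinearMap.comp_apply, LinearMap.id_apply, TensorProduct.mk_apply]
      rw [leftAct_ι, ι_π, leftCounit_act₂, leftAct_tmul, incl_oneT]
      simp)

/-- The right unit constraint `x ⊗ z ↦ ε(z) x = ε(1₂ z) 1₁ x` (for `x ⊗ z ∈ Δ(1)(X ⊗ A_t)`). -/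
def rightIso : tensor X (tensorUnit k A) ≅ X :=
  mkIso
    { hom := rightAct X ∘ₗ ι X (tensorUnit k A)
      comm := fun a w => by
        simp only [LinearMap.comp_apply]
        rw [rightAct_ι, ι_ρ, rightCounit_act₂] }
    (π X (tensorUnit k A) ∘ₗ (TensorProduct.mk k _ _).flip (oneT k A))
    (LinearMap.ext fun w => ι_injective _ _ (by
      simp only [LinearMap.comp_apply, LinearMap.id_apply, TensorProduct.mk_apply,
        LinearMap.flip_apply]
      rw [ι_π, act₂_oneT_right, act₂_one_ι]))
    (LinearMap.ext fun x => by
      simp only [LinearMap.comp_apply, LinearMap.id_apply, TensorProduct.mk_apply,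
        LinearMap.flip_apply]
      rw [rightAct_ι, ι_π, rightCounit_act₂, rightAct_tmul, incl_oneT, εr_one]
      simp)

end monoidal
end FinRep

namespace FinRep
section monoidal
open Coalgebra WeakBialgebra
variable {k A : Type u} [Field k] [Ring A] [Algebra k A] [WeakBialgebra k A]
variable (X Y Z : FinRep k A)

lemma tensorMap_id : tensorMap (𝟙 X) (𝟙 Y) = 𝟙 (tensor X Y) :=
  hom_ext (LinearMap.ext fun w => ι_injective _ _ (by
    rw [ι_tensorMap]; simp))

lemma tensorMap_comp {X X' X'' Y Y' Y'' : FinRep k A} (f : X ⟶ X') (f' : X' ⟶ X'')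
    (g : Y ⟶ Y') (g' : Y' ⟶ Y'') :
    tensorMap f g ≫ tensorMap f' g' = tensorMap (f ≫ f') (g ≫ g') :=
  hom_ext (LinearMap.ext fun w => ι_injective _ _ (by
    rw [comp_hom, LinearMap.comp_apply, ι_tensorMap, ι_tensorMap, ι_tensorMap]
    rw [comp_hom, comp_hom, TensorProduct.map_comp, LinearMap.comp_apply]))

lemma jL_apply (w) : jL X Y Z w = (ι X Y).rTensor Z.V (ι (tensor X Y) Z w) := rfl
lemma jR_apply (w) : jR X Y Z w = (ι Y Z).lTensor X.V (ι X (tensor Y Z) w) := rfl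

lemma rTensor_ι_map {X X' Y Y' Z Z' : FinRep k A} (f : X ⟶ X') (g : Y ⟶ Y') (h : Z ⟶ Z') (w) :
    (ι X' Y').rTensor Z'.V (TensorProduct.map (tensorMap f g).hom h.hom w) =
      TensorProduct.map (TensorProduct.map f.hom g.hom) h.hom ((ι X Y).rTensor Z.V w) := by
  induction w with
  | zero => simp
  | add w w' h h' => simp only [map_add, h, h']
  | tmul x z => simp [ι_tensorMap]

lemma lTensor_ι_map {X X' Y Y' Z Z' : FinRep k A} (f : X ⟶ X') (g : Y ⟶ Y') (h : Z ⟶ Z') (w) :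
    (ι Y' Z').lTensor X'.V (TensorProduct.map f.hom (tensorMap g h).hom w) =
      TensorProduct.map f.hom (TensorProduct.map g.hom h.hom) ((ι Y Z).lTensor X.V w) := by
  induction w with
  | zero => simp
  | add w w' h h' => simp only [map_add, h, h']
  | tmul x z => simp [ι_tensorMap]

lemma assocIso_natural {X X' Y Y' Z Z' : FinRep k A} (f : X ⟶ X') (g : Y ⟶ Y') (h : Z ⟶ Z') :
    tensorMap (tensorMap f g) h ≫ (assocIso X' Y' Z').hom =
      (assocIso X Y Z).hom ≫ tensorMap f (tensorMap g h) :=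
  hom_ext (LinearMap.ext fun w => jR_injective _ _ _ (by
    simp only [comp_hom, LinearMap.comp_apply]
    rw [jR_assocIso, jL_apply, ι_tensorMap, rTensor_ι_map, ← jL_apply,
      jR_apply, ι_tensorMap, lTensor_ι_map, ← jR_apply, jR_assocIso]
    generalize jL X Y Z w = v
    induction v with
    | zero => simp
    | add w w' h h' => simp only [map_add, h, h']
    | tmul v z =>
      induction v with
      | zero => simp
      | add w w' h h' => simp only [map_add, TensorProduct.add_tmul, h, h']
      | tmul x y => simp))

lemma pentagon_aux (W : FinRep k A) :
    tensorMap (assocIso W X Y).hom (𝟙 Z) ≫ (assocIso W (tensor X Y) Z).hom ≫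
      tensorMap (𝟙 W) (assocIso X Y Z).hom =
    (assocIso (tensor W X) Y Z).hom ≫ (assocIso W X (tensor Y Z)).hom :=
  hom_ext (LinearMap.ext fun w => by
    apply ι_injective
    have inj : Function.Injective ((jR X Y Z).lTensor W.V) :=
      Function.LeftInverse.injective (g := (pR X Y Z).lTensor W.V) fun v => by
        rw [← LinearMap.lTensor_comp_apply,
          show pR X Y Z ∘ₗ jR X Y Z = LinearMap.id from LinearMap.ext (pR_jR X Y Z),
          LinearMap.lTensor_id_apply]
    apply inj
    simp only [comp_hom, LinearMap.comp_apply]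
    rw [ι_tensorMap]
    -- the left-hand side
    have h1 : ∀ v, (jR X Y Z).lTensor W.V (TensorProduct.map (Hom.hom (𝟙 W))
        (assocIso X Y Z).hom.hom v) =
        (TensorProduct.assoc k X.V Y.V Z.V).toLinearMap.lTensor W.V
          (((ι X Y).rTensor Z.V).lTensor W.V ((ι (tensor X Y) Z).lTensor W.V v)) := by
      intro v
      induction v with
      | zero => simp
      | add w w' h h' => simp only [map_add, h, h']
      | tmul x z => simp [jR_assocIso, jL_apply]
    have h2 : ∀ v, ((ι X Y).rTensor Z.V).lTensor W.V (TensorProduct.assoc k _ _ _ v) =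
        TensorProduct.assoc k _ _ _ (((ι X Y).lTensor W.V).rTensor Z.V v) := by
      intro v
      induction v with
      | zero => simp
      | add w w' h h' => simp only [map_add, h, h']
      | tmul v z =>
        induction v with
        | zero => simp
        | add w w' h h' => simp only [map_add, TensorProduct.add_tmul, h, h']
        | tmul x y => simp
    have h3 : ∀ v, ((ι X Y).lTensor W.V).rTensor Z.V ((ι W (tensor X Y)).rTensor Z.V
        (TensorProduct.map (assocIso W X Y).hom.hom (Hom.hom (𝟙 Z)) v)) =
        (TensorProduct.assoc k W.V X.V Y.V).toLinearMap.rTensor Z.V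
          (((ι W X).rTensor Y.V).rTensor Z.V ((ι (tensor W X) Y).rTensor Z.V v)) := by
      intro v
      induction v with
      | zero => simp
      | add w w' h h' => simp only [map_add, h, h']
      | tmul x z =>
        have := jR_assocIso W X Y x
        rw [jR_apply, jL_apply] at this
        simp [this]
    rw [h1, ← jR_apply, jR_assocIso, h2, jL_apply, ι_tensorMap, h3, ← jL_apply]
    -- the right-hand side
    have h4 : ∀ v, (jR X Y Z).lTensor W.V v = ((ι Y Z).lTensor X.V).lTensor W.V
        ((ι X (tensor Y Z)).lTensor W.V v) := by
      intro v
      rw [← LinearMap.lTensor_comp_apply]; rfl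
    have h5 : ∀ v, ((ι Y Z).lTensor X.V).lTensor W.V (TensorProduct.assoc k _ _ _
        ((ι W X).rTensor (tensor Y Z).V v)) =
        TensorProduct.assoc k _ _ _ ((ι W X).rTensor (Y.V ⊗[k] Z.V)
          ((ι Y Z).lTensor (tensor W X).V v)) := by
      intro v
      induction v with
      | zero => simp
      | add w w' h h' => simp only [map_add, h, h']
      | tmul v z =>
        simp only [LinearMap.rTensor_tmul, LinearMap.lTensor_tmul]
        generalize ι W X v = v
        induction v with
        | zero => simp
        | add w w' h h' => simp only [map_add, TensorProduct.add_tmul, h, h']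
        | tmul x y => simp
    rw [h4, ← jR_apply, jR_assocIso, jL_apply W X (tensor Y Z), h5, ← jR_apply, jR_assocIso]
    generalize jL (tensor W X) Y Z w = v
    induction v with
    | zero => simp
    | add w w' h h' => simp only [map_add, h, h']
    | tmul v z =>
      induction v with
      | zero => simp
      | add w w' h h' => simp only [map_add, TensorProduct.add_tmul, h, h']
      | tmul v y =>
        simp only [LinearMap.rTensor_tmul, TensorProduct.assoc_tmul]
        generalize ι W X v = v
        induction v with
        | zero => simp
        | add w w' h h' => simp only [map_add, TensorProduct.add_tmul, h, h']
        | tmul x y => simp)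

variable [FiniteDimensional k A]

lemma leftIso_apply (w) : (leftIso X).hom.hom w = leftCounit X (ι _ _ w) := leftAct_ι X w
lemma rightIso_apply (w) : (rightIso X).hom.hom w = rightCounit X (ι _ _ w) := rightAct_ι X w

lemma leftIso_natural {X Y : FinRep k A} (f : X ⟶ Y) :
    tensorMap (𝟙 (tensorUnit k A)) f ≫ (leftIso Y).hom = (leftIso X).hom ≫ f :=
  hom_ext (LinearMap.ext fun w => by
    simp only [comp_hom, LinearMap.comp_apply]
    rw [leftIso_apply, leftIso_apply, ι_tensorMap]
    generalize ι _ _ w = v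
    induction v with
    | zero => simp
    | add w w' h h' => simp only [map_add, h, h']
    | tmul z x => simp [leftCounit])

lemma rightIso_natural {X Y : FinRep k A} (f : X ⟶ Y) :
    tensorMap f (𝟙 (tensorUnit k A)) ≫ (rightIso Y).hom = (rightIso X).hom ≫ f :=
  hom_ext (LinearMap.ext fun w => by
    simp only [comp_hom, LinearMap.comp_apply]
    rw [rightIso_apply, rightIso_apply, ι_tensorMap]
    generalize ι _ _ w = v
    induction v with
    | zero => simp
    | add w w' h h' => simp only [map_add, h, h']
    | tmul z x => simp [rightCounit])

lemma triangle_aux : (assocIso X (tensorUnit k A) Y).hom ≫ tensorMap (𝟙 X) (leftIso Y).hom =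
    tensorMap (rightIso X).hom (𝟙 Y) :=
  hom_ext (LinearMap.ext fun w => ι_injective _ _ (by
    simp only [comp_hom, LinearMap.comp_apply]
    rw [ι_tensorMap, ι_tensorMap]
    have h1 : ∀ v, TensorProduct.map (Hom.hom (𝟙 X)) (leftIso Y).hom.hom v =
        (leftCounit Y).lTensor X.V ((ι _ _).lTensor X.V v) := by
      intro v
      induction v with
      | zero => simp
      | add w w' h h' => simp only [map_add, h, h']
      | tmul x z => simp [leftIso_apply]
    have h2 : ∀ v, TensorProduct.map (rightIso X).hom.hom (Hom.hom (𝟙 Y)) v =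
        (rightCounit X).rTensor Y.V ((ι _ _).rTensor Y.V v) := by
      intro v
      induction v with
      | zero => simp
      | add w w' h h' => simp only [map_add, h, h']
      | tmul x z => simp [rightIso_apply]
    rw [h1, h2, ← jR_apply, ← jL_apply, jR_assocIso]
    generalize jL _ _ _ w = v
    induction v with
    | zero => simp
    | add w w' h h' => simp only [map_add, h, h']
    | tmul v z =>
      induction v with
      | zero => simp
      | add w w' h h' => simp only [map_add, TensorProduct.add_tmul, h, h']
      | tmul x y => simp [leftCounit, rightCounit, TensorProduct.smul_tmul']))

/-- The monoidal category of finite-dimensional representations of a finite-dimensional weak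
bialgebra. -/
instance : MonoidalCategory (FinRep k A) where
  tensorObj := tensor
  tensorHom f g := tensorMap f g
  whiskerLeft X _ _ f := tensorMap (𝟙 X) f
  whiskerRight f Y := tensorMap f (𝟙 Y)
  tensorUnit := tensorUnit k A
  associator X Y Z := assocIso X Y Z
  leftUnitor X := leftIso X
  rightUnitor X := rightIso X
  tensorHom_def f g := by rw [tensorMap_comp, Category.comp_id, Category.id_comp]
  id_tensorHom_id := tensorMap_id
  tensorHom_comp_tensorHom f g f' g' := tensorMap_comp f f' g g'
  whiskerLeft_id := tensorMap_id
  id_whiskerRight := tensorMap_id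
  associator_naturality := assocIso_natural
  leftUnitor_naturality := leftIso_natural
  rightUnitor_naturality := rightIso_natural
  pentagon W X Y Z := pentagon_aux X Y Z W
  triangle X Y := triangle_aux X Y

end monoidal
end FinRep

/-! ### Groupoids and double groupoids -/

/-- A (small) groupoid with set of arrows `Arr` and set of objects `Obj`. The composition `a b`
is written in diagrammatic order and is defined when `tgt a = src b`; the values of `comp` at
other pairs are irrelevant. -/
structure GroupoidOn (Arr Obj : Type u) where
  src : Arr → Obj
  tgt : Arr → Obj
  /-- identity arrows -/
  one : Obj → Arr
  comp : Arr → Arr → Arr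
  inv : Arr → Arr
  src_one : ∀ p, src (one p) = p
  tgt_one : ∀ p, tgt (one p) = p
  src_comp : ∀ a b, tgt a = src b → src (comp a b) = src a
  tgt_comp : ∀ a b, tgt a = src b → tgt (comp a b) = tgt b
  one_comp : ∀ a, comp (one (src a)) a = a
  comp_one : ∀ a, comp a (one (tgt a)) = a
  assoc : ∀ a b c, tgt a = src b → tgt b = src c → comp (comp a b) c = comp a (comp b c)
  src_inv : ∀ a, src (inv a) = tgt a
  tgt_inv : ∀ a, tgt (inv a) = src a
  comp_inv : ∀ a, comp a (inv a) = one (src a)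
  inv_comp : ∀ a, comp (inv a) a = one (tgt a)

namespace GroupoidOn

variable {Arr Obj : Type u} (G : GroupoidOn Arr Obj)

/-- A groupoid is connected if there is an arrow between any two objects. -/
def IsConnected : Prop := ∀ p q : Obj, ∃ a : Arr, G.src a = p ∧ G.tgt a = q

lemma inv_comp_cancel {a b : Arr} (h : G.tgt a = G.src b) : G.comp (G.inv a) (G.comp a b) = b := by
  rw [← G.assoc _ _ _ (G.tgt_inv a) h, G.inv_comp, h, G.one_comp]

lemma comp_inv_cancel {a b : Arr} (h : G.src a = G.src b) : G.comp a (G.comp (G.inv a) b) = b := by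
  rw [← G.assoc _ _ _ (G.src_inv a).symm ((G.tgt_inv a).trans h), G.comp_inv, h, G.one_comp]

lemma left_cancel {a b c : Arr} (h : G.tgt a = G.src b) (h' : G.tgt a = G.src c)
    (e : G.comp a b = G.comp a c) : b = c := by
  rw [← G.inv_comp_cancel h, e, G.inv_comp_cancel h']

lemma eq_inv {a b : Arr} (h : G.tgt a = G.src b) (e : G.comp a b = G.one (G.src a)) :
    b = G.inv a := by
  refine G.left_cancel h (G.src_inv a).symm ?_
  rw [e, G.comp_inv]

lemma inv_inv (a : Arr) : G.inv (G.inv a) = a := by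
  refine (G.eq_inv (G.tgt_inv a) ?_).symm
  rw [G.inv_comp, G.src_inv]

end GroupoidOn

/-- A double groupoid with boxes `B`, horizontal edges `H`, vertical edges `V` and points `P`. -/
structure DoubleGroupoid (B H V P : Type u) where
  /-- the groupoid `B ⇉ H`: vertical composition of boxes; source is top, target is bottom -/
  vBox : GroupoidOn B H
  /-- the groupoid `B ⇉ V`: horizontal composition of boxes; source is left, target is right -/
  hBox : GroupoidOn B V
  /-- the groupoid `H ⇉ P`: source is left, target is right -/
  hor : GroupoidOn H P
  /-- the groupoid `V ⇉ P`: source is top, target is bottom -/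
  ver : GroupoidOn V P
  nonempty : Nonempty P
  -- the four corners of a box
  top_left : ∀ A, ver.src (hBox.src A) = hor.src (vBox.src A)
  top_right : ∀ A, ver.src (hBox.tgt A) = hor.tgt (vBox.src A)
  bot_left : ∀ A, ver.tgt (hBox.src A) = hor.src (vBox.tgt A)
  bot_right : ∀ A, ver.tgt (hBox.tgt A) = hor.tgt (vBox.tgt A)
  -- boundaries of the compositions
  top_hcomp : ∀ A C, hBox.tgt A = hBox.src C →
    vBox.src (hBox.comp A C) = hor.comp (vBox.src A) (vBox.src C)
  bot_hcomp : ∀ A C, hBox.tgt A = hBox.src C →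
    vBox.tgt (hBox.comp A C) = hor.comp (vBox.tgt A) (vBox.tgt C)
  left_vcomp : ∀ A C, vBox.tgt A = vBox.src C →
    hBox.src (vBox.comp A C) = ver.comp (hBox.src A) (hBox.src C)
  right_vcomp : ∀ A C, vBox.tgt A = vBox.src C →
    hBox.tgt (vBox.comp A C) = ver.comp (hBox.tgt A) (hBox.tgt C)
  /-- the interchange law -/
  interchange : ∀ A C D E, hBox.tgt A = hBox.src C → hBox.tgt D = hBox.src E →
    vBox.tgt A = vBox.src D → vBox.tgt C = vBox.src E →
    vBox.comp (hBox.comp A C) (hBox.comp D E) = hBox.comp (vBox.comp A D) (vBox.comp C E)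
  -- boundaries of the identities
  left_vone : ∀ x, hBox.src (vBox.one x) = ver.one (hor.src x)
  right_vone : ∀ x, hBox.tgt (vBox.one x) = ver.one (hor.tgt x)
  top_hone : ∀ g, vBox.src (hBox.one g) = hor.one (ver.src g)
  bot_hone : ∀ g, vBox.tgt (hBox.one g) = hor.one (ver.tgt g)
  -- compatibilities of the identities
  vone_one : ∀ p, vBox.one (hor.one p) = hBox.one (ver.one p)
  hcomp_vone : ∀ x y, hor.tgt x = hor.src y →
    hBox.comp (vBox.one x) (vBox.one y) = vBox.one (hor.comp x y)
  vcomp_hone : ∀ f g, ver.tgt f = ver.src g →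
    vBox.comp (hBox.one f) (hBox.one g) = hBox.one (ver.comp f g)

/-- A vacant double groupoid: a double groupoid in which any horizontal edge `x` and vertical
edge `g` with `r(x) = t(g)` are the top and the right side of exactly one box. -/
structure VacantDoubleGroupoid (B H V P : Type u) extends DoubleGroupoid B H V P where
  vacant : ∀ (x : H) (g : V), hor.tgt x = ver.src g → ∃! A : B, vBox.src A = x ∧ hBox.tgt A = g

/-- A normalized 2-cocycle `(σ, τ)` on a double groupoid with values in `kˣ`. Only the values of
`σ` at vertically composable pairs and of `τ` at horizontally composable pairs are relevant. -/
structure DoubleGroupoid.Cocycle {B H V P : Type u} (T : DoubleGroupoid B H V P) (k : Type u)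
    [Field k] where
  σ : B → B → kˣ
  τ : B → B → kˣ
  σ_cocycle : ∀ A C D, T.vBox.tgt A = T.vBox.src C → T.vBox.tgt C = T.vBox.src D →
    σ A C * σ (T.vBox.comp A C) D = σ C D * σ A (T.vBox.comp C D)
  σ_vone_left : ∀ A, σ (T.vBox.one (T.vBox.src A)) A = 1
  σ_vone_right : ∀ A, σ A (T.vBox.one (T.vBox.tgt A)) = 1
  τ_cocycle : ∀ A C D, T.hBox.tgt A = T.hBox.src C → T.hBox.tgt C = T.hBox.src D →
    τ A C * τ (T.hBox.comp A C) D = τ C D * τ A (T.hBox.comp C D)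
  τ_hone_left : ∀ A, τ (T.hBox.one (T.hBox.src A)) A = 1
  τ_hone_right : ∀ A, τ A (T.hBox.one (T.hBox.tgt A)) = 1
  compat : ∀ A C D E, T.hBox.tgt A = T.hBox.src C → T.hBox.tgt D = T.hBox.src E →
    T.vBox.tgt A = T.vBox.src D → T.vBox.tgt C = T.vBox.src E →
    σ (T.hBox.comp A C) (T.hBox.comp D E) * τ (T.vBox.comp A D) (T.vBox.comp C E) =
      τ A C * τ D E * σ A D * σ C E

namespace VacantDoubleGroupoid

variable {B H V P : Type u} (T : VacantDoubleGroupoid B H V P)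

lemma top_hinv (A : B) : T.vBox.src (T.hBox.inv A) = T.hor.inv (T.vBox.src A) := by
  have h : T.hor.tgt (T.vBox.src A) = T.hor.src (T.vBox.src (T.hBox.inv A)) := by
    rw [← T.top_right, ← T.top_left, T.hBox.src_inv]
  apply T.hor.eq_inv h
  rw [← T.top_hcomp _ _ (T.hBox.src_inv A).symm, T.hBox.comp_inv, T.top_hone, T.top_left]

lemma bot_hinv (A : B) : T.vBox.tgt (T.hBox.inv A) = T.hor.inv (T.vBox.tgt A) := by
  have h : T.hor.tgt (T.vBox.tgt A) = T.hor.src (T.vBox.tgt (T.hBox.inv A)) := by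
    rw [← T.bot_right, ← T.bot_left, T.hBox.src_inv]
  apply T.hor.eq_inv h
  rw [← T.bot_hcomp _ _ (T.hBox.src_inv A).symm, T.hBox.comp_inv, T.bot_hone, T.bot_left]

lemma left_vinv (A : B) : T.hBox.src (T.vBox.inv A) = T.ver.inv (T.hBox.src A) := by
  have h : T.ver.tgt (T.hBox.src A) = T.ver.src (T.hBox.src (T.vBox.inv A)) := by
    rw [T.bot_left, T.top_left, T.vBox.src_inv]
  apply T.ver.eq_inv h
  rw [← T.left_vcomp _ _ (T.vBox.src_inv A).symm, T.vBox.comp_inv, T.left_vone, T.top_left]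

/-- A box is determined by its top and right sides. -/
lemma ext_top_right {A C : B} (h : T.vBox.src A = T.vBox.src C)
    (h' : T.hBox.tgt A = T.hBox.tgt C) : A = C :=
  (T.vacant (T.vBox.src C) (T.hBox.tgt C) (T.top_right C).symm).unique ⟨h, h'⟩ ⟨rfl, rfl⟩

/-- A box is determined by its top and left sides. -/
lemma ext_top_left {A C : B} (h : T.vBox.src A = T.vBox.src C)
    (h' : T.hBox.src A = T.hBox.src C) : A = C := by
  rw [← T.hBox.inv_inv A, ← T.hBox.inv_inv C]
  congr 1
  apply T.ext_top_right
  · rw [top_hinv, top_hinv, h]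
  · rw [T.hBox.tgt_inv, T.hBox.tgt_inv, h']

lemma exists_top_left (x : H) (f : V) (h : T.hor.src x = T.ver.src f) :
    ∃ A : B, T.vBox.src A = x ∧ T.hBox.src A = f := by
  obtain ⟨A, ⟨h1, h2⟩, -⟩ := T.vacant (T.hor.inv x) f (by rw [T.hor.tgt_inv, h])
  exact ⟨T.hBox.inv A, by rw [top_hinv, h1, T.hor.inv_inv], by rw [T.hBox.src_inv, h2]⟩

/-- Being a horizontal identity. -/
def IsHOne (A : B) : Prop := A = T.hBox.one (T.hBox.src A)

lemma isHOne_hone (g : V) : T.IsHOne (T.hBox.one g) := by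
  rw [IsHOne, T.hBox.src_one]

lemma isHOne_of_top {A : B} {p : P} (h : T.vBox.src A = T.hor.one p) : T.IsHOne A := by
  apply T.ext_top_left
  · rw [T.top_hone, T.top_left, h, T.hor.src_one]
  · rw [T.hBox.src_one]

variable {T}

lemma IsHOne.top {A : B} (h : T.IsHOne A) : ∃ p, T.vBox.src A = T.hor.one p :=
  ⟨_, by rw [h, T.top_hone]⟩

lemma IsHOne.bot {A : B} (h : T.IsHOne A) : ∃ p, T.vBox.tgt A = T.hor.one p :=
  ⟨_, by rw [h, T.bot_hone]⟩

lemma IsHOne.tgt {A : B} (h : T.IsHOne A) : T.hBox.tgt A = T.hBox.src A := by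
  conv_lhs => rw [h, T.hBox.tgt_one]

variable (T)

lemma isHOne_vcomp {A C : B} (h : T.vBox.tgt A = T.vBox.src C) :
    T.IsHOne (T.vBox.comp A C) ↔ T.IsHOne A ∧ T.IsHOne C := by
  constructor
  · intro hAC
    have hA : T.IsHOne A := by
      obtain ⟨p, hp⟩ := hAC.top
      rw [T.vBox.src_comp _ _ h] at hp
      exact T.isHOne_of_top hp
    refine ⟨hA, ?_⟩
    obtain ⟨p, hp⟩ := hA.bot
    exact T.isHOne_of_top (h.symm.trans hp)
  · rintro ⟨hA, -⟩
    obtain ⟨p, hp⟩ := hA.top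
    exact T.isHOne_of_top (p := p) (by rw [T.vBox.src_comp _ _ h, hp])

lemma eq_vone_of_hcomp {A C : B} {z : H} (h : T.hBox.tgt A = T.hBox.src C)
    (e : T.hBox.comp A C = T.vBox.one z) :
    A = T.vBox.one (T.vBox.src A) ∧ C = T.vBox.one (T.vBox.src C) := by
  have hl : T.hBox.src A = T.ver.one (T.hor.src z) := by
    rw [← T.left_vone, ← e, T.hBox.src_comp _ _ h]
  have hr : T.hBox.tgt C = T.ver.one (T.hor.tgt z) := by
    rw [← T.right_vone, ← e, T.hBox.tgt_comp _ _ h]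
  constructor
  · apply T.ext_top_left
    · rw [T.vBox.src_one]
    · rw [T.left_vone, ← T.top_left, hl, T.ver.src_one]
  · apply T.ext_top_right
    · rw [T.vBox.src_one]
    · rw [T.right_vone, ← T.top_right, hr, T.ver.src_one]

variable {T} {k : Type u} [Field k] (c : T.Cocycle k)

lemma τ_vone {x y : H} (h : T.hor.tgt x = T.hor.src y) :
    c.τ (T.vBox.one x) (T.vBox.one y) = 1 := by
  have hxy : T.hBox.tgt (T.vBox.one x) = T.hBox.src (T.vBox.one y) := by
    rw [T.right_vone, T.left_vone, h]
  have hx : ∀ x, T.vBox.tgt (T.vBox.one x) = T.vBox.src (T.vBox.one x) := fun x => by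
    rw [T.vBox.tgt_one, T.vBox.src_one]
  have hc : ∀ x, T.vBox.comp (T.vBox.one x) (T.vBox.one x) = T.vBox.one x := fun x => by
    conv_lhs => rw [← T.vBox.src_one x, T.vBox.src_one x]
    simpa only [T.vBox.src_one] using T.vBox.one_comp (T.vBox.one x)
  have hs : ∀ x, c.σ (T.vBox.one x) (T.vBox.one x) = 1 := fun x => by
    simpa only [T.vBox.src_one] using c.σ_vone_left (T.vBox.one x)
  have := c.compat _ _ _ _ hxy hxy (hx x) (hx y)
  rw [T.hcomp_vone _ _ h, hs, hs, hs, hc, hc, one_mul, mul_one, mul_one] at this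
  exact left_eq_mul.mp this

lemma σ_hone {f g : V} (h : T.ver.tgt f = T.ver.src g) :
    c.σ (T.hBox.one f) (T.hBox.one g) = 1 := by
  have hfg : T.vBox.tgt (T.hBox.one f) = T.vBox.src (T.hBox.one g) := by
    rw [T.bot_hone, T.top_hone, h]
  have hx : ∀ x, T.hBox.tgt (T.hBox.one x) = T.hBox.src (T.hBox.one x) := fun x => by
    rw [T.hBox.tgt_one, T.hBox.src_one]
  have hc : ∀ x, T.hBox.comp (T.hBox.one x) (T.hBox.one x) = T.hBox.one x := fun x => by
    simpa only [T.hBox.src_one] using T.hBox.one_comp (T.hBox.one x)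
  have hs : ∀ x, c.τ (T.hBox.one x) (T.hBox.one x) = 1 := fun x => by
    simpa only [T.hBox.src_one] using c.τ_hone_left (T.hBox.one x)
  have := c.compat _ _ _ _ (hx f) (hx g) hfg hfg
  rw [T.vcomp_hone _ _ h, hs, hs, hs, hc, hc, one_mul, one_mul, mul_one] at this
  exact left_eq_mul.mp this

lemma σ_isHOne {A C : B} (h : T.vBox.tgt A = T.vBox.src C) (hA : T.IsHOne A) (hC : T.IsHOne C) :
    c.σ A C = 1 := by
  rw [hA, hC]
  apply σ_hone
  rw [T.bot_left, T.top_left, h]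

end VacantDoubleGroupoid

/-! ### The weak bialgebra of a vacant double groupoid with a cocycle -/

/-- The vector space `k^τ_σ T` with basis the set of boxes. -/
def TwistedAlg {B H V P : Type u} (T : VacantDoubleGroupoid B H V P) {k : Type u} [Field k]
    (_c : T.Cocycle k) : Type u := B →₀ k

namespace TwistedAlg

variable {B H V P : Type u} {T : VacantDoubleGroupoid B H V P} {k : Type u} [Field k]
  {c : T.Cocycle k}

instance (priority := low) : AddCommGroup (TwistedAlg T c) := inferInstanceAs (AddCommGroup (B →₀ k))
instance (priority := low) : Module k (TwistedAlg T c) := inferInstanceAs (Module k (B →₀ k))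

variable (c) in
/-- The basis element of a box. -/
def box (A : B) : TwistedAlg T c := Finsupp.single A (1 : k)

variable (c) in
/-- The linear map with prescribed values on boxes. -/
def lift {M : Type*} [AddCommGroup M] [Module k M] (f : B → M) : TwistedAlg T c →ₗ[k] M :=
  Finsupp.linearCombination k f

@[simp] lemma lift_box {M : Type*} [AddCommGroup M] [Module k M] (f : B → M) (A : B) :
    lift c f (box c A) = f A :=
  (Finsupp.linearCombination_single k (1 : k) A).trans (one_smul k (f A))

@[elab_as_elim]
lemma induction {p : TwistedAlg T c → Prop} (a : TwistedAlg T c) (h0 : p 0)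
    (hadd : ∀ a b, p a → p b → p (a + b)) (hbox : ∀ (r : k) A, p (r • box c A)) : p a :=
  Finsupp.induction_linear (motive := p) a h0 hadd fun A r => by
    have : (Finsupp.single A r : B →₀ k) = r • Finsupp.single A (1 : k) := by simp
    rw [this]
    exact hbox r A

lemma hom_ext {M : Type*} [AddCommGroup M] [Module k M] {f g : TwistedAlg T c →ₗ[k] M}
    (h : ∀ A, f (box c A) = g (box c A)) : f = g :=
  Finsupp.lhom_ext' fun A => LinearMap.ext_ring (h A)

open Classical in
variable (c) in
/-- `A.C = σ(A, C) (A over C)` if `A` and `C` are vertically composable, and `0` otherwise. -/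
def mulBox (A C : B) : TwistedAlg T c :=
  if T.vBox.tgt A = T.vBox.src C then (c.σ A C : k) • box c (T.vBox.comp A C) else 0

variable (c) in
/-- The multiplication as a bilinear map. -/
def mulMap : TwistedAlg T c →ₗ[k] TwistedAlg T c →ₗ[k] TwistedAlg T c :=
  lift c fun A => lift c fun C => mulBox c A C

instance (priority := low) : Mul (TwistedAlg T c) := ⟨fun a b => mulMap c a b⟩

lemma mul_def (a b : TwistedAlg T c) : a * b = mulMap c a b := rfl

lemma box_mul_box (A C : B) : box c A * box c C = mulBox c A C := by
  rw [mul_def, mulMap, lift_box, lift_box]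

instance (priority := low) : NonUnitalNonAssocRing (TwistedAlg T c) :=
  { (inferInstance : AddCommGroup (TwistedAlg T c)), (inferInstance : Mul (TwistedAlg T c)) with
    left_distrib := fun a b c => by simp only [mul_def, map_add]
    right_distrib := fun a b c => by simp only [mul_def, map_add, LinearMap.add_apply]
    zero_mul := fun a => by simp only [mul_def, map_zero, LinearMap.zero_apply]
    mul_zero := fun a => by simp only [mul_def, map_zero] }

instance (priority := low) : IsScalarTower k (TwistedAlg T c) (TwistedAlg T c) :=
  ⟨fun r a b => by simp only [smul_eq_mul, mul_def, map_smul, LinearMap.smul_apply]⟩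

instance (priority := low) : SMulCommClass k (TwistedAlg T c) (TwistedAlg T c) :=
  ⟨fun r a b => by simp only [smul_eq_mul, mul_def, map_smul]⟩

lemma box_mul_box_of {A C : B} (h : T.vBox.tgt A = T.vBox.src C) :
    box c A * box c C = (c.σ A C : k) • box c (T.vBox.comp A C) := by
  rw [box_mul_box, mulBox, if_pos h]

lemma box_mul_box_of_ne {A C : B} (h : T.vBox.tgt A ≠ T.vBox.src C) :
    box c A * box c C = 0 := by
  rw [box_mul_box, mulBox, if_neg h]

lemma mul_assoc' (a b d : TwistedAlg T c) : a * b * d = a * (b * d) := by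
  induction a using induction with
  | h0 => simp
  | hadd a a' h h' => simp only [add_mul, h, h']
  | hbox r A =>
  induction b using induction with
  | h0 => simp
  | hadd a a' h h' => simp only [add_mul, mul_add, h, h']
  | hbox s C =>
  induction d using induction with
  | h0 => simp
  | hadd a a' h h' => simp only [mul_add, h, h']
  | hbox t D =>
  simp only [smul_mul_assoc, mul_smul_comm]
  congr 3
  by_cases h1 : T.vBox.tgt A = T.vBox.src C
  · by_cases h2 : T.vBox.tgt C = T.vBox.src D
    · rw [box_mul_box_of h1, box_mul_box_of h2, smul_mul_assoc, mul_smul_comm,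
        box_mul_box_of (by rw [T.vBox.tgt_comp _ _ h1, h2]),
        box_mul_box_of (by rw [T.vBox.src_comp _ _ h2, h1]), T.vBox.assoc _ _ _ h1 h2,
        smul_smul, smul_smul, ← Units.val_mul, ← Units.val_mul, c.σ_cocycle _ _ _ h1 h2]
    · rw [box_mul_box_of h1, box_mul_box_of_ne h2, smul_mul_assoc,
        box_mul_box_of_ne (by rwa [T.vBox.tgt_comp _ _ h1]), smul_zero, mul_zero]
  · by_cases h2 : T.vBox.tgt C = T.vBox.src D
    · rw [box_mul_box_of_ne h1, box_mul_box_of h2, mul_smul_comm,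
        box_mul_box_of_ne (by rwa [T.vBox.src_comp _ _ h2]), smul_zero, zero_mul]
    · rw [box_mul_box_of_ne h1, box_mul_box_of_ne h2, zero_mul, mul_zero]

variable [Fintype H]

/-- The unit is the sum of the vertical identities. -/
instance (priority := low) : One (TwistedAlg T c) := ⟨∑ x : H, box c (T.vBox.one x)⟩

lemma one_def : (1 : TwistedAlg T c) = ∑ x : H, box c (T.vBox.one x) := rfl

lemma one_mul' (a : TwistedAlg T c) : 1 * a = a := by
  induction a using induction with
  | h0 => simp
  | hadd a a' h h' => simp only [mul_add, h, h']
  | hbox r A =>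
    rw [mul_smul_comm, one_def, Finset.sum_mul, Finset.sum_eq_single (T.vBox.src A)]
    · rw [box_mul_box_of (T.vBox.tgt_one _), c.σ_vone_left, T.vBox.one_comp, Units.val_one, one_smul]
    · intro x _ hx
      rw [box_mul_box_of_ne (by rwa [T.vBox.tgt_one])]
    · simp

lemma mul_one' (a : TwistedAlg T c) : a * 1 = a := by
  induction a using induction with
  | h0 => simp
  | hadd a a' h h' => simp only [add_mul, h, h']
  | hbox r A =>
    rw [smul_mul_assoc, one_def, Finset.mul_sum, Finset.sum_eq_single (T.vBox.tgt A)]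
    · rw [box_mul_box_of (T.vBox.src_one _).symm, c.σ_vone_right, T.vBox.comp_one, Units.val_one,
        one_smul]
    · intro x _ hx
      rw [box_mul_box_of_ne (by rw [T.vBox.src_one]; exact hx.symm)]
    · simp

instance : Ring (TwistedAlg T c) :=
  { (inferInstance : NonUnitalNonAssocRing (TwistedAlg T c)) with
    one := 1
    mul_assoc := mul_assoc'
    one_mul := one_mul'
    mul_one := mul_one' }

instance : Algebra k (TwistedAlg T c) :=
  Algebra.ofModule (fun r a b => smul_mul_assoc r a b) (fun r a b => mul_smul_comm r a b)

variable [Fintype B]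

instance : FiniteDimensional k (TwistedAlg T c) :=
  inferInstanceAs (FiniteDimensional k (B →₀ k))

end TwistedAlg

namespace TwistedAlg
variable {B H V P : Type u} {T : VacantDoubleGroupoid B H V P} {k : Type u} [Field k]
  {c : T.Cocycle k}

/-- If both factors of a horizontal composition are horizontal identities, they agree with it. -/
lemma eq_of_isHOne {X Y A : B} (h : T.hBox.tgt X = T.hBox.src Y) (e : T.hBox.comp X Y = A)
    (hX : T.IsHOne X) (hY : T.IsHOne Y) : X = A ∧ Y = A := by
  have h1 : Y = A := by rw [← e, hX, ← hX.tgt, h, T.hBox.one_comp]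
  have h2 : X = A := by rw [← e, hY, ← h, T.hBox.comp_one]
  exact ⟨h2, h1⟩

variable [Fintype H]

lemma vone_mul_vone_self (x : H) : box c (T.vBox.one x) * box c (T.vBox.one x) =
    box c (T.vBox.one x) := by
  rw [box_mul_box_of (by rw [T.vBox.tgt_one, T.vBox.src_one])]
  have h1 := c.σ_vone_left (T.vBox.one x)
  have h2 := T.vBox.one_comp (T.vBox.one x)
  rw [T.vBox.src_one] at h1 h2
  rw [h1, h2, Units.val_one, one_smul]

lemma vone_mul_vone_ne {x y : H} (h : x ≠ y) :
    box c (T.vBox.one x) * box c (T.vBox.one y) = 0 :=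
  box_mul_box_of_ne (by rwa [T.vBox.tgt_one, T.vBox.src_one])

lemma mulLeft_add (a b : TwistedAlg T c) :
    LinearMap.mulLeft k (a + b) = LinearMap.mulLeft k a + LinearMap.mulLeft k b :=
  LinearMap.ext fun x => add_mul a b x

lemma mulRight_add (a b : TwistedAlg T c) :
    LinearMap.mulRight k (a + b) = LinearMap.mulRight k a + LinearMap.mulRight k b :=
  LinearMap.ext fun x => mul_add x a b

lemma mulLeft_smul (r : k) (a : TwistedAlg T c) :
    LinearMap.mulLeft k (r • a) = r • LinearMap.mulLeft k a :=
  LinearMap.ext fun x => smul_mul_assoc r a x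

lemma mulRight_smul (r : k) (a : TwistedAlg T c) :
    LinearMap.mulRight k (r • a) = r • LinearMap.mulRight k a :=
  LinearMap.ext fun x => mul_smul_comm r x a

lemma sum_mul_sum_three {α β : Type*} [Fintype α] [Fintype β]
    (f : α → TwistedAlg T c ⊗[k] (TwistedAlg T c ⊗[k] TwistedAlg T c))
    (g : β → TwistedAlg T c ⊗[k] (TwistedAlg T c ⊗[k] TwistedAlg T c)) :
    (∑ i, f i) * (∑ j, g j) = ∑ i, ∑ j, f i * g j :=
  Finset.sum_mul_sum Finset.univ Finset.univ f g

variable [Fintype B]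

open Classical in
variable (c) in
/-- `Δ(A) = ∑ τ(X, Y) X ⊗ Y`, the sum over all pairs of boxes with `X | Y` and `XY = A`. -/
def comulBox (A : B) : TwistedAlg T c ⊗[k] TwistedAlg T c :=
  ∑ X : B, ∑ Y : B, if T.hBox.tgt X = T.hBox.src Y ∧ T.hBox.comp X Y = A then
    (c.τ X Y : k) • (box c X ⊗ₜ[k] box c Y) else 0

open Classical in
/-- `ε(A) = 1` if `A` is a horizontal identity, and `0` otherwise. -/
def counitBox (_c : T.Cocycle k) (A : B) : k := if T.IsHOne A then 1 else 0

instance : CoalgebraStruct k (TwistedAlg T c) where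
  comul := lift c (comulBox c)
  counit := lift c (counitBox c)

open Coalgebra

lemma comul_box (A : B) : comul (R := k) (box c A) = comulBox c A := lift_box _ _

lemma counit_box (A : B) : counit (R := k) (box c A) = counitBox c A := lift_box _ _

open Classical in
lemma coassoc_box (A : B) : TensorProduct.assoc k _ _ _ (comul.rTensor (TwistedAlg T c)
    (comul (R := k) (box c A))) = comul.lTensor (TwistedAlg T c) (comul (R := k) (box c A)) := by
  have h1 : TensorProduct.assoc k _ _ _ (comul.rTensor (TwistedAlg T c)
      (comul (R := k) (box c A))) = ∑ X : B, ∑ Y : B, ∑ Z : B,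
      if T.hBox.tgt X = T.hBox.src Y ∧ T.hBox.tgt Y = T.hBox.src Z ∧
        T.hBox.comp (T.hBox.comp X Y) Z = A then
        ((c.τ X Y * c.τ (T.hBox.comp X Y) Z : kˣ) : k) •
          (box c X ⊗ₜ[k] (box c Y ⊗ₜ[k] box c Z)) else 0 := by
    calc _ = ∑ W : B, ∑ Z : B, ∑ X : B, ∑ Y : B,
          if (T.hBox.tgt W = T.hBox.src Z ∧ T.hBox.comp W Z = A) ∧
            (T.hBox.tgt X = T.hBox.src Y ∧ T.hBox.comp X Y = W) then
            ((c.τ X Y * c.τ W Z : kˣ) : k) • (box c X ⊗ₜ[k] (box c Y ⊗ₜ[k] box c Z)) else 0 := by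
          rw [comul_box, comulBox]
          simp only [map_sum]
          refine Finset.sum_congr rfl fun W _ => Finset.sum_congr rfl fun Z _ => ?_
          split_ifs with h
          · rw [map_smul, map_smul, LinearMap.rTensor_tmul, comul_box, comulBox]
            simp only [TensorProduct.sum_tmul, map_sum, Finset.smul_sum]
            refine Finset.sum_congr rfl fun X _ => Finset.sum_congr rfl fun Y _ => ?_
            by_cases h' : T.hBox.tgt X = T.hBox.src Y ∧ T.hBox.comp X Y = W
            · rw [if_pos h', if_pos ⟨h, h'⟩, ← TensorProduct.smul_tmul', map_smul,
                TensorProduct.assoc_tmul, smul_smul, Units.val_mul, mul_comm]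
            · rw [if_neg h', if_neg (fun h2 => h' h2.2)]
              simp
          · simp [h]
      _ = ∑ X : B, ∑ Y : B, ∑ Z : B, ∑ W : B,
          if (T.hBox.tgt W = T.hBox.src Z ∧ T.hBox.comp W Z = A) ∧
            (T.hBox.tgt X = T.hBox.src Y ∧ T.hBox.comp X Y = W) then
            ((c.τ X Y * c.τ W Z : kˣ) : k) • (box c X ⊗ₜ[k] (box c Y ⊗ₜ[k] box c Z)) else 0 := by
          rw [Finset.sum_comm' (t' := Finset.univ) (s' := fun _ => Finset.univ) (by simp)]
          have : ∀ Z : B, ∑ W : B, ∑ X : B, ∑ Y : B, (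
              if (T.hBox.tgt W = T.hBox.src Z ∧ T.hBox.comp W Z = A) ∧
              (T.hBox.tgt X = T.hBox.src Y ∧ T.hBox.comp X Y = W) then
              ((c.τ X Y * c.τ W Z : kˣ) : k) • (box c X ⊗ₜ[k] (box c Y ⊗ₜ[k] box c Z)) else 0) =
              ∑ X : B, ∑ Y : B, ∑ W : B, (
              if (T.hBox.tgt W = T.hBox.src Z ∧ T.hBox.comp W Z = A) ∧
              (T.hBox.tgt X = T.hBox.src Y ∧ T.hBox.comp X Y = W) then
              ((c.τ X Y * c.τ W Z : kˣ) : k) • (box c X ⊗ₜ[k] (box c Y ⊗ₜ[k] box c Z)) else 0) := by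
            intro Z
            rw [Finset.sum_comm]
            exact Finset.sum_congr rfl fun X _ => Finset.sum_comm
          simp only [this]
          rw [Finset.sum_comm]
          exact Finset.sum_congr rfl fun X _ => Finset.sum_comm
      _ = _ := by
          refine Finset.sum_congr rfl fun X _ => Finset.sum_congr rfl fun Y _ =>
            Finset.sum_congr rfl fun Z _ => ?_
          rw [Finset.sum_eq_single (T.hBox.comp X Y)]
          · by_cases h : T.hBox.tgt X = T.hBox.src Y
            · simp [h, T.hBox.tgt_comp _ _ h]
            · simp [h]
          · intro W _ hW
            rw [if_neg (fun h => hW h.2.2.symm)]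
          · simp
  have h2 : comul.lTensor (TwistedAlg T c) (comul (R := k) (box c A)) = ∑ X : B, ∑ Y : B, ∑ Z : B,
      if T.hBox.tgt X = T.hBox.src Y ∧ T.hBox.tgt Y = T.hBox.src Z ∧
        T.hBox.comp X (T.hBox.comp Y Z) = A then
        ((c.τ Y Z * c.τ X (T.hBox.comp Y Z) : kˣ) : k) •
          (box c X ⊗ₜ[k] (box c Y ⊗ₜ[k] box c Z)) else 0 := by
    calc _ = ∑ X : B, ∑ W : B, ∑ Y : B, ∑ Z : B,
          if (T.hBox.tgt X = T.hBox.src W ∧ T.hBox.comp X W = A) ∧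
            (T.hBox.tgt Y = T.hBox.src Z ∧ T.hBox.comp Y Z = W) then
            ((c.τ Y Z * c.τ X W : kˣ) : k) • (box c X ⊗ₜ[k] (box c Y ⊗ₜ[k] box c Z)) else 0 := by
          rw [comul_box, comulBox]
          simp only [map_sum]
          refine Finset.sum_congr rfl fun X _ => Finset.sum_congr rfl fun W _ => ?_
          split_ifs with h
          · rw [map_smul, LinearMap.lTensor_tmul, comul_box, comulBox]
            simp only [TensorProduct.tmul_sum, Finset.smul_sum]
            refine Finset.sum_congr rfl fun Y _ => Finset.sum_congr rfl fun Z _ => ?_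
            by_cases h' : T.hBox.tgt Y = T.hBox.src Z ∧ T.hBox.comp Y Z = W
            · rw [if_pos h', if_pos ⟨h, h'⟩, TensorProduct.tmul_smul, smul_smul, Units.val_mul,
                mul_comm]
            · rw [if_neg h', if_neg (fun h2 => h' h2.2)]
              simp
          · simp [h]
      _ = ∑ X : B, ∑ Y : B, ∑ Z : B, ∑ W : B,
          if (T.hBox.tgt X = T.hBox.src W ∧ T.hBox.comp X W = A) ∧
            (T.hBox.tgt Y = T.hBox.src Z ∧ T.hBox.comp Y Z = W) then
            ((c.τ Y Z * c.τ X W : kˣ) : k) • (box c X ⊗ₜ[k] (box c Y ⊗ₜ[k] box c Z)) else 0 := by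
          refine Finset.sum_congr rfl fun X _ => ?_
          rw [Finset.sum_comm]
          exact Finset.sum_congr rfl fun X _ => Finset.sum_comm
      _ = _ := by
          refine Finset.sum_congr rfl fun X _ => Finset.sum_congr rfl fun Y _ =>
            Finset.sum_congr rfl fun Z _ => ?_
          rw [Finset.sum_eq_single (T.hBox.comp Y Z)]
          · by_cases h : T.hBox.tgt Y = T.hBox.src Z
            · simp [h, T.hBox.src_comp _ _ h]
            · simp [h]
          · intro W _ hW
            rw [if_neg (fun h => hW h.2.2.symm)]
          · simp
  rw [h1, h2]
  refine Finset.sum_congr rfl fun X _ => Finset.sum_congr rfl fun Y _ =>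
    Finset.sum_congr rfl fun Z _ => ?_
  by_cases hXY : T.hBox.tgt X = T.hBox.src Y
  · by_cases hYZ : T.hBox.tgt Y = T.hBox.src Z
    · rw [T.hBox.assoc _ _ _ hXY hYZ, c.τ_cocycle _ _ _ hXY hYZ]
    · simp [hYZ]
  · simp [hXY]

lemma rTensor_counit_box (A : B) : counit.rTensor (TwistedAlg T c) (comul (R := k) (box c A)) =
    (1 : k) ⊗ₜ[k] box c A := by
  rw [comul_box, comulBox]
  simp only [map_sum]
  rw [Finset.sum_eq_single (T.hBox.one (T.hBox.src A)), Finset.sum_eq_single A]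
  · rw [if_pos ⟨T.hBox.tgt_one _, T.hBox.one_comp A⟩, c.τ_hone_left, Units.val_one, one_smul,
      LinearMap.rTensor_tmul, counit_box, counitBox, if_pos (T.isHOne_hone _)]
  · intro Y _ hY
    rw [if_neg, map_zero]
    rintro ⟨h1, h2⟩
    rw [T.hBox.tgt_one] at h1
    rw [h1, T.hBox.one_comp] at h2
    exact hY h2
  · simp
  · intro X _ hX
    refine Finset.sum_eq_zero fun Y _ => ?_
    split_ifs with h
    · rw [map_smul, LinearMap.rTensor_tmul, counit_box, counitBox, if_neg, TensorProduct.zero_tmul,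
        smul_zero]
      intro h'
      apply hX
      rw [← h.2, T.hBox.src_comp _ _ h.1]
      exact h'
    · simp
  · simp

lemma lTensor_counit_box (A : B) : counit.lTensor (TwistedAlg T c) (comul (R := k) (box c A)) =
    box c A ⊗ₜ[k] (1 : k) := by
  rw [comul_box, comulBox]
  simp only [map_sum]
  rw [Finset.sum_eq_single A, Finset.sum_eq_single (T.hBox.one (T.hBox.tgt A))]
  · rw [if_pos ⟨(T.hBox.src_one _).symm, T.hBox.comp_one A⟩, c.τ_hone_right, Units.val_one, one_smul,
      LinearMap.lTensor_tmul, counit_box, counitBox, if_pos (T.isHOne_hone _)]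
  · intro Y _ hY
    split_ifs with h
    · rw [map_smul, LinearMap.lTensor_tmul, counit_box, counitBox, if_neg, TensorProduct.tmul_zero,
        smul_zero]
      intro h'
      apply hY
      rw [h.1]
      exact h'
    · simp
  · simp
  · intro X _ hX
    refine Finset.sum_eq_zero fun Y _ => ?_
    split_ifs with h
    · rw [map_smul, LinearMap.lTensor_tmul, counit_box, counitBox, if_neg, TensorProduct.tmul_zero,
        smul_zero]
      intro h'
      apply hX
      rw [← h.2, h', ← h.1, T.hBox.comp_one]
    · simp
  · simp

instance : Coalgebra k (TwistedAlg T c) where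
  coassoc := hom_ext coassoc_box
  rTensor_counit_comp_comul := hom_ext rTensor_counit_box
  lTensor_counit_comp_comul := hom_ext lTensor_counit_box

open Classical in
lemma comul_mul_box (A C : B) : comul (R := k) (box c A * box c C) =
    comul (R := k) (box c A) * comul (R := k) (box c C) := by
  have hR : comul (R := k) (box c A) * comul (R := k) (box c C) =
      ∑ q : (B × B) × (B × B), if (T.hBox.tgt q.1.1 = T.hBox.src q.1.2 ∧
        T.hBox.comp q.1.1 q.1.2 = A) ∧ (T.hBox.tgt q.2.1 = T.hBox.src q.2.2 ∧
        T.hBox.comp q.2.1 q.2.2 = C) ∧ T.vBox.tgt q.1.1 = T.vBox.src q.2.1 ∧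
        T.vBox.tgt q.1.2 = T.vBox.src q.2.2 then
        ((c.τ q.1.1 q.1.2 * c.τ q.2.1 q.2.2 * c.σ q.1.1 q.2.1 * c.σ q.1.2 q.2.2 : kˣ) : k) •
          (box c (T.vBox.comp q.1.1 q.2.1) ⊗ₜ[k] box c (T.vBox.comp q.1.2 q.2.2)) else 0 := by
    rw [comul_box, comul_box, comulBox, comulBox, ← Fintype.sum_prod_type', ← Fintype.sum_prod_type',
      Finset.sum_mul_sum, ← Fintype.sum_prod_type']
    refine Finset.sum_congr rfl fun q _ => ?_
    by_cases h1 : T.hBox.tgt q.1.1 = T.hBox.src q.1.2 ∧ T.hBox.comp q.1.1 q.1.2 = A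
    · by_cases h2 : T.hBox.tgt q.2.1 = T.hBox.src q.2.2 ∧ T.hBox.comp q.2.1 q.2.2 = C
      · rw [if_pos h1, if_pos h2, smul_mul_smul_comm, Algebra.TensorProduct.tmul_mul_tmul]
        by_cases h3 : T.vBox.tgt q.1.1 = T.vBox.src q.2.1
        · by_cases h4 : T.vBox.tgt q.1.2 = T.vBox.src q.2.2
          · rw [if_pos ⟨h1, h2, h3, h4⟩, box_mul_box_of h3, box_mul_box_of h4,
              TensorProduct.smul_tmul_smul, smul_smul]
            congr 1
            push_cast
            ring
          · rw [if_neg (fun h => h4 h.2.2.2), box_mul_box_of_ne h4, TensorProduct.tmul_zero,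
              smul_zero]
        · rw [if_neg (fun h => h3 h.2.2.1), box_mul_box_of_ne h3, TensorProduct.zero_tmul,
            smul_zero]
      · rw [if_neg h2, mul_zero, if_neg (fun h => h2 h.2.1)]
    · rw [if_neg h1, zero_mul, if_neg (fun h => h1 h.1)]
  rw [hR]
  by_cases hAC : T.vBox.tgt A = T.vBox.src C
  · rw [box_mul_box_of hAC, map_smul, comul_box, comulBox, ← Fintype.sum_prod_type',
      Finset.smul_sum, ← Finset.sum_filter]
    simp only [smul_ite, smul_zero]
    rw [← Finset.sum_filter]
    symm
    refine Finset.sum_nbij (fun q => (T.vBox.comp q.1.1 q.2.1, T.vBox.comp q.1.2 q.2.2)) ?_ ?_ ?_ ?_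
    · rintro ⟨⟨X, Y⟩, ⟨R, S⟩⟩ hq
      simp only [Finset.mem_filter, Finset.mem_univ, true_and] at hq ⊢
      obtain ⟨⟨h1, h2⟩, ⟨h3, h4⟩, h5, h6⟩ := hq
      refine ⟨?_, ?_⟩
      · rw [T.right_vcomp _ _ h5, T.left_vcomp _ _ h6, h1, h3]
      · rw [← T.interchange _ _ _ _ h1 h3 h5 h6, h2, h4]
    · rintro ⟨⟨X, Y⟩, ⟨R, S⟩⟩ hq ⟨⟨X', Y'⟩, ⟨R', S'⟩⟩ hq' he
      simp only [Finset.coe_filter, Finset.mem_univ, true_and, Set.mem_ofPred_eq] at hq hq'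
      obtain ⟨⟨h1, h2⟩, ⟨h3, h4⟩, h5, h6⟩ := hq
      obtain ⟨⟨h1', h2'⟩, ⟨h3', h4'⟩, h5', h6'⟩ := hq'
      simp only [Prod.mk.injEq] at he
      obtain ⟨e1, e2⟩ := he
      have eX : X = X' := by
        apply T.ext_top_left
        · rw [← T.vBox.src_comp _ _ h5, e1, T.vBox.src_comp _ _ h5']
        · rw [← T.hBox.src_comp _ _ h1, h2, ← h2', T.hBox.src_comp _ _ h1']
      subst eX
      obtain rfl : Y = Y' := T.hBox.left_cancel h1 h1' (h2.trans h2'.symm)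
      obtain rfl : R = R' := T.vBox.left_cancel h5 h5' e1
      obtain rfl : S = S' := T.vBox.left_cancel h6 h6' e2
      rfl
    · rintro ⟨U, W⟩ hUW
      simp only [Finset.coe_filter, Finset.mem_univ, true_and, Set.mem_ofPred_eq] at hUW
      obtain ⟨h1, h2⟩ := hUW
      have hlA : T.ver.tgt (T.hBox.src A) = T.ver.src (T.hBox.src C) := by
        rw [T.bot_left, T.top_left, hAC]
      have hU : T.hBox.src U = T.ver.comp (T.hBox.src A) (T.hBox.src C) := by
        rw [← T.left_vcomp _ _ hAC, ← h2, T.hBox.src_comp _ _ h1]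
      obtain ⟨X, hX1, hX2⟩ := T.exists_top_left (T.vBox.src U) (T.hBox.src A)
        (by rw [← T.top_left, hU, T.ver.src_comp _ _ hlA])
      set R := T.vBox.comp (T.vBox.inv X) U with hRdef
      have hXU : T.vBox.tgt (T.vBox.inv X) = T.vBox.src U := by rw [T.vBox.tgt_inv, hX1]
      have hXR : T.vBox.tgt X = T.vBox.src R := by
        rw [hRdef, T.vBox.src_comp _ _ hXU, T.vBox.src_inv]
      have eU : T.vBox.comp X R = U := T.vBox.comp_inv_cancel hX1
      have hR2 : T.hBox.src R = T.hBox.src C := by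
        rw [hRdef, T.left_vcomp _ _ hXU, T.left_vinv, hX2, hU, T.ver.inv_comp_cancel hlA]
      set Y := T.hBox.comp (T.hBox.inv X) A with hYdef
      set S := T.hBox.comp (T.hBox.inv R) C with hSdef
      have hXA : T.hBox.tgt (T.hBox.inv X) = T.hBox.src A := by rw [T.hBox.tgt_inv, hX2]
      have hRC : T.hBox.tgt (T.hBox.inv R) = T.hBox.src C := by rw [T.hBox.tgt_inv, hR2]
      have hXY : T.hBox.tgt X = T.hBox.src Y := by
        rw [hYdef, T.hBox.src_comp _ _ hXA, T.hBox.src_inv]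
      have hRS : T.hBox.tgt R = T.hBox.src S := by
        rw [hSdef, T.hBox.src_comp _ _ hRC, T.hBox.src_inv]
      have eA : T.hBox.comp X Y = A := T.hBox.comp_inv_cancel hX2
      have eC : T.hBox.comp R S = C := T.hBox.comp_inv_cancel hR2
      have hYS : T.vBox.tgt Y = T.vBox.src S := by
        rw [hYdef, T.bot_hcomp _ _ hXA, hSdef, T.top_hcomp _ _ hRC, T.bot_hinv, T.top_hinv, hXR,
          hAC]
      have eW : T.vBox.comp Y S = W := by
        have := T.interchange _ _ _ _ hXY hRS hXR hYS
        rw [eA, eC, eU, ← h2] at this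
        refine (T.hBox.left_cancel h1 ?_ this).symm
        rw [← eU, T.right_vcomp _ _ hXR, T.left_vcomp _ _ hYS, hXY, hRS]
      refine ⟨((X, Y), (R, S)), ?_, ?_⟩
      · simp only [Finset.coe_filter, Finset.mem_univ, true_and, Set.mem_ofPred_eq]
        exact ⟨⟨hXY, eA⟩, ⟨hRS, eC⟩, hXR, hYS⟩
      · simp only [eU, eW]
    · rintro ⟨⟨X, Y⟩, ⟨R, S⟩⟩ hq
      simp only [Finset.mem_filter, Finset.mem_univ, true_and] at hq ⊢
      obtain ⟨⟨h1, h2⟩, ⟨h3, h4⟩, h5, h6⟩ := hq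
      rw [← c.compat _ _ _ _ h1 h3 h5 h6, h2, h4, smul_smul, Units.val_mul]
  · rw [box_mul_box_of_ne hAC, map_zero]
    symm
    refine Finset.sum_eq_zero fun q _ => if_neg ?_
    rintro ⟨⟨h1, h2⟩, ⟨h3, h4⟩, h5, h6⟩
    apply hAC
    rw [← h2, ← h4, T.bot_hcomp _ _ h1, T.top_hcomp _ _ h3, h5, h6]

lemma comul_mul' (a b : TwistedAlg T c) :
    comul (R := k) (a * b) = comul (R := k) a * comul (R := k) b := by
  induction a using induction with
  | h0 => simp
  | hadd a a' h h' => simp only [add_mul, map_add, h, h']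
  | hbox r A =>
  induction b using induction with
  | h0 => simp
  | hadd a a' h h' => simp only [mul_add, map_add, h, h']
  | hbox s C =>
  simp only [smul_mul_assoc, mul_smul_comm, map_smul, comul_mul_box]

open Classical in
lemma comul_vone (z : H) : comul (R := k) (box c (T.vBox.one z)) =
    ∑ x : H, ∑ y : H, if T.hor.tgt x = T.hor.src y ∧ T.hor.comp x y = z then
      box c (T.vBox.one x) ⊗ₜ[k] box c (T.vBox.one y) else 0 := by
  rw [comul_box, comulBox, ← Fintype.sum_prod_type', ← Fintype.sum_prod_type',
    ← Finset.sum_filter, ← Finset.sum_filter]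
  symm
  refine Finset.sum_nbij (fun q => (T.vBox.one q.1, T.vBox.one q.2)) ?_ ?_ ?_ ?_
  · rintro ⟨x, y⟩ hq
    simp only [Finset.mem_filter, Finset.mem_univ, true_and] at hq ⊢
    rw [T.right_vone, T.left_vone, hq.1, T.hcomp_vone _ _ hq.1, hq.2]
    exact ⟨rfl, rfl⟩
  · rintro ⟨x, y⟩ - ⟨x', y'⟩ - he
    simp only [Prod.mk.injEq] at he
    rw [← T.vBox.src_one x, ← T.vBox.src_one y, he.1, he.2, T.vBox.src_one, T.vBox.src_one]
  · rintro ⟨X, Y⟩ hq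
    simp only [Finset.coe_filter, Finset.mem_univ, true_and, Set.mem_ofPred_eq] at hq
    obtain ⟨h1, h2⟩ := T.eq_vone_of_hcomp hq.1 hq.2
    refine ⟨(T.vBox.src X, T.vBox.src Y), ?_, ?_⟩
    · simp only [Finset.coe_filter, Finset.mem_univ, true_and, Set.mem_ofPred_eq]
      refine ⟨by rw [← T.top_right, ← T.top_left, hq.1], ?_⟩
      rw [← T.top_hcomp _ _ hq.1, hq.2, T.vBox.src_one]
    · simp only [← h1, ← h2]
  · rintro ⟨x, y⟩ hq
    simp only [Finset.mem_filter, Finset.mem_univ, true_and] at hq ⊢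
    rw [VacantDoubleGroupoid.τ_vone c hq.1, Units.val_one, one_smul]

open Classical in
lemma comul_one : comul (R := k) (1 : TwistedAlg T c) =
    ∑ x : H, ∑ y : H, if T.hor.tgt x = T.hor.src y then
      box c (T.vBox.one x) ⊗ₜ[k] box c (T.vBox.one y) else 0 := by
  rw [one_def, map_sum]
  simp only [comul_vone]
  rw [Finset.sum_comm]
  refine Finset.sum_congr rfl fun x _ => ?_
  rw [Finset.sum_comm]
  refine Finset.sum_congr rfl fun y _ => ?_
  rw [Finset.sum_eq_single (T.hor.comp x y)]
  · simp
  · intro z _ hz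
    rw [if_neg (fun h => hz h.2.symm)]
  · simp

open Classical in
lemma comul_comul_one_eq : comul.lTensor (TwistedAlg T c) (comul (R := k) (1 : TwistedAlg T c)) =
    ∑ x : H, ∑ y : H, ∑ z : H, if T.hor.tgt x = T.hor.src y ∧ T.hor.tgt y = T.hor.src z then
      box c (T.vBox.one x) ⊗ₜ[k] (box c (T.vBox.one y) ⊗ₜ[k] box c (T.vBox.one z)) else 0 := by
  rw [comul_one]
  simp only [map_sum]
  refine Finset.sum_congr rfl fun x _ => ?_
  calc _ = ∑ w : H, ∑ y : H, ∑ z : H, if T.hor.tgt x = T.hor.src w ∧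
        (T.hor.tgt y = T.hor.src z ∧ T.hor.comp y z = w) then
        box c (T.vBox.one x) ⊗ₜ[k] (box c (T.vBox.one y) ⊗ₜ[k] box c (T.vBox.one z)) else 0 := by
        refine Finset.sum_congr rfl fun w _ => ?_
        by_cases h : T.hor.tgt x = T.hor.src w
        · rw [if_pos h, LinearMap.lTensor_tmul, comul_vone]
          simp only [TensorProduct.tmul_sum]
          refine Finset.sum_congr rfl fun y _ => Finset.sum_congr rfl fun z _ => ?_
          by_cases h' : T.hor.tgt y = T.hor.src z ∧ T.hor.comp y z = w
          · rw [if_pos h', if_pos ⟨h, h'⟩]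
          · rw [if_neg h', if_neg (fun h2 => h' h2.2), TensorProduct.tmul_zero]
        · simp [h]
    _ = _ := by
        rw [Finset.sum_comm]
        refine Finset.sum_congr rfl fun y _ => ?_
        rw [Finset.sum_comm]
        refine Finset.sum_congr rfl fun z _ => ?_
        rw [Finset.sum_eq_single (T.hor.comp y z)]
        · by_cases h : T.hor.tgt y = T.hor.src z
          · simp [h, T.hor.src_comp _ _ h]
          · simp [h]
        · intro w _ hw
          rw [if_neg (fun h => hw h.2.2.symm)]
        · simp

open Classical in
lemma assoc_comul_one_tmul : TensorProduct.assoc k _ _ _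
    (comul (R := k) (1 : TwistedAlg T c) ⊗ₜ[k] (1 : TwistedAlg T c)) =
    ∑ x : H, ∑ y : H, if T.hor.tgt x = T.hor.src y then
      box c (T.vBox.one x) ⊗ₜ[k] (box c (T.vBox.one y) ⊗ₜ[k] (1 : TwistedAlg T c)) else 0 := by
  rw [comul_one]
  simp only [TensorProduct.sum_tmul, map_sum]
  refine Finset.sum_congr rfl fun x _ => Finset.sum_congr rfl fun y _ => ?_
  split_ifs <;> simp

open Classical in
lemma tmul_comul_one : (1 : TwistedAlg T c) ⊗ₜ[k] comul (R := k) (1 : TwistedAlg T c) =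
    ∑ x : H, ∑ y : H, if T.hor.tgt x = T.hor.src y then
      (1 : TwistedAlg T c) ⊗ₜ[k] (box c (T.vBox.one x) ⊗ₜ[k] box c (T.vBox.one y)) else 0 := by
  rw [comul_one]
  simp only [TensorProduct.tmul_sum]
  refine Finset.sum_congr rfl fun x _ => Finset.sum_congr rfl fun y _ => ?_
  split_ifs <;> simp

lemma weak_unit : comul.lTensor (TwistedAlg T c) (comul (R := k) (1 : TwistedAlg T c)) =
    TensorProduct.assoc k _ _ _
      (comul (R := k) (1 : TwistedAlg T c) ⊗ₜ[k] (1 : TwistedAlg T c)) *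
      ((1 : TwistedAlg T c) ⊗ₜ[k] comul (R := k) (1 : TwistedAlg T c)) := by
  classical
  rw [comul_comul_one_eq, assoc_comul_one_tmul, tmul_comul_one]
  conv_rhs => rw [← Fintype.sum_prod_type', ← Fintype.sum_prod_type', sum_mul_sum_three,
    Fintype.sum_prod_type]
  refine Finset.sum_congr rfl fun x _ => Finset.sum_congr rfl fun y _ => ?_
  symm
  rw [Fintype.sum_prod_type, Finset.sum_eq_single y]
  · refine Finset.sum_congr rfl fun z _ => ?_
    by_cases h1 : T.hor.tgt x = T.hor.src y
    · by_cases h2 : T.hor.tgt y = T.hor.src z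
      · simp [h1, h2, vone_mul_vone_self]
      · simp [h2]
    · simp [h1]
  · intro y' _ hy
    refine Finset.sum_eq_zero fun z _ => ?_
    split_ifs <;> simp [vone_mul_vone_ne (c := c) hy.symm]
  · simp

lemma weak_unit' : comul.lTensor (TwistedAlg T c) (comul (R := k) (1 : TwistedAlg T c)) =
    ((1 : TwistedAlg T c) ⊗ₜ[k] comul (R := k) (1 : TwistedAlg T c)) *
      TensorProduct.assoc k _ _ _
      (comul (R := k) (1 : TwistedAlg T c) ⊗ₜ[k] (1 : TwistedAlg T c)) := by
  classical
  have : TensorProduct.assoc k _ _ _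
      (comul (R := k) (1 : TwistedAlg T c) ⊗ₜ[k] (1 : TwistedAlg T c)) *
      ((1 : TwistedAlg T c) ⊗ₜ[k] comul (R := k) (1 : TwistedAlg T c)) =
      ((1 : TwistedAlg T c) ⊗ₜ[k] comul (R := k) (1 : TwistedAlg T c)) *
      TensorProduct.assoc k _ _ _
      (comul (R := k) (1 : TwistedAlg T c) ⊗ₜ[k] (1 : TwistedAlg T c)) := by
    rw [assoc_comul_one_tmul, tmul_comul_one]
    simp only [← Fintype.sum_prod_type']
    rw [sum_mul_sum_three, sum_mul_sum_three, Finset.sum_comm]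
    refine Finset.sum_congr rfl fun q _ => Finset.sum_congr rfl fun r _ => ?_
    by_cases h : r.2 = q.1
    · split_ifs <;> simp [h]
    · split_ifs <;> simp [vone_mul_vone_ne (c := c) h, vone_mul_vone_ne (c := c) (Ne.symm h)]
  rw [weak_unit, this]

open Classical in
lemma counit_mul_box (A C : B) : counit (R := k) (box c A * box c C) =
    if T.vBox.tgt A = T.vBox.src C ∧ T.IsHOne A ∧ T.IsHOne C then 1 else 0 := by
  by_cases h : T.vBox.tgt A = T.vBox.src C
  · rw [box_mul_box_of h, map_smul, counit_box, counitBox, T.isHOne_vcomp h]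
    by_cases h' : T.IsHOne A ∧ T.IsHOne C
    · rw [if_pos h', if_pos ⟨h, h'⟩, VacantDoubleGroupoid.σ_isHOne c h h'.1 h'.2]
      simp
    · rw [if_neg h', if_neg (fun h2 => h' h2.2), smul_zero]
  · rw [box_mul_box_of_ne h, map_zero, if_neg (fun h2 => h h2.1)]

open Classical in
lemma counit_mul_mul_box (A C D : B) : counit (R := k) (box c A * box c C * box c D) =
    if (T.vBox.tgt A = T.vBox.src C ∧ T.vBox.tgt C = T.vBox.src D) ∧
      T.IsHOne A ∧ T.IsHOne C ∧ T.IsHOne D then 1 else 0 := by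
  by_cases h : T.vBox.tgt A = T.vBox.src C
  · rw [box_mul_box_of h, smul_mul_assoc, map_smul, counit_mul_box, T.isHOne_vcomp h,
      T.vBox.tgt_comp _ _ h]
    by_cases h' : T.IsHOne A ∧ T.IsHOne C
    · rw [VacantDoubleGroupoid.σ_isHOne c h h'.1 h'.2]
      simp [h, h']
    · rw [if_neg (fun h2 => h' h2.2.1), if_neg (fun h2 => h' ⟨h2.2.1, h2.2.2.1⟩), smul_zero]
  · rw [box_mul_box_of_ne h, zero_mul, map_zero, if_neg (fun h2 => h h2.1.1)]

lemma sum_counit (F : B → B → k) (hF : ∀ X Y, F X Y ≠ 0 → T.IsHOne X ∧ T.IsHOne Y) (C : B)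
    (φ : TwistedAlg T c ⊗[k] TwistedAlg T c →ₗ[k] k)
    (hφ : ∀ X Y, φ (box c X ⊗ₜ[k] box c Y) = F X Y) :
    φ (comul (R := k) (box c C)) = F C C := by
  rw [comul_box, comulBox]
  simp only [map_sum]
  rw [Finset.sum_eq_single C, Finset.sum_eq_single C]
  · by_cases h : F C C = 0
    · rw [h]
      split_ifs <;> simp [hφ, h]
    · have hC := (hF _ _ h).1
      have h1 := T.hBox.one_comp C
      have h2 := c.τ_hone_left C
      rw [← hC] at h1 h2
      rw [if_pos ⟨hC.tgt, h1⟩, h2, Units.val_one, one_smul, hφ]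
  · intro Y _ hY
    split_ifs with h
    · rw [map_smul, hφ]
      by_cases h0 : F C Y = 0
      · rw [h0, smul_zero]
      · obtain ⟨h1, h2⟩ := hF _ _ h0
        exact absurd (eq_of_isHOne h.1 h.2 h1 h2).2 hY
    · simp
  · simp
  · intro X _ hX
    refine Finset.sum_eq_zero fun Y _ => ?_
    split_ifs with h
    · rw [map_smul, hφ]
      by_cases h0 : F X Y = 0
      · rw [h0, smul_zero]
      · obtain ⟨h1, h2⟩ := hF _ _ h0
        exact absurd (eq_of_isHOne h.1 h.2 h1 h2).1 hX
    · simp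
  · simp

lemma weak_counit_box (A C D : B) : counit (R := k) (box c A * box c C * box c D) =
    LinearMap.mul' k k (TensorProduct.map (counit ∘ₗ LinearMap.mulLeft k (box c A))
      (counit ∘ₗ LinearMap.mulRight k (box c D)) (comul (R := k) (box c C))) := by
  classical
  symm
  refine (sum_counit (fun X Y => counit (R := k) (box c A * box c X) *
    counit (R := k) (box c Y * box c D)) ?_ C (LinearMap.mul' k k ∘ₗ TensorProduct.map _ _)
    (fun X Y => by simp)).trans ?_
  · intro X Y
    simp only [counit_mul_box]
    split_ifs with h1 h2 <;> simp_all
  · simp only [counit_mul_box, counit_mul_mul_box]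
    split_ifs <;> simp_all

lemma weak_counit_box' (A C D : B) : counit (R := k) (box c A * box c C * box c D) =
    LinearMap.mul' k k (TensorProduct.map (counit ∘ₗ LinearMap.mulRight k (box c D))
      (counit ∘ₗ LinearMap.mulLeft k (box c A)) (comul (R := k) (box c C))) := by
  classical
  symm
  refine (sum_counit (fun X Y => counit (R := k) (box c X * box c D) *
    counit (R := k) (box c A * box c Y)) ?_ C (LinearMap.mul' k k ∘ₗ TensorProduct.map _ _)
    (fun X Y => by simp)).trans ?_
  · intro X Y
    simp only [counit_mul_box]
    split_ifs with h1 h2 <;> simp_all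
  · simp only [counit_mul_box, counit_mul_mul_box]
    split_ifs <;> simp_all

lemma weak_counit (a b d : TwistedAlg T c) : counit (R := k) (a * b * d) =
    LinearMap.mul' k k (TensorProduct.map (counit ∘ₗ LinearMap.mulLeft k a)
      (counit ∘ₗ LinearMap.mulRight k d) (comul (R := k) b)) := by
  induction a using induction with
  | h0 => simp
  | hadd a a' h h' =>
    rw [add_mul, add_mul, map_add, h, h', mulLeft_add, LinearMap.comp_add,
      TensorProduct.map_add_left, LinearMap.add_apply, map_add]
  | hbox r A =>
  induction d using induction with
  | h0 => simp
  | hadd a a' h h' =>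
    rw [mul_add, map_add, h, h', mulRight_add, LinearMap.comp_add,
      TensorProduct.map_add_right, LinearMap.add_apply, map_add]
  | hbox t D =>
  induction b using induction with
  | h0 => simp
  | hadd a a' h h' => simp only [mul_add, add_mul, map_add, h, h']
  | hbox s C =>
    simp only [smul_mul_assoc, mul_smul_comm, map_smul, weak_counit_box,
      mulLeft_smul, mulRight_smul, LinearMap.comp_smul,
      TensorProduct.map_smul_left, TensorProduct.map_smul_right, LinearMap.smul_apply]
    simp only [smul_smul]; congr 1; ring

lemma weak_counit' (a b d : TwistedAlg T c) : counit (R := k) (a * b * d) =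
    LinearMap.mul' k k (TensorProduct.map (counit ∘ₗ LinearMap.mulRight k d)
      (counit ∘ₗ LinearMap.mulLeft k a) (comul (R := k) b)) := by
  induction a using induction with
  | h0 => simp
  | hadd a a' h h' =>
    rw [add_mul, add_mul, map_add, h, h', mulLeft_add, LinearMap.comp_add,
      TensorProduct.map_add_right, LinearMap.add_apply, map_add]
  | hbox r A =>
  induction d using induction with
  | h0 => simp
  | hadd a a' h h' =>
    rw [mul_add, map_add, h, h', mulRight_add, LinearMap.comp_add,
      TensorProduct.map_add_left, LinearMap.add_apply, map_add]
  | hbox t D =>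
  induction b using induction with
  | h0 => simp
  | hadd a a' h h' => simp only [mul_add, add_mul, map_add, h, h']
  | hbox s C =>
    simp only [smul_mul_assoc, mul_smul_comm, map_smul, weak_counit_box',
      mulLeft_smul, mulRight_smul, LinearMap.comp_smul,
      TensorProduct.map_smul_left, TensorProduct.map_smul_right, LinearMap.smul_apply]
    simp only [smul_smul]; congr 1; ring

instance : WeakBialgebra k (TwistedAlg T c) where
  comul_mul := comul_mul'
  comul_comul_one := weak_unit
  comul_comul_one' := weak_unit'
  counit_mul_mul := weak_counit
  counit_mul_mul' := weak_counit'

end TwistedAlg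

/-! ### Multifusion and fusion categories -/

/-- A multifusion category over `k`: a semisimple `k`-linear rigid tensor category with finitely
many isomorphism classes of simple objects and finite-dimensional spaces of morphisms. -/
structure IsMultifusion (k : Type*) [Field k] (C : Type*) [Category* C] [Preadditive C]
    [Linear k C] [MonoidalCategory C] : Prop where
  /-- the tensor product is `k`-bilinear on morphisms -/
  monoidalPreadditive : MonoidalPreadditive C
  monoidalLinear : MonoidalLinear k C
  /-- the category, with its given additive structure, is abelian -/
  abelian : ∃ h : Abelian C, h.toPreadditive = ‹Preadditive C›
  /-- every object is a finite direct sum of simple objects -/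
  semisimple : ∀ X : C, ∃ (n : ℕ) (S : Fin n → C) (b : Limits.Bicone S),
    (∀ i, Simple (S i)) ∧ Nonempty b.IsBilimit ∧ Nonempty (X ≅ b.pt)
  /-- there are finitely many simple objects up to isomorphism -/
  finite_simples : ∃ (n : ℕ) (S : Fin n → C), ∀ X : C, Simple X → ∃ i, Nonempty (X ≅ S i)
  finiteDimensional_hom : ∀ X Y : C, FiniteDimensional k (X ⟶ Y)
  /-- every object has a left and a right dual -/
  rigid : Nonempty (RigidCategory C)

/-- A fusion category over `k`: a multifusion category whose unit object is simple. -/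
structure IsFusion (k : Type*) [Field k] (C : Type*) [Category* C] [Preadditive C]
    [Linear k C] [MonoidalCategory C] : Prop extends IsMultifusion k C where
  simple_unit : Simple (𝟙_ C)

/-- The category `Rep k^τ_σ T` of finite-dimensional `k^τ_σ T`-modules. -/
abbrev RepTwisted {B H V P k : Type u} [Fintype H] [Field k] (T : VacantDoubleGroupoid B H V P)
    (c : T.Cocycle k) : Type (u + 1) := FinRep k (TwistedAlg T c)

end

/-!
The horizontal inverse of the vertical inverse of a box, rescaled by the cocycle, defines an
antipode `S` of the weak bialgebra `k^τ_σ T`: a bijective antihomomorphism with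
`∑ a₁ S(a₂) = ε_t(a)` and `∑ S(a₁) a₂ = ε_s(a)`. Over any finite-dimensional weak bialgebra with
such an `S` the linear dual of a module is a left and a right dual.

The algebra `k^τ_σ T` is a twisted groupoid algebra of the boxes over the horizontal edges.
Whenever the orders of the vertex groups are invertible in `k`, a weighted sum of the tensors
`A ⊗ A⁻¹` is a separability element, and averaging a linear projection over it splits every
submodule.

The unit object has a basis indexed by the points, and a box acts on it as zero unless it is a
horizontal identity, in which case it moves one basis vector along the corresponding vertical edge
and kills the others.
Hence its submodules are the spans of unions of connected components of the vertical groupoid.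
-/

noncomputable section

/-! ### Finite-dimensional modules form an abelian category -/

namespace FinRep

section Module

variable {k A : Type u} [Field k] [Ring A] [Algebra k A]

instance (X : FinRep k A) : Module A X.V := Module.compHom X.V X.ρ.toRingHom

lemma smul_eq_ρ (X : FinRep k A) (a : A) (v : X.V) : a • v = X.ρ a v := rfl

instance (X : FinRep k A) : IsScalarTower k A X.V :=
  ⟨fun r a v => by rw [smul_eq_ρ, map_smul]; rfl⟩

instance (X : FinRep k A) : Module.Finite A X.V := Module.Finite.of_restrictScalars_finite k A X.V

/-- The representation on a finite-dimensional `A`-module. -/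
def ofModule (k A : Type u) [Field k] [Ring A] [Algebra k A] (M : Type u) [AddCommGroup M]
    [Module k M] [Module A M] [IsScalarTower k A M] [FiniteDimensional k M] :
    FinRep k A where
  V := M
  ρ := Algebra.lsmul k k M

variable {X Y : FinRep k A}

/-- A morphism of representations as a linear map over the algebra. -/
def Hom.toLinear (f : X ⟶ Y) : X.V →ₗ[A] Y.V where
  toFun := f.hom
  map_add' := f.hom.map_add
  map_smul' := f.comm

/-- A linear map over the algebra as a morphism of representations. -/
def ofLinear (g : X.V →ₗ[A] Y.V) : X ⟶ Y := ⟨g.restrictScalars k, g.map_smul⟩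

/-- Isomorphic modules give isomorphic representations. -/
def isoOfLinearEquiv (e : X.V ≃ₗ[A] Y.V) : X ≅ Y where
  hom := ofLinear e.toLinearMap
  inv := ofLinear e.symm.toLinearMap
  hom_inv_id := hom_ext (LinearMap.ext e.symm_apply_apply)
  inv_hom_id := hom_ext (LinearMap.ext e.apply_symm_apply)

lemma hom_congr {f g : X ⟶ Y} (h : f = g) (x : X.V) : f.hom x = g.hom x := by rw [h]

lemma sum_hom {ι : Type*} (s : Finset ι) (f : ι → (X ⟶ Y)) :
    Hom.hom (∑ i ∈ s, f i : X ⟶ Y) = ∑ i ∈ s, (f i).hom :=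
  map_sum (AddMonoidHom.mk' (fun f : X ⟶ Y => f.hom) fun _ _ => rfl) f s

instance finiteDimensional_hom (X Y : FinRep k A) : FiniteDimensional k (X ⟶ Y) :=
  FiniteDimensional.of_injective
    (⟨⟨fun f : X ⟶ Y => f.hom, fun _ _ => rfl⟩, fun _ _ => rfl⟩ : (X ⟶ Y) →ₗ[k] (X.V →ₗ[k] Y.V))
    hom_injective

end Module

section Abelian

variable {k A : Type u} [Field k] [Ring A] [Algebra k A] {X Y : FinRep k A}

instance (W : Submodule A X.V) : FiniteDimensional k W :=
  inferInstanceAs (FiniteDimensional k (W.restrictScalars k))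

instance (W : Submodule A X.V) : FiniteDimensional k (X.V ⧸ W) :=
  Module.Finite.of_surjective (W.mkQ.restrictScalars k) W.mkQ_surjective

/-- The subrepresentation on a submodule. -/
abbrev sub (X : FinRep k A) (W : Submodule A X.V) : FinRep k A := ofModule k A W

/-- The inclusion of a subrepresentation. -/
def subι (X : FinRep k A) (W : Submodule A X.V) : X.sub W ⟶ X := ofLinear (X := X.sub W) W.subtype

/-- The quotient of a representation by a submodule. -/
abbrev quot (X : FinRep k A) (W : Submodule A X.V) : FinRep k A := ofModule k A (X.V ⧸ W)

/-- The projection onto a quotient representation. -/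
def quotπ (X : FinRep k A) (W : Submodule A X.V) : X ⟶ X.quot W :=
  ofLinear (Y := X.quot W) W.mkQ

lemma range_subι (X : FinRep k A) (W : Submodule A X.V) :
    LinearMap.range (X.subι W).toLinear = W := W.range_subtype

lemma subι_ker_comp (f : X ⟶ Y) : X.subι (LinearMap.ker f.toLinear) ≫ f = 0 :=
  hom_ext (LinearMap.ext fun v => v.2)

lemma comp_quotπ_range (f : X ⟶ Y) : f ≫ Y.quotπ (LinearMap.range f.toLinear) = 0 :=
  hom_ext (LinearMap.ext fun v => (Submodule.Quotient.mk_eq_zero _).mpr ⟨v, rfl⟩)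

/-- The subrepresentation on the kernel is a categorical kernel. -/
def kernelIsLimit (f : X ⟶ Y) : Limits.IsLimit (Limits.KernelFork.ofι _ (subι_ker_comp f)) :=
  Limits.KernelFork.IsLimit.ofι _ _
    (fun g h => ofLinear (Y := X.sub _) (g.toLinear.codRestrict _ fun z => hom_congr h z))
    (fun _ _ => rfl)
    (fun _ _ _ e => hom_ext (LinearMap.ext fun z => Subtype.ext (hom_congr e z)))

/-- The quotient by the range is a categorical cokernel. -/
def cokernelIsColimit (f : X ⟶ Y) :
    Limits.IsColimit (Limits.CokernelCofork.ofπ _ (comp_quotπ_range f)) :=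
  Limits.CokernelCofork.IsColimit.ofπ _ _
    (fun g h => ofLinear (X := Y.quot _) ((LinearMap.range f.toLinear).liftQ g.toLinear (by
      rintro _ ⟨x, rfl⟩
      exact hom_congr h x)))
    (fun _ _ => rfl)
    (fun _ _ _ e => hom_ext (LinearMap.ext fun v => by
      obtain ⟨y, rfl⟩ := Submodule.mkQ_surjective _ v
      exact hom_congr e y))

lemma mono_iff_injective (f : X ⟶ Y) : Mono f ↔ Function.Injective f.hom := by
  refine ⟨fun _ => ?_, fun hf => ⟨fun _ _ e => hom_ext (LinearMap.ext fun v =>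
    hf (hom_congr e v))⟩⟩
  have h : X.subι (LinearMap.ker f.toLinear) = 0 :=
    (cancel_mono f).mp ((subι_ker_comp f).trans Limits.zero_comp.symm)
  exact (injective_iff_map_eq_zero f.hom).mpr fun v hv => hom_congr h ⟨v, hv⟩

lemma surjective_of_epi (f : X ⟶ Y) [Epi f] : Function.Surjective f.hom := by
  have h : Y.quotπ (LinearMap.range f.toLinear) = 0 :=
    (cancel_epi f).mp ((comp_quotπ_range f).trans Limits.comp_zero.symm)
  exact fun y => (Submodule.Quotient.mk_eq_zero _).mp (hom_congr h y)

lemma isIso_iff_bijective (f : X ⟶ Y) : IsIso f ↔ Function.Bijective f.hom :=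
  ⟨fun _ => ⟨(mono_iff_injective f).mp inferInstance, surjective_of_epi f⟩,
    fun hf => (isoOfLinearEquiv (LinearEquiv.ofBijective f.toLinear hf)).isIso_hom⟩

/-- A monomorphism is the kernel of the projection onto the quotient by its range. -/
abbrev normalMono (f : X ⟶ Y) [Mono f] : NormalMono f where
  Z := Y.quot (LinearMap.range f.toLinear)
  g := Y.quotπ _
  w := comp_quotπ_range f
  isLimit := Limits.IsKernel.isoKernel _ _ (kernelIsLimit _)
    (isoOfLinearEquiv (Y := Y.sub _)
      (LinearEquiv.ofInjective f.toLinear ((mono_iff_injective f).mp inferInstance) ≪≫ₗ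
        LinearEquiv.ofEq _ _ (Submodule.ker_mkQ _).symm))
    rfl

/-- An epimorphism is the cokernel of the inclusion of its kernel. -/
abbrev normalEpi (f : X ⟶ Y) [Epi f] : NormalEpi f where
  W := X.sub (LinearMap.ker f.toLinear)
  g := X.subι _
  w := subι_ker_comp f
  isColimit := Limits.IsCokernel.cokernelIso _ _ (cokernelIsColimit _)
    (isoOfLinearEquiv (X := X.quot _)
      (Submodule.quotEquivOfEq _ _ (range_subι _ _) ≪≫ₗ
        f.toLinear.quotKerEquivOfSurjective (surjective_of_epi f)))
    rfl

/-- The direct sum of a finite family of representations, with its inclusions and projections. -/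
def piBicone {n : ℕ} (X : Fin n → FinRep k A) : Limits.Bicone X where
  pt := ofModule k A (∀ i, (X i).V)
  π i := ofLinear (X := ofModule k A _) (LinearMap.proj i)
  ι i := ofLinear (Y := ofModule k A _) (LinearMap.single A (fun i => (X i).V) i)
  ι_π i j := by
    split_ifs with h
    · subst h
      exact hom_ext (LinearMap.ext fun v => Pi.single_eq_same (M := fun i => (X i).V) i v)
    · exact hom_ext (LinearMap.ext fun v =>
        Pi.single_eq_of_ne (M := fun i => (X i).V) (Ne.symm h) v)

/-- The direct sum of a finite family of representations is a biproduct. -/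
def piBiconeIsBilimit {n : ℕ} (X : Fin n → FinRep k A) : (piBicone X).IsBilimit :=
  Limits.isBilimitOfTotal _ (hom_ext (LinearMap.ext fun v => by
    rw [sum_hom, LinearMap.sum_apply]
    exact Finset.univ_sum_single (M := fun i => (X i).V) v))

instance : Limits.HasFiniteBiproducts (FinRep k A) where
  out _ := ⟨fun X => Limits.HasBiproduct.mk ⟨piBicone X, piBiconeIsBilimit X⟩⟩

instance : Abelian (FinRep k A) where
  normalMonoOfMono f _ := ⟨normalMono f⟩
  normalEpiOfEpi f _ := ⟨normalEpi f⟩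
  has_finite_products := inferInstance
  has_kernels := ⟨fun f => ⟨⟨_, kernelIsLimit f⟩⟩⟩
  has_cokernels := ⟨fun f => ⟨⟨_, cokernelIsColimit f⟩⟩⟩

end Abelian

section Semisimple

variable {k A : Type u} [Field k] [Ring A] [Algebra k A]

lemma isSimpleModule_of_simple (X : FinRep k A) [Simple X] : IsSimpleModule A X.V := by
  have : Nontrivial X.V := by
    by_contra h
    rw [not_nontrivial_iff_subsingleton] at h
    exact id_nonzero X (hom_ext (LinearMap.ext fun v => Subsingleton.elim _ _))
  refine (isSimpleModule_iff A X.V).mpr ⟨fun W => or_iff_not_imp_left.mpr fun hW => ?_⟩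
  have : Mono (X.subι W) := (mono_iff_injective _).mpr Subtype.val_injective
  have hne : X.subι W ≠ 0 := fun h => hW ((Submodule.eq_bot_iff W).mpr fun v hv =>
    hom_congr h ⟨v, hv⟩)
  have := isIso_of_mono_of_nonzero hne
  refine Submodule.eq_top_iff'.mpr fun v => ?_
  obtain ⟨w, rfl⟩ := ((isIso_iff_bijective (X.subι W)).mp inferInstance).2 v
  exact w.2

lemma simple_of_isSimpleModule (X : FinRep k A) [IsSimpleModule A X.V] : Simple X where
  mono_isIso_iff_nonzero {Y} f hf := by
    refine ⟨fun hi h => ?_, fun h => (isIso_iff_bijective f).mpr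
      ⟨(mono_iff_injective f).mp hf, LinearMap.range_eq_top.mp ?_⟩⟩
    · have := IsSimpleModule.nontrivial A X.V
      obtain ⟨x, hx⟩ := exists_ne (0 : X.V)
      obtain ⟨y, rfl⟩ := ((isIso_iff_bijective f).mp hi).2 x
      exact hx (hom_congr h y)
    · refine (Submodule.restrictScalars_eq_top_iff k A X.V).mpr
        ((eq_bot_or_eq_top (LinearMap.range f.toLinear)).resolve_left fun h' => h (hom_ext ?_))
      exact congrArg (LinearMap.restrictScalars k) (LinearMap.range_eq_bot.mp h')

lemma simple_iff_isSimpleModule (X : FinRep k A) : Simple X ↔ IsSimpleModule A X.V :=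
  ⟨fun _ => isSimpleModule_of_simple X, fun _ => simple_of_isSimpleModule X⟩

lemma exists_bicone_simple [IsSemisimpleRing A] (X : FinRep k A) :
    ∃ (n : ℕ) (S : Fin n → FinRep k A) (b : Limits.Bicone S),
      (∀ i, Simple (S i)) ∧ Nonempty b.IsBilimit ∧ Nonempty (X ≅ b.pt) := by
  obtain ⟨n, S, e, hS⟩ := IsSemisimpleModule.exists_linearEquiv_fin_dfinsupp A X.V
  refine ⟨n, fun i => X.sub (S i), _,
    fun i => (simple_iff_isSimpleModule _).mpr (hS i), ⟨piBiconeIsBilimit _⟩,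
    ⟨isoOfLinearEquiv (Y := ofModule k A _) (e ≪≫ₗ DFinsupp.linearEquivFunOnFintype)⟩⟩

variable [FiniteDimensional k A]

lemma exists_hom_regular_ne_zero (X : FinRep k A) [Nontrivial X.V] :
    ∃ f : ofModule k A A ⟶ X, f ≠ 0 := by
  obtain ⟨x, hx⟩ := exists_ne (0 : X.V)
  refine ⟨ofLinear (X := ofModule k A A) (LinearMap.toSpanSingleton A X.V x), fun h => hx ?_⟩
  exact (one_smul A x).symm.trans (hom_congr h (1 : A))

/-- Every simple module is one of the simple summands of the regular module. -/
lemma exists_fin_simple [IsSemisimpleRing A] :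
    ∃ (n : ℕ) (S : Fin n → FinRep k A), ∀ X : FinRep k A, Simple X → ∃ i, Nonempty (X ≅ S i) := by
  obtain ⟨n, S, b, hS, ⟨hb⟩, ⟨e⟩⟩ := exists_bicone_simple (ofModule k A A)
  refine ⟨n, S, fun X hX => ?_⟩
  have := isSimpleModule_of_simple X
  have := IsSimpleModule.nontrivial A X.V
  obtain ⟨f, hf⟩ := exists_hom_regular_ne_zero X
  obtain ⟨i, hi⟩ : ∃ i, b.ι i ≫ e.inv ≫ f ≠ 0 := by
    by_contra! h
    refine hf ((cancel_epi e.inv).mp ?_)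
    rw [Limits.comp_zero, ← Category.id_comp (e.inv ≫ f), ← Limits.IsBilimit.total hb,
      Preadditive.sum_comp]
    exact Finset.sum_eq_zero fun i _ => by rw [Category.assoc, h, Limits.comp_zero]
  have := hS i
  have := isIso_of_hom_simple hi
  exact ⟨i, ⟨(asIso (b.ι i ≫ e.inv ≫ f)).symm⟩⟩

end Semisimple

section Monoidal

variable {k A : Type u} [Field k] [Ring A] [Algebra k A] [WeakBialgebra k A]
  [FiniteDimensional k A]

lemma ι_whiskerLeft (X : FinRep k A) {Y Z : FinRep k A} (f : Y ⟶ Z) (w : (tensor X Y).V) :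
    ι X Z ((X ◁ f).hom w) = f.hom.lTensor X.V (ι X Y w) := ι_tensorMap (𝟙 X) f w

lemma ι_whiskerRight {Y Z : FinRep k A} (f : Y ⟶ Z) (X : FinRep k A) (w : (tensor Y X).V) :
    ι Z X ((f ▷ X).hom w) = f.hom.rTensor X.V (ι Y X w) := ι_tensorMap f (𝟙 X) w

instance : MonoidalPreadditive (FinRep k A) where
  whiskerLeft_zero := hom_ext (LinearMap.ext fun w => ι_injective _ _ (by
    rw [ι_whiskerLeft]; simp))
  zero_whiskerRight := hom_ext (LinearMap.ext fun w => ι_injective _ _ (by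
    rw [ι_whiskerRight]; simp))
  whiskerLeft_add f g := hom_ext (LinearMap.ext fun w => ι_injective _ _ (by
    rw [add_hom, LinearMap.add_apply, map_add, ι_whiskerLeft, ι_whiskerLeft, ι_whiskerLeft,
      add_hom, LinearMap.lTensor_add]; rfl))
  add_whiskerRight f g := hom_ext (LinearMap.ext fun w => ι_injective _ _ (by
    rw [add_hom, LinearMap.add_apply, map_add, ι_whiskerRight, ι_whiskerRight, ι_whiskerRight,
      add_hom, LinearMap.rTensor_add]; rfl))

instance : MonoidalLinear k (FinRep k A) where
  whiskerLeft_smul X _ _ r f := hom_ext (LinearMap.ext fun w => ι_injective _ _ (by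
    rw [smul_hom, LinearMap.smul_apply, map_smul, ι_whiskerLeft, ι_whiskerLeft,
      smul_hom, LinearMap.lTensor_smul]; rfl))
  smul_whiskerRight r _ _ f X := hom_ext (LinearMap.ext fun w => ι_injective _ _ (by
    rw [smul_hom, LinearMap.smul_apply, map_smul, ι_whiskerRight, ι_whiskerRight,
      smul_hom, LinearMap.rTensor_smul]; rfl))

end Monoidal

end FinRep

/-! ### Antipodes of weak bialgebras -/

namespace WeakBialgebra

open Coalgebra MulOpposite

section SourceMap

lemma rTensor_mulRight {k A : Type u} [Field k] [Ring A] [Algebra k A] (h : A) (t : A ⊗[k] A) :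
    (LinearMap.mulRight k h).rTensor A t = t * (h ⊗ₜ 1) := by
  induction t with
  | zero => simp
  | add t t' ht ht' => rw [map_add, ht, ht', add_mul]
  | tmul a b => simp

variable (k A : Type u) [Field k] [Ring A] [Algebra k A] [WeakBialgebra k A]

/-- The source map `ε_s(h) = (id ⊗ ε)((1 ⊗ h)Δ(1))`. -/
def εs : A →ₗ[k] A :=
  counitR k A ∘ₗ LinearMap.mulRight k (comul (1 : A)) ∘ₗ TensorProduct.mk k A A 1

variable {A}

lemma counitR_mul_comul (y h : A) : counitR k A ((1 ⊗ₜ y) * comul h) = εs k A y * h := by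
  let Φ (t : A ⊗[k] A) : (A ⊗[k] A) ⊗[k] A →ₗ[k] A := TensorProduct.rid k A ∘ₗ
    TensorProduct.map (counitR k A ∘ₗ LinearMap.mulRight k t) (counit ∘ₗ LinearMap.mulLeft k y)
  have hΦ_comul (s : A ⊗[k] A) :
      Φ (comul h) (comul.rTensor A s) = counitR k A ((1 ⊗ₜ y) * s) * h := by
    induction s with
    | zero => simp
    | add s t hs ht => simp only [mul_add, add_mul, map_add, hs, ht]
    | tmul p q => simp [Φ, ← comul_mul, counitR_comul, counitR_tmul]
  have hΦ_counit (s t : A ⊗[k] A) : Φ t ((TensorProduct.assoc k A A A).symm (comul.lTensor A s)) =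
      counitR k A ((1 ⊗ₜ y) * (s * t)) := by
    induction s with
    | zero => simp
    | add s s' hs hs' => simp only [add_mul, mul_add, map_add, hs, hs']
    | tmul p q =>
      induction t with
      | zero => simp [Φ]
      | add t t' ht ht' =>
        have hΦ_add : Φ (t + t') = Φ t + Φ t' := by ext; simp [Φ, mul_add, TensorProduct.add_tmul]
        simp only [hΦ_add, LinearMap.add_apply, ht, ht', mul_add, map_add]
      | tmul a b =>
        simp only [Algebra.TensorProduct.tmul_mul_tmul, counitR_tmul, one_mul, ← mul_assoc,
          counit_mul_mul', LinearMap.lTensor_tmul]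
        induction comul (R := k) q with
        | zero => simp
        | add r r' hr hr' => simp only [TensorProduct.tmul_add, map_add, hr, hr', add_smul]
        | tmul c d => simp [Φ, counitR_tmul, smul_smul, mul_comm]
  rw [← comul_one_mul_comul, ← hΦ_counit, ← coassoc_one, LinearEquiv.symm_apply_apply, hΦ_comul]
  rfl

/-- For `t = t₁ ⊗ t₂` and `s = s₁ ⊗ s₂`, both sides are `t₁ ⊗ ε(s₁ t₂) s₂`. -/
lemma rTensor_counitR_eq_lTensor_counitL (s t : A ⊗[k] A) :
    (counitR k A ∘ₗ LinearMap.mulRight k t ∘ₗ TensorProduct.mk k A A 1).rTensor A s =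
      (counitL k A ∘ₗ LinearMap.mulLeft k s ∘ₗ (TensorProduct.mk k A A).flip 1).lTensor A t := by
  induction s with
  | zero =>
    rw [LinearMap.mulLeft_zero_eq_zero]
    simp
  | add s s' hs hs' =>
    have h : LinearMap.mulLeft k (s + s') = LinearMap.mulLeft k s + LinearMap.mulLeft k s' := by
      ext; simp [add_mul]
    rw [map_add, hs, hs', h, LinearMap.add_comp, LinearMap.comp_add, LinearMap.lTensor_add,
      LinearMap.add_apply]
  | tmul p q =>
    induction t with
    | zero => simp
    | add t t' ht ht' =>
      rw [map_add, ← ht, ← ht']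
      simp [mul_add, TensorProduct.add_tmul]
    | tmul a b => simp [counitL_tmul, counitR_tmul, TensorProduct.smul_tmul]

lemma lTensor_εt_comul_one_eq : (εt k A).lTensor A (comul (1 : A)) = comul (1 : A) := by
  have h := lTensor_εt_comul_one k (1 : A)
  rwa [LinearMap.mulRight_one, LinearMap.comp_id, εr_one, ← Algebra.TensorProduct.one_def,
    mul_one] at h

lemma lTensor_εt_comul (h : A) :
    (εt k A).lTensor A (comul h) = comul (1 : A) * (h ⊗ₜ 1) := by
  have key (h : A) : (εt k A).lTensor A (comul h) =
      (εs k A).rTensor A (comul (1 : A)) * (h ⊗ₜ 1) := by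
    rw [← rTensor_mulRight, ← LinearMap.rTensor_comp_apply]
    refine (rTensor_counitR_eq_lTensor_counitL k _ _).symm.trans ?_
    congr 2
    exact LinearMap.ext fun y => counitR_mul_comul k y h
  have h_one : (εs k A).rTensor A (comul (1 : A)) = comul (1 : A) := by
    rw [← mul_one ((εs k A).rTensor A _), Algebra.TensorProduct.one_def, ← key,
      lTensor_εt_comul_one_eq]
  rw [key, h_one]

lemma rTensor_εs_comul_one_mul (h : A) :
    (εs k A).rTensor A (comul (1 : A) * (h ⊗ₜ 1)) =
      (εt k A).lTensor A ((1 ⊗ₜ h) * comul (1 : A)) := by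
  refine Eq.trans ?_ (rTensor_counitR_eq_lTensor_counitL k _ _)
  rw [← rTensor_mulRight, ← LinearMap.rTensor_comp_apply]
  congr 2
  ext a
  simp [εs]

lemma εr_εt (h : A) : εr k A (εt k A h) = εr k A h := by
  rw [εr_apply, εr_apply]
  induction comul (R := k) (1 : A) with
  | zero => simp
  | add s t hs ht => simp only [add_mul, map_add, hs, ht]
  | tmul a b => simp only [Algebra.TensorProduct.tmul_mul_tmul, counitR_tmul, counit_mul_εt]

lemma sum_εr_right_mul_left {h : A} {ι : Type*} (r : Coalgebra.Repr k h ι) :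
    ∑ i ∈ r.index, εr k A (r.right i) * r.left i = h := by
  have key (a b : A) : εr k A b * a = counitR k A (comul (1 : A) * (a ⊗ₜ b)) := by
    rw [εr_apply]
    induction comul (R := k) (1 : A) with
    | zero => simp
    | add s t hs ht => simp only [add_mul, map_add, hs, ht]
    | tmul p q => simp [counitR_tmul]
  simp only [key]
  rw [← map_sum, ← Finset.mul_sum, r.eq, comul_one_mul_comul, counitR_comul]

end SourceMap

section Antipode

variable {k A : Type u} [Field k] [Ring A] [Algebra k A] [WeakBialgebra k A]

/-- The linear endomorphism underlying an anti-endomorphism of an algebra. -/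
def unopLinearMap {k A : Type u} [Field k] [Ring A] [Algebra k A] (S : A →ₐ[k] Aᵐᵒᵖ) : A →ₗ[k] A :=
  (opLinearEquiv k).symm.toLinearMap ∘ₗ S.toLinearMap

/-- An antipode of a weak bialgebra: an anti-endomorphism `S` of the algebra with
`h₁ S(h₂) = ε_t(h)` and `S(h₁) h₂ = ε_s(h)`. Anti-multiplicativity, encoded by the opposite algebra
in the codomain, takes the place of the usual third axiom `S(h₁) h₂ S(h₃) = S(h)`. -/
structure IsAntipode (S : A →ₐ[k] Aᵐᵒᵖ) : Prop where
  mul_lTensor_comul (h : A) :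
    LinearMap.mul' k A ((unopLinearMap S).lTensor A (comul h)) = εt k A h
  mul_rTensor_comul (h : A) :
    LinearMap.mul' k A ((unopLinearMap S).rTensor A (comul h)) = εs k A h

variable {S : A →ₐ[k] Aᵐᵒᵖ}

lemma IsAntipode.sum_left_mul_antipode_εt (hS : IsAntipode S) {ι : Type*}
    (r : Coalgebra.Repr k (1 : A) ι) :
    ∑ i ∈ r.index, r.left i * unop (S (εt k A (r.right i))) = 1 := by
  refine Eq.trans ?_ ((hS.mul_lTensor_comul 1).trans (εt_one k))
  rw [← lTensor_εt_comul_one_eq, ← r.eq]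
  simp [unopLinearMap]

/-- The Sweedler form is `S(h₁) 1₁ h₂ ⊗ ε_t(1₂) = 1₁ ⊗ ε_t(h 1₂)`. -/
lemma IsAntipode.sum_antipode_mul_left_mul (hS : IsAntipode S) {ι : Type*}
    (r : Coalgebra.Repr k (1 : A) ι) (h : A) :
    ∑ i ∈ r.index, LinearMap.mul' k A (TensorProduct.map (unopLinearMap S)
        (LinearMap.mulLeft k (r.left i)) (comul h)) ⊗ₜ[k] εt k A (r.right i) =
      (εt k A).lTensor A ((1 ⊗ₜ h) * comul (1 : A)) := by
  let F : A ⊗[k] (A ⊗[k] A) →ₗ[k] A ⊗[k] A :=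
    (LinearMap.mul' k A ∘ₗ (unopLinearMap S).rTensor A).rTensor A ∘ₗ
      (TensorProduct.assoc k A A A).symm
  have F_comul : F (comul.lTensor A (comul h)) = (εs k A).rTensor A (comul h) := by
    rw [← coassoc_apply, LinearMap.comp_apply, LinearEquiv.coe_coe, LinearEquiv.symm_apply_apply,
      ← LinearMap.rTensor_comp_apply]
    congr 2
    exact LinearMap.ext hS.mul_rTensor_comul
  have F_εt (t : A ⊗[k] (A ⊗[k] A)) :
      F (((εt k A).lTensor A).lTensor A t) = (εt k A).lTensor A (F t) := by
    have h : F ∘ₗ ((εt k A).lTensor A).lTensor A = (εt k A).lTensor A ∘ₗ F := by ext; simp [F]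
    exact LinearMap.congr_fun h t
  have F_sum (t : A ⊗[k] A) : ∑ i ∈ r.index, LinearMap.mul' k A
      (TensorProduct.map (unopLinearMap S) (LinearMap.mulLeft k (r.left i)) t) ⊗ₜ[k]
        εt k A (r.right i) =
      F (((εt k A).lTensor A ∘ₗ comul).lTensor A t) := by
    induction t with
    | zero => simp
    | add t t' ht ht' =>
      simp only [map_add, TensorProduct.add_tmul, Finset.sum_add_distrib, ht, ht']
    | tmul a b =>
      rw [LinearMap.lTensor_tmul, LinearMap.comp_apply (g := comul), lTensor_εt_comul,
        ← lTensor_εt_comul_one_eq, ← r.eq]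
      simp [F, Finset.sum_mul, TensorProduct.tmul_sum]
  rw [F_sum, LinearMap.lTensor_comp_apply, F_εt, F_comul, ← rTensor_εs_comul_one_mul,
    ← lTensor_εt_comul]
  exact LinearMap.congr_fun ((LinearMap.lTensor_comp_rTensor ..).trans
    (LinearMap.rTensor_comp_lTensor ..).symm) (comul h)

end Antipode

end WeakBialgebra

/-! ### Rigidity -/

namespace FinRep

open Coalgebra WeakBialgebra MulOpposite

section Dual

variable {k A : Type u} [Field k] [Ring A] [Algebra k A]

/-- The dual space of a representation, on which `a` acts by the transpose of `S a`, for an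
anti-endomorphism `S` of the algebra. -/
def dual (S : A →ₐ[k] Aᵐᵒᵖ) (X : FinRep k A) : FinRep k A where
  V := Module.Dual k X.V
  ρ := AlgHom.ofLinearMap
    { toFun := fun a => (X.ρ (unop (S a))).dualMap
      map_add' := fun a b => LinearMap.ext fun f => LinearMap.ext fun v => by simp
      map_smul' := fun r a => LinearMap.ext fun f => LinearMap.ext fun v => by simp }
    (LinearMap.ext fun f => LinearMap.ext fun v => by simp)
    (fun a b => LinearMap.ext fun f => LinearMap.ext fun v => by simp)

variable {S : A →ₐ[k] Aᵐᵒᵖ}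

/-- The elements of the dual representation as linear forms. -/
def dualForm (X : FinRep k A) : (dual S X).V ≃ₗ[k] Module.Dual k X.V :=
  LinearEquiv.refl k (Module.Dual k X.V)

lemma dualForm_ρ (X : FinRep k A) (a : A) (f : (dual S X).V) (v : X.V) :
    dualForm X ((dual S X).ρ a f) v = dualForm X f (X.ρ (unop (S a)) v) := rfl

/-- The isomorphism `X ⊗ X* ≃ End X`, `x ⊗ f ↦ (v ↦ f(v) x)`. -/
def tensorDualEquiv (X : FinRep k A) : X.V ⊗[k] (dual S X).V ≃ₗ[k] Module.End k X.V :=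
  TensorProduct.congr (LinearEquiv.refl k X.V) (dualForm X) ≪≫ₗ TensorProduct.comm k _ _ ≪≫ₗ
    dualTensorHomEquiv k X.V X.V

lemma tensorDualEquiv_tmul (X : FinRep k A) (x v : X.V) (f : (dual S X).V) :
    tensorDualEquiv X (x ⊗ₜ f) v = dualForm X f v • x := by
  simp [tensorDualEquiv]

lemma tensorDualEquiv_act₂ (X : FinRep k A) (a b : A) (w : X.V ⊗[k] (dual S X).V) :
    tensorDualEquiv X (act₂ X (dual S X) (a ⊗ₜ b) w) =
      X.ρ a ∘ₗ tensorDualEquiv X w ∘ₗ X.ρ (unop (S b)) := by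
  induction w with
  | zero => simp
  | add w w' h h' => simp only [map_add, h, h', LinearMap.add_comp, LinearMap.comp_add]
  | tmul x f =>
    ext v
    rw [act₂_tmul, TensorProduct.map_tmul, tensorDualEquiv_tmul, LinearMap.comp_apply,
      LinearMap.comp_apply, tensorDualEquiv_tmul, dualForm_ρ, map_smul]

/-- The isomorphism of a representation with its double dual with respect to inverse
anti-automorphisms. -/
def doubleDualIso (S : A ≃ₐ[k] Aᵐᵒᵖ) (X : FinRep k A) :
    X ≅ dual (S : A →ₐ[k] Aᵐᵒᵖ) (dual ((AlgEquiv.opComm S).symm : A →ₐ[k] Aᵐᵒᵖ) X) :=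
  mkIso ⟨Module.Dual.eval k X.V, fun a v => LinearMap.ext fun f : Module.Dual k X.V => by
      change f (X.ρ a v) = f (X.ρ (unop ((AlgEquiv.opComm S).symm (unop (S a)))) v)
      congr
      exact (congrArg unop ((AlgEquiv.opComm S).symm_apply_apply (op a))).symm⟩
    (Module.evalEquiv k X.V).symm.toLinearMap
    (LinearMap.ext fun v => (Module.evalEquiv k X.V).symm_apply_apply v)
    (LinearMap.ext fun v => (Module.evalEquiv k X.V).apply_symm_apply v)

/-- The element of `X ⊗ X*` corresponding to the identity of `X`. -/
def coevElt (S : A →ₐ[k] Aᵐᵒᵖ) (X : FinRep k A) : X.V ⊗[k] (dual S X).V :=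
  (tensorDualEquiv X).symm 1

lemma tensorDualEquiv_act₂_coevElt (X : FinRep k A) (t : A ⊗[k] A) :
    tensorDualEquiv X (act₂ X (dual S X) t (coevElt S X)) =
      X.ρ (LinearMap.mul' k _ ((unopLinearMap S).lTensor _ t)) := by
  induction t with
  | zero => simp
  | add s t hs ht => simp only [map_add, LinearMap.add_apply, hs, ht]
  | tmul a b =>
    rw [tensorDualEquiv_act₂, coevElt, LinearEquiv.apply_symm_apply, LinearMap.lTensor_tmul,
      LinearMap.mul'_apply, map_mul]
    rfl

end Dual

section Tensor

variable {k A : Type u} [Field k] [Ring A] [Algebra k A] [WeakBialgebra k A]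

lemma tensorMap_π {X X' Y Y' : FinRep k A} (f : X ⟶ X') (g : Y ⟶ Y') (w : X.V ⊗[k] Y.V) :
    (tensorMap f g).hom (π X Y w) = π X' Y' (TensorProduct.map f.hom g.hom w) := by
  apply ι_injective
  rw [ι_tensorMap, ι_π, ι_π, act₂_natural]

lemma ρ_π (X Y : FinRep k A) (a : A) (w : X.V ⊗[k] Y.V) :
    (tensor X Y).ρ a (π X Y w) = π X Y (act₂ X Y (comul a) w) := by
  apply ι_injective
  rw [ι_ρ, ι_π, ι_π, act₂_mul_apply, act₂_mul_apply, comul_mul_comul_one, comul_one_mul_comul]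

lemma assocIso_hom_pL (X Y Z : FinRep k A) (w : (X.V ⊗[k] Y.V) ⊗[k] Z.V) :
    (assocIso X Y Z).hom.hom (pL X Y Z w) = pR X Y Z (TensorProduct.assoc k _ _ _ w) := by
  apply jR_injective
  rw [jR_assocIso, jL_pL, jR_pR]

lemma assocIso_inv_pR (X Y Z : FinRep k A) (w : X.V ⊗[k] (Y.V ⊗[k] Z.V)) :
    (assocIso X Y Z).inv.hom (pR X Y Z w) = pL X Y Z ((TensorProduct.assoc k _ _ _).symm w) := by
  have h := assocIso_hom_pL X Y Z ((TensorProduct.assoc k _ _ _).symm w)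
  rw [LinearEquiv.apply_symm_apply] at h
  rw [← h]
  exact hom_congr (assocIso X Y Z).hom_inv_id _

variable [FiniteDimensional k A]

lemma leftIso_hom_π (X : FinRep k A) (w : (tensorUnit k A).V ⊗[k] X.V) :
    (leftIso X).hom.hom (π _ _ w) = leftAct X w := by
  rw [leftIso_apply, ι_π, leftCounit_act₂, map_one]; rfl

lemma rightIso_hom_π (X : FinRep k A) (w : X.V ⊗[k] (tensorUnit k A).V) :
    (rightIso X).hom.hom (π _ _ w) = rightAct X w := by
  rw [rightIso_apply, ι_π, rightCounit_act₂, map_one]; rfl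

lemma leftIso_inv_apply (X : FinRep k A) (x : X.V) :
    (leftIso X).inv.hom x = π (tensorUnit k A) X (oneT k A ⊗ₜ x) := rfl

lemma rightIso_inv_apply (X : FinRep k A) (x : X.V) :
    (rightIso X).inv.hom x = π X (tensorUnit k A) (x ⊗ₜ oneT k A) := rfl

lemma incl_εt' (a : A) : incl k A (εt' k A a) = εt k A a := rfl

end Tensor

section Pairing

variable {k A : Type u} [Field k] [Ring A] [Algebra k A] [WeakBialgebra k A]
  {S : A →ₐ[k] Aᵐᵒᵖ} (hS : IsAntipode S) (X : FinRep k A)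

include hS in
lemma act₂_comul_εt_coevElt (h : A) :
    act₂ X (dual S X) (comul (εt k A h)) (coevElt S X) =
      act₂ X (dual S X) (comul h) (coevElt S X) := by
  apply (tensorDualEquiv X).injective
  rw [tensorDualEquiv_act₂_coevElt, tensorDualEquiv_act₂_coevElt, hS.mul_lTensor_comul,
    hS.mul_lTensor_comul, εt_εt]

variable [FiniteDimensional k A]

/-- The coevaluation `z ↦ z · coevElt`. -/
def coev : tensorUnit k A ⟶ tensor X (dual S X) where
  hom := (tensor X (dual S X)).ρ.toLinearMap.flip (π _ _ (coevElt S X)) ∘ₗ incl k A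
  comm a z := by
    change (tensor X (dual S X)).ρ (εt k A (a * incl k A z)) (π _ _ (coevElt S X)) =
      (tensor X (dual S X)).ρ a ((tensor X (dual S X)).ρ (incl k A z) (π _ _ (coevElt S X)))
    rw [ρ_π, act₂_comul_εt_coevElt hS, ← ρ_π, map_mul]
    rfl

lemma coev_oneT : (coev hS X).hom (oneT k A) = π X (dual S X) (coevElt S X) := by
  change (tensor X (dual S X)).ρ (incl k A (oneT k A)) (π _ _ (coevElt S X)) = _
  rw [incl_oneT, map_one]
  rfl

/-- The evaluation on the full tensor product: `f ⊗ v ↦ f(1₁ v) ε_t(1₂)`. -/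
def evFull (S : A →ₐ[k] Aᵐᵒᵖ) (X : FinRep k A) :
    (dual S X).V ⊗[k] X.V →ₗ[k] (tensorUnit k A).V :=
  ∑ i ∈ (ℛ k (1 : A)).index,
    LinearMap.toSpanSingleton k _ (εt' k A ((ℛ k (1 : A)).right i)) ∘ₗ contractLeft k X.V ∘ₗ
      TensorProduct.map (dualForm X).toLinearMap (X.ρ ((ℛ k (1 : A)).left i))

lemma evFull_tmul (f : (dual S X).V) (v : X.V) :
    evFull S X (f ⊗ₜ v) = ∑ i ∈ (ℛ k (1 : A)).index,
      dualForm X f (X.ρ ((ℛ k (1 : A)).left i) v) • εt' k A ((ℛ k (1 : A)).right i) := by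
  rw [evFull, LinearMap.sum_apply]
  rfl

include hS in
lemma evFull_act₂ (h : A) (w : (dual S X).V ⊗[k] X.V) :
    evFull S X (act₂ (dual S X) X (comul h) w) = (tensorUnit k A).ρ h (evFull S X w) := by
  induction w with
  | zero => simp
  | add w w' h h' => simp only [map_add, h, h']
  | tmul f v =>
    let E : A ⊗[k] A →ₗ[k] (tensorUnit k A).V := (TensorProduct.lid k _).toLinearMap ∘ₗ
      TensorProduct.map (dualForm X f ∘ₗ X.ρ.toLinearMap.flip v) (εt' k A)
    have hE (a b : A) : E (a ⊗ₜ b) = dualForm X f (X.ρ a v) • εt' k A b := rfl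
    have E_εt (t : A ⊗[k] A) : E ((εt k A).lTensor A t) = E t := by
      have h : E ∘ₗ (εt k A).lTensor A = E := by
        ext a b
        exact congrArg (dualForm X f (X.ρ a v) • ·) (εt'_εt (k := k) b)
      exact LinearMap.congr_fun h t
    have key (t : A ⊗[k] A) : evFull S X (act₂ (dual S X) X t (f ⊗ₜ v)) =
        E (∑ i ∈ (ℛ k (1 : A)).index, LinearMap.mul' k A (TensorProduct.map (unopLinearMap S)
          (LinearMap.mulLeft k ((ℛ k (1 : A)).left i)) t) ⊗ₜ[k]
            εt k A ((ℛ k (1 : A)).right i)) := by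
      induction t with
      | zero => simp
      | add s t hs ht =>
        simp only [map_add, LinearMap.add_apply, hs, ht, TensorProduct.add_tmul,
          Finset.sum_add_distrib]
      | tmul a b =>
        rw [act₂_tmul, TensorProduct.map_tmul, map_sum, evFull_tmul]
        refine Finset.sum_congr rfl fun i _ => ?_
        rw [← LinearMap.lTensor_tmul, E_εt, hE, dualForm_ρ, TensorProduct.map_tmul,
          LinearMap.mul'_apply, LinearMap.mulLeft_apply, map_mul, map_mul]
        rfl
    rw [key, hS.sum_antipode_mul_left_mul, E_εt, evFull_tmul, map_sum, ← (ℛ k (1 : A)).eq,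
      Finset.mul_sum, map_sum]
    refine Finset.sum_congr rfl fun i _ => ?_
    rw [Algebra.TensorProduct.tmul_mul_tmul, one_mul, hE, map_smul, tensorUnit_ρ, incl_εt']
    exact congrArg _ (Subtype.ext (εt_mul_εt k _ _).symm)

/-- The evaluation. -/
def ev : tensor (dual S X) X ⟶ tensorUnit k A where
  hom := evFull S X ∘ₗ ι _ _
  comm a w := by
    rw [LinearMap.comp_apply, LinearMap.comp_apply, ι_ρ, evFull_act₂ hS]

lemma ev_comp_π : (ev hS X).hom ∘ₗ π _ _ = evFull S X := by
  refine LinearMap.ext fun w => ?_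
  change evFull S X (ι _ _ (π _ _ w)) = _
  rw [ι_π, evFull_act₂ hS, map_one]
  rfl

lemma rightAct_evFull (x : X.V) (w : X.V ⊗[k] (dual S X).V) :
    rightAct X ((evFull S X).lTensor X.V (TensorProduct.assoc k _ _ _ (w ⊗ₜ x))) =
      ∑ i ∈ (ℛ k (1 : A)).index, X.ρ (εr k A ((ℛ k (1 : A)).right i))
        (tensorDualEquiv X w (X.ρ ((ℛ k (1 : A)).left i) x)) := by
  induction w with
  | zero => simp
  | add w w' h h' =>
    simp only [TensorProduct.add_tmul, map_add, h, h', LinearMap.add_apply, Finset.sum_add_distrib]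
  | tmul v f =>
    rw [TensorProduct.assoc_tmul, LinearMap.lTensor_tmul, evFull_tmul, TensorProduct.tmul_sum,
      map_sum]
    refine Finset.sum_congr rfl fun i _ => ?_
    rw [TensorProduct.tmul_smul, map_smul, rightAct_tmul, incl_εt', εr_εt, tensorDualEquiv_tmul,
      map_smul]

lemma leftAct_evFull (f : (dual S X).V) (w : X.V ⊗[k] (dual S X).V) :
    dualForm X (leftAct (dual S X) ((evFull S X).rTensor (dual S X).V
      ((TensorProduct.assoc k (dual S X).V X.V (dual S X).V).symm (f ⊗ₜ w)))) =
      ∑ i ∈ (ℛ k (1 : A)).index, dualForm X f ∘ₗ X.ρ ((ℛ k (1 : A)).left i) ∘ₗ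
        tensorDualEquiv X w ∘ₗ X.ρ (unop (S (εt k A ((ℛ k (1 : A)).right i)))) := by
  induction w with
  | zero => simp
  | add w w' h h' =>
    simp only [TensorProduct.tmul_add, map_add, h, h', LinearMap.add_comp, LinearMap.comp_add,
      Finset.sum_add_distrib]
  | tmul v g =>
    rw [TensorProduct.assoc_symm_tmul, LinearMap.rTensor_tmul, evFull_tmul,
      TensorProduct.sum_tmul, map_sum, map_sum]
    refine Finset.sum_congr rfl fun p _ => LinearMap.ext fun y => ?_
    rw [← TensorProduct.smul_tmul', map_smul, leftAct_tmul, incl_εt', map_smul,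
      LinearMap.smul_apply, dualForm_ρ, LinearMap.comp_apply,
      LinearMap.comp_apply, LinearMap.comp_apply, tensorDualEquiv_tmul, map_smul, map_smul,
      smul_eq_mul, smul_eq_mul, mul_comm]

lemma zigzag :
    (leftIso X).inv ≫ tensorMap (coev hS X) (𝟙 X) ≫ (assocIso X (dual S X) X).hom ≫
      tensorMap (𝟙 X) (ev hS X) ≫ (rightIso X).hom = 𝟙 X := by
  refine FinRep.hom_ext (LinearMap.ext fun x => ?_)
  simp only [comp_hom, LinearMap.comp_apply]
  rw [leftIso_inv_apply, tensorMap_π, TensorProduct.map_tmul, coev_oneT]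
  have h1 : π (tensor X (dual S X)) X (π X (dual S X) (coevElt S X) ⊗ₜ (Hom.hom (𝟙 X)) x) =
    pL X (dual S X) X (coevElt S X ⊗ₜ x) := rfl
  have h2 (w) : TensorProduct.map (Hom.hom (𝟙 X)) (ev hS X).hom
      ((π (dual S X) X).lTensor X.V w) = (evFull S X).lTensor X.V w := by
    rw [← ev_comp_π hS, LinearMap.lTensor_comp]
    rfl
  rw [h1, assocIso_hom_pL, pR, LinearMap.comp_apply, tensorMap_π, rightIso_hom_π, h2,
    rightAct_evFull, coevElt, LinearEquiv.apply_symm_apply]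
  have h3 := congrArg (X.ρ · x) (sum_εr_right_mul_left k (ℛ k (1 : A)))
  simpa using h3

lemma zigzag_dual :
    (rightIso (dual S X)).inv ≫ tensorMap (𝟙 (dual S X)) (coev hS X) ≫
      (assocIso (dual S X) X (dual S X)).inv ≫
      tensorMap (ev hS X) (𝟙 (dual S X)) ≫ (leftIso (dual S X)).hom = 𝟙 (dual S X) := by
  refine FinRep.hom_ext (LinearMap.ext fun f => (dualForm X).injective ?_)
  simp only [comp_hom, LinearMap.comp_apply]
  rw [rightIso_inv_apply, tensorMap_π, TensorProduct.map_tmul, coev_oneT]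
  have h1 : π (dual S X) (tensor X (dual S X))
      ((Hom.hom (𝟙 (dual S X))) f ⊗ₜ π X (dual S X) (coevElt S X)) =
    pR (dual S X) X (dual S X) (f ⊗ₜ coevElt S X) := rfl
  have h2 (w) : TensorProduct.map (ev hS X).hom (Hom.hom (𝟙 (dual S X)))
      ((π (dual S X) X).rTensor (dual S X).V w) = (evFull S X).rTensor (dual S X).V w := by
    rw [← ev_comp_π hS, LinearMap.rTensor_comp]
    rfl
  rw [h1, assocIso_inv_pR, pL, LinearMap.comp_apply, tensorMap_π, leftIso_hom_π, h2,
    leftAct_evFull, coevElt, LinearEquiv.apply_symm_apply]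
  refine LinearMap.ext fun x => ?_
  rw [LinearMap.sum_apply]
  refine (map_sum (dualForm X f) _ _).symm.trans (congrArg (dualForm X f) ?_)
  have h3 := congrArg (X.ρ · x) (hS.sum_left_mul_antipode_εt (ℛ k (1 : A)))
  simpa using h3

/-- The dual of a representation with respect to an antipode is a right dual. -/
@[reducible]
def exactPairing : ExactPairing X (dual S X) where
  coevaluation' := coev hS X
  evaluation' := ev hS X
  coevaluation_evaluation' := by
    have h : (ρ_ (dual S X)).inv ≫ dual S X ◁ coev hS X ≫ (α_ (dual S X) X (dual S X)).inv ≫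
      ev hS X ▷ dual S X ≫ (λ_ (dual S X)).hom = 𝟙 (dual S X) := zigzag_dual hS X
    rw [← Iso.inv_comp_eq, ← cancel_mono (λ_ (dual S X)).hom, Iso.inv_hom_id]
    simpa only [Category.assoc] using h
  evaluation_coevaluation' := by
    have h : (λ_ X).inv ≫ coev hS X ▷ X ≫ (α_ X (dual S X) X).hom ≫ X ◁ ev hS X ≫ (ρ_ X).hom =
      𝟙 X := zigzag hS X
    rw [← Iso.inv_comp_eq, ← cancel_mono (ρ_ X).hom, Iso.inv_hom_id]
    simpa only [Category.assoc] using h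

end Pairing

section Multifusion

variable {k A : Type u} [Field k] [Ring A] [Algebra k A] [WeakBialgebra k A]
  [FiniteDimensional k A]

/-- Right duals are formed with a bijective antipode and left duals with its inverse. -/
@[reducible]
def rigidCategory (S : A ≃ₐ[k] Aᵐᵒᵖ) (hS : IsAntipode (S : A →ₐ[k] Aᵐᵒᵖ)) :
    RigidCategory (FinRep k A) where
  rightDual X := { rightDual := dual S X, exact := exactPairing hS X }
  leftDual X :=
    { leftDual := dual ((AlgEquiv.opComm S).symm : A →ₐ[k] Aᵐᵒᵖ) X
      exact := letI := exactPairing hS (dual ((AlgEquiv.opComm S).symm : A →ₐ[k] Aᵐᵒᵖ) X)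
        exactPairingCongrRight (doubleDualIso S X) }

theorem isMultifusion [IsSemisimpleRing A] (S : A ≃ₐ[k] Aᵐᵒᵖ)
    (hS : IsAntipode (S : A →ₐ[k] Aᵐᵒᵖ)) : IsMultifusion k (FinRep k A) where
  monoidalPreadditive := inferInstance
  monoidalLinear := inferInstance
  abelian := ⟨inferInstance, rfl⟩
  semisimple := exists_bicone_simple
  finite_simples := exists_fin_simple
  finiteDimensional_hom := finiteDimensional_hom
  rigid := ⟨rigidCategory S hS⟩

end Multifusion

end FinRep

/-! ### Inverses in groupoids and double groupoids -/

namespace GroupoidOn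

variable {Arr Obj : Type u} (G : GroupoidOn Arr Obj)

lemma inv_one (p : Obj) : G.inv (G.one p) = G.one p := by
  symm
  apply G.eq_inv
  · rw [G.tgt_one, G.src_one]
  · simpa only [G.src_one] using G.one_comp (G.one p)

end GroupoidOn

namespace VacantDoubleGroupoid

variable {B H V P : Type u} (T : VacantDoubleGroupoid B H V P)

lemma hinv_vcomp {A C : B} (h : T.vBox.tgt A = T.vBox.src C) :
    T.hBox.inv (T.vBox.comp A C) = T.vBox.comp (T.hBox.inv A) (T.hBox.inv C) := by
  have h' : T.vBox.tgt (T.hBox.inv A) = T.vBox.src (T.hBox.inv C) := by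
    rw [T.bot_hinv, T.top_hinv, h]
  have hA := (T.hBox.src_inv A).symm
  have hC := (T.hBox.src_inv C).symm
  symm
  apply T.hBox.eq_inv
  · rw [T.right_vcomp _ _ h, T.left_vcomp _ _ h', hA, hC]
  · rw [← T.interchange _ _ _ _ hA hC h h', T.hBox.comp_inv, T.hBox.comp_inv,
      T.vcomp_hone _ _ (by rw [T.bot_left, T.top_left, h]), T.left_vcomp _ _ h]

lemma hinv_vone (x : H) : T.hBox.inv (T.vBox.one x) = T.vBox.one (T.hor.inv x) := by
  symm
  apply T.hBox.eq_inv
  · rw [T.right_vone, T.left_vone, T.hor.src_inv]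
  · rw [T.hcomp_vone _ _ (T.hor.src_inv x).symm, T.hor.comp_inv, T.vone_one, T.left_vone]

lemma ext_bot_left {A C : B} (h : T.vBox.tgt A = T.vBox.tgt C)
    (h' : T.hBox.src A = T.hBox.src C) : A = C := by
  rw [← T.vBox.inv_inv A, ← T.vBox.inv_inv C]
  congr 1
  apply T.ext_top_left
  · rw [T.vBox.src_inv, T.vBox.src_inv, h]
  · rw [left_vinv, left_vinv, h']

lemma bot_eq_one_of_bot_eq {A X : B} (h : T.hBox.src X = T.hBox.src A)
    (e : T.vBox.tgt (T.hBox.comp (T.hBox.inv X) A) = T.hor.inv (T.vBox.tgt X)) :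
    T.vBox.tgt A = T.hor.one (T.hor.src (T.vBox.tgt X)) := by
  have h' : T.hBox.tgt X = T.hBox.src (T.hBox.comp (T.hBox.inv X) A) := by
    rw [T.hBox.src_comp _ _ (by rw [T.hBox.tgt_inv, h]), T.hBox.src_inv]
  rw [← T.hBox.comp_inv_cancel h, T.bot_hcomp _ _ h', e, T.hor.comp_inv]

lemma top_eq_one_of_top_eq {A X : B} (h : T.hBox.src X = T.hBox.src A)
    (e : T.vBox.src (T.hBox.comp (T.hBox.inv X) A) = T.hor.inv (T.vBox.src X)) :
    T.vBox.src A = T.hor.one (T.hor.src (T.vBox.src X)) := by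
  have h' : T.hBox.tgt X = T.hBox.src (T.hBox.comp (T.hBox.inv X) A) := by
    rw [T.hBox.src_comp _ _ (by rw [T.hBox.tgt_inv, h]), T.hBox.src_inv]
  rw [← T.hBox.comp_inv_cancel h, T.top_hcomp _ _ h', e, T.hor.comp_inv]

lemma isHOne_of_bot {A : B} {p : P} (h : T.vBox.tgt A = T.hor.one p) : T.IsHOne A := by
  apply T.ext_bot_left
  · rw [T.bot_hone, T.bot_left, h, T.hor.src_one]
  · rw [T.hBox.src_one]

lemma isHOne_vone_one (p : P) : T.IsHOne (T.vBox.one (T.hor.one p)) :=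
  T.isHOne_of_top (T.vBox.src_one _)

variable {T}

lemma IsHOne.top_eq {A : B} (h : T.IsHOne A) :
    T.vBox.src A = T.hor.one (T.ver.src (T.hBox.src A)) := by
  conv_lhs => rw [h, T.top_hone]

lemma IsHOne.hinv_hcomp {A X : B} (hA : T.IsHOne A) (h : T.hBox.src X = T.hBox.src A) :
    T.hBox.comp (T.hBox.inv X) A = T.hBox.inv X := by
  rw [hA, ← h, ← T.hBox.tgt_inv, T.hBox.comp_one]

end VacantDoubleGroupoid

/-! ### The twisted groupoid algebra -/

namespace DoubleGroupoid.Cocycle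

variable {B H V P : Type u} {T : DoubleGroupoid B H V P} {k : Type u} [Field k] (c : T.Cocycle k)

lemma σ_inv_comm (A : B) : c.σ A (T.vBox.inv A) = c.σ (T.vBox.inv A) A := by
  have h := c.σ_cocycle A (T.vBox.inv A) A (T.vBox.src_inv A).symm (T.vBox.tgt_inv A)
  rwa [T.vBox.comp_inv, T.vBox.inv_comp, c.σ_vone_left, c.σ_vone_right, mul_one, mul_one] at h

lemma τ_inv_comm (A : B) : c.τ A (T.hBox.inv A) = c.τ (T.hBox.inv A) A := by
  have h := c.τ_cocycle A (T.hBox.inv A) A (T.hBox.src_inv A).symm (T.hBox.tgt_inv A)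
  rwa [T.hBox.comp_inv, T.hBox.inv_comp, c.τ_hone_left, c.τ_hone_right, mul_one, mul_one] at h

end DoubleGroupoid.Cocycle

namespace TwistedAlg

variable {B H V P : Type u} {T : VacantDoubleGroupoid B H V P} {k : Type u} [Field k]
  {c : T.Cocycle k}

variable (c) in
/-- The inverse of a box in the twisted groupoid algebra. -/
def vinvBox (A : B) : TwistedAlg T c :=
  (((c.σ (T.vBox.inv A) A)⁻¹ : kˣ) : k) • box c (T.vBox.inv A)

lemma vone_mul_box_of {x : H} {A : B} (h : x = T.vBox.src A) :
    box c (T.vBox.one x) * box c A = box c A := by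
  subst h
  rw [box_mul_box_of (T.vBox.tgt_one _), c.σ_vone_left, T.vBox.one_comp, Units.val_one, one_smul]

lemma vone_mul_box_of_ne {x : H} {A : B} (h : x ≠ T.vBox.src A) :
    box c (T.vBox.one x) * box c A = 0 := box_mul_box_of_ne (by rwa [T.vBox.tgt_one])

lemma box_mul_vone_of {x : H} {A : B} (h : T.vBox.tgt A = x) :
    box c A * box c (T.vBox.one x) = box c A := by
  subst h
  rw [box_mul_box_of (T.vBox.src_one _).symm, c.σ_vone_right, T.vBox.comp_one, Units.val_one,
    one_smul]

lemma box_mul_vone_of_ne {x : H} {A : B} (h : T.vBox.tgt A ≠ x) :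
    box c A * box c (T.vBox.one x) = 0 := box_mul_box_of_ne (by rwa [T.vBox.src_one])

lemma vinvBox_mul_box (A : B) : vinvBox c A * box c A = box c (T.vBox.one (T.vBox.tgt A)) := by
  rw [vinvBox, smul_mul_assoc, box_mul_box_of (T.vBox.tgt_inv A), T.vBox.inv_comp, smul_smul,
    ← Units.val_mul, inv_mul_cancel, Units.val_one, one_smul]

lemma box_mul_vinvBox (A : B) : box c A * vinvBox c A = box c (T.vBox.one (T.vBox.src A)) := by
  rw [vinvBox, mul_smul_comm, box_mul_box_of (T.vBox.src_inv A).symm, T.vBox.comp_inv, smul_smul,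
    ← c.σ_inv_comm, ← Units.val_mul, inv_mul_cancel, Units.val_one, one_smul]

lemma vinvBox_mul_box_of_ne {A C : B} (h : T.vBox.src A ≠ T.vBox.src C) :
    vinvBox c A * box c C = 0 := by
  rw [vinvBox, smul_mul_assoc, box_mul_box_of_ne (by rwa [T.vBox.tgt_inv]), smul_zero]

lemma box_mul_vinvBox_of_ne {A C : B} (h : T.vBox.tgt C ≠ T.vBox.tgt A) :
    box c C * vinvBox c A = 0 := by
  rw [vinvBox, mul_smul_comm, box_mul_box_of_ne (by rwa [T.vBox.src_inv]), smul_zero]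

lemma vinvBox_mul_vinvBox_of_ne {A C : B} (h : T.vBox.tgt A ≠ T.vBox.src C) :
    vinvBox c C * vinvBox c A = 0 := by
  rw [vinvBox, smul_mul_assoc, box_mul_vinvBox_of_ne (by rw [T.vBox.tgt_inv]; exact h.symm),
    smul_zero]

lemma vinvBox_mul_vone (A : B) :
    vinvBox c A * box c (T.vBox.one (T.vBox.src A)) = vinvBox c A := by
  rw [vinvBox, smul_mul_assoc, box_mul_vone_of (T.vBox.tgt_inv A)]

lemma vone_mul_vinvBox (A : B) :
    box c (T.vBox.one (T.vBox.tgt A)) * vinvBox c A = vinvBox c A := by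
  rw [vinvBox, mul_smul_comm, vone_mul_box_of (T.vBox.src_inv A).symm]

lemma vinvBox_vone (x : H) : vinvBox c (T.vBox.one x) = box c (T.vBox.one x) := by
  have h := c.σ_vone_left (T.vBox.one x)
  rw [T.vBox.src_one] at h
  rw [vinvBox, T.vBox.inv_one, h, inv_one, Units.val_one, one_smul]

variable [Fintype H]

lemma vinvBox_vcomp {A C : B} (h : T.vBox.tgt A = T.vBox.src C) :
    vinvBox c (T.vBox.comp A C) = (c.σ A C : k) • (vinvBox c C * vinvBox c A) := by
  have h1 : vinvBox c C * vinvBox c A * (box c A * box c C) =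
      box c (T.vBox.one (T.vBox.tgt C)) := by
    rw [mul_assoc, ← mul_assoc (vinvBox c A), vinvBox_mul_box, vone_mul_box_of h, vinvBox_mul_box]
  have h2 := congrArg (· * vinvBox c (T.vBox.comp A C)) h1
  have h3 := vone_mul_vinvBox (c := c) (T.vBox.comp A C)
  rw [T.vBox.tgt_comp _ _ h] at h3
  rw [h3, box_mul_box_of h, mul_smul_comm, smul_mul_assoc, mul_assoc, box_mul_vinvBox, mul_assoc,
    T.vBox.src_comp _ _ h, vinvBox_mul_vone] at h2
  exact h2.symm

variable (c) in
/-- The antipode: the inverse of a box in both directions, rescaled by the cocycle. -/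
def antipode : TwistedAlg T c →ₗ[k] TwistedAlg T c :=
  lift c fun A => (((c.τ A (T.hBox.inv A))⁻¹ : kˣ) : k) • vinvBox c (T.hBox.inv A)

lemma antipode_box (A : B) : antipode c (box c A) =
    (((c.τ A (T.hBox.inv A))⁻¹ : kˣ) : k) • vinvBox c (T.hBox.inv A) := lift_box _ _

lemma antipode_mul_box (A C : B) :
    antipode c (box c A * box c C) = antipode c (box c C) * antipode c (box c A) := by
  by_cases h : T.vBox.tgt A = T.vBox.src C
  · have h' : T.vBox.tgt (T.hBox.inv A) = T.vBox.src (T.hBox.inv C) := by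
      rw [T.bot_hinv, T.top_hinv, h]
    have key := c.compat _ _ _ _ (T.hBox.src_inv A).symm (T.hBox.src_inv C).symm h h'
    rw [T.hBox.comp_inv, T.hBox.comp_inv, VacantDoubleGroupoid.σ_hone c
      (by rw [T.bot_left, T.top_left, h]), one_mul] at key
    rw [box_mul_box_of h, map_smul]
    simp only [antipode_box]
    rw [T.hinv_vcomp h, vinvBox_vcomp h', smul_smul, smul_smul, smul_mul_smul_comm, key]
    congr 1
    simp only [Units.val_inv_eq_inv_val, Units.val_mul]
    field_simp
  · rw [box_mul_box_of_ne h, map_zero, antipode_box, antipode_box, smul_mul_smul_comm,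
      vinvBox_mul_vinvBox_of_ne, smul_zero]
    rw [T.bot_hinv, T.top_hinv]
    intro e
    exact h (by rw [← T.hor.inv_inv (T.vBox.tgt A), e, T.hor.inv_inv])

lemma antipode_mul (a b : TwistedAlg T c) :
    antipode c (a * b) = antipode c b * antipode c a := by
  induction a using induction with
  | h0 => simp
  | hadd a a' h h' => simp only [add_mul, mul_add, map_add, h, h']
  | hbox r A =>
  induction b using induction with
  | h0 => simp
  | hadd a a' h h' => simp only [add_mul, mul_add, map_add, h, h']
  | hbox s C =>
  simp only [smul_mul_assoc, mul_smul_comm, map_smul, antipode_mul_box, smul_comm r s]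

lemma antipode_vone (x : H) :
    antipode c (box c (T.vBox.one x)) = box c (T.vBox.one (T.hor.inv x)) := by
  rw [antipode_box, T.hinv_vone, VacantDoubleGroupoid.τ_vone c (T.hor.src_inv x).symm, inv_one,
    Units.val_one, one_smul, vinvBox_vone]

lemma antipode_one : antipode c 1 = 1 := by
  rw [one_def, map_sum]
  simp only [antipode_vone]
  exact Function.Bijective.sum_comp (Function.Involutive.bijective T.hor.inv_inv)
    fun x => box c (T.vBox.one x)

lemma antipode_surjective : Function.Surjective (antipode c) := by
  intro a
  induction a using induction with
  | h0 => exact ⟨0, map_zero _⟩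
  | hadd a a' h h' =>
    obtain ⟨b, rfl⟩ := h
    obtain ⟨b', rfl⟩ := h'
    exact ⟨b + b', map_add _ _ _⟩
  | hbox r A =>
    set C := T.hBox.inv (T.vBox.inv A) with hC
    have hinv : T.vBox.inv (T.hBox.inv C) = A := by rw [hC, T.hBox.inv_inv, T.vBox.inv_inv]
    set u : kˣ := (c.τ C (T.hBox.inv C))⁻¹ * (c.σ A (T.hBox.inv C))⁻¹
    have h : antipode c (box c C) = (u : k) • box c A := by
      rw [antipode_box, vinvBox, smul_smul, ← Units.val_mul, hinv]
    refine ⟨(r * ((u⁻¹ : kˣ) : k)) • box c C, ?_⟩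
    rw [map_smul, h, smul_smul, mul_assoc, Units.inv_mul, mul_one]

lemma antipode_bijective [Finite B] : Function.Bijective (antipode c) :=
  have := Fintype.ofFinite B
  ⟨LinearMap.injective_iff_surjective.mpr antipode_surjective, antipode_surjective⟩

variable (c) in
/-- The antipode of a finite vacant double groupoid as an isomorphism onto the opposite algebra. -/
def antipodeEquiv [Fintype B] : TwistedAlg T c ≃ₐ[k] (TwistedAlg T c)ᵐᵒᵖ :=
  AlgEquiv.ofLinearEquiv
    (LinearEquiv.ofBijective (antipode c) antipode_bijective ≪≫ₗ MulOpposite.opLinearEquiv k)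
    (congrArg MulOpposite.op antipode_one) fun a b => congrArg MulOpposite.op (antipode_mul a b)

open Classical in
variable (c) in
/-- The sum of the vertical identities of the horizontal edges starting at a point; it spans the
target subalgebra together with its analogues for the other points. -/
def srcIdem (p : P) : TwistedAlg T c :=
  ∑ x : H, if T.hor.src x = p then box c (T.vBox.one x) else 0

open Classical in
variable (c) in
/-- The sum of the vertical identities of the horizontal edges ending at a point, a value of the
source map `εs`. -/
def tgtIdem (p : P) : TwistedAlg T c :=
  ∑ x : H, if T.hor.tgt x = p then box c (T.vBox.one x) else 0

lemma box_mul_srcIdem_of {A : B} {p : P} (h : T.hor.src (T.vBox.tgt A) = p) :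
    box c A * srcIdem c p = box c A := by
  rw [srcIdem, Finset.mul_sum, Finset.sum_eq_single (T.vBox.tgt A), if_pos h, box_mul_vone_of rfl]
  · intro x _ hx
    rw [mul_ite, box_mul_vone_of_ne hx.symm, mul_zero, ite_self]
  · exact fun hx => absurd (Finset.mem_univ _) hx

lemma box_mul_srcIdem_of_ne {A : B} {p : P} (h : T.hor.src (T.vBox.tgt A) ≠ p) :
    box c A * srcIdem c p = 0 := by
  rw [srcIdem, Finset.mul_sum]
  refine Finset.sum_eq_zero fun x _ => ?_
  by_cases hx : T.vBox.tgt A = x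
  · rw [if_neg (hx ▸ h), mul_zero]
  · rw [mul_ite, box_mul_vone_of_ne hx, mul_zero, ite_self]

open Classical in
lemma sum_vone_inv (p : P) :
    (∑ x : H, if T.hor.src x = p then box c (T.vBox.one (T.hor.inv x)) else 0) = tgtIdem c p := by
  simp only [tgtIdem, ← T.hor.tgt_inv]
  exact Function.Bijective.sum_comp (Function.Involutive.bijective T.hor.inv_inv)
    fun x => if T.hor.tgt x = p then box c (T.vBox.one x) else 0

end TwistedAlg

namespace VacantDoubleGroupoid

variable {B H V P : Type u} (T : VacantDoubleGroupoid B H V P) [Fintype B] [Fintype H]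

open Classical in
lemma sum_left_top {M : Type*} [AddCommMonoid M] (g : V) (F : H → M) :
    (∑ A : B, if T.hBox.src A = g then F (T.vBox.src A) else 0) =
      ∑ x : H, if T.hor.src x = T.ver.src g then F x else 0 := by
  rw [← Finset.sum_filter, ← Finset.sum_filter]
  refine Finset.sum_nbij T.vBox.src ?_ ?_ ?_ (fun _ _ => rfl)
  · intro A hA
    simp only [Finset.mem_filter, Finset.mem_univ, true_and] at hA ⊢
    rw [← T.top_left, hA]
  · intro A hA C hC h
    simp only [Finset.coe_filter, Finset.mem_univ, true_and, Set.mem_ofPred_eq] at hA hC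
    exact T.ext_top_left h (hA.trans hC.symm)
  · intro x hx
    simp only [Finset.coe_filter, Finset.mem_univ, true_and, Set.mem_ofPred_eq] at hx
    obtain ⟨A, h1, h2⟩ := T.exists_top_left x g hx
    exact ⟨A, by simpa using h2, h1⟩

open Classical in
lemma sum_left_bot {M : Type*} [AddCommMonoid M] (g : V) (F : H → M) :
    (∑ A : B, if T.hBox.src A = g then F (T.vBox.tgt A) else 0) =
      ∑ x : H, if T.hor.src x = T.ver.tgt g then F x else 0 := by
  rw [← T.ver.src_inv, ← T.sum_left_top,
    ← Function.Bijective.sum_comp (Function.Involutive.bijective T.vBox.inv_inv)]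
  refine Finset.sum_congr rfl fun A _ => ?_
  simp only [T.vBox.tgt_inv, T.left_vinv]
  refine if_congr ⟨?_, ?_⟩ rfl rfl
  · rintro rfl
    rw [T.ver.inv_inv]
  · intro h
    rw [h, T.ver.inv_inv]

end VacantDoubleGroupoid

namespace TwistedAlg

open Coalgebra WeakBialgebra

variable {B H V P : Type u} {T : VacantDoubleGroupoid B H V P} {k : Type u} [Field k]
  {c : T.Cocycle k} [Fintype B] [Fintype H]

open Classical in
lemma comul_box_eq_sum (A : B) : comul (R := k) (box c A) =
    ∑ X : B, if T.hBox.src X = T.hBox.src A then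
      (c.τ X (T.hBox.comp (T.hBox.inv X) A) : k) •
        (box c X ⊗ₜ[k] box c (T.hBox.comp (T.hBox.inv X) A)) else 0 := by
  rw [comul_box, comulBox]
  refine Finset.sum_congr rfl fun X _ => ?_
  rw [Finset.sum_eq_single (T.hBox.comp (T.hBox.inv X) A)]
  · by_cases h : T.hBox.src X = T.hBox.src A
    · have h' : T.hBox.tgt X = T.hBox.src (T.hBox.comp (T.hBox.inv X) A) := by
        rw [T.hBox.src_comp _ _ (by rw [T.hBox.tgt_inv, h]), T.hBox.src_inv]
      rw [if_pos h, if_pos ⟨h', T.hBox.comp_inv_cancel h⟩]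
    · rw [if_neg h, if_neg]
      rintro ⟨h1, h2⟩
      exact h (by rw [← h2, T.hBox.src_comp _ _ h1])
  · intro Y _ hY
    refine if_neg ?_
    rintro ⟨h1, h2⟩
    exact hY (by rw [← h2, T.hBox.inv_comp_cancel h1])
  · simp

lemma εt_box_of {A : B} (hA : T.IsHOne A) :
    εt k (TwistedAlg T c) (box c A) = srcIdem c (T.ver.src (T.hBox.src A)) := by
  classical
  rw [εt_apply, comul_one]
  simp only [Finset.sum_mul, map_sum]
  rw [Finset.sum_eq_single (T.vBox.src A), srcIdem]
  · refine Finset.sum_congr rfl fun y _ => ?_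
    have h1 : T.hor.tgt (T.vBox.src A) = T.ver.src (T.hBox.src A) := by
      rw [hA.top_eq, T.hor.tgt_one]
    have h2 : counit (R := k) (box c A) = 1 := by rw [counit_box, counitBox, if_pos hA]
    by_cases h : T.hor.src y = T.ver.src (T.hBox.src A)
    · rw [if_pos h, if_pos (h1.trans h.symm), Algebra.TensorProduct.tmul_mul_tmul, mul_one,
        counitL_tmul, vone_mul_box_of rfl, h2, one_smul]
    · rw [if_neg h, if_neg (fun h' => h (h'.symm.trans h1)), zero_mul, map_zero]
  · intro x _ hx
    refine Finset.sum_eq_zero fun y _ => ?_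
    split_ifs
    · rw [Algebra.TensorProduct.tmul_mul_tmul, counitL_tmul, vone_mul_box_of_ne hx, map_zero,
        zero_smul]
    · rw [zero_mul, map_zero]
  · simp

lemma εt_box_of_not {A : B} (hA : ¬ T.IsHOne A) : εt k (TwistedAlg T c) (box c A) = 0 := by
  classical
  rw [εt_apply, comul_one]
  simp only [Finset.sum_mul, map_sum]
  refine Finset.sum_eq_zero fun x _ => Finset.sum_eq_zero fun y _ => ?_
  split_ifs
  · rw [Algebra.TensorProduct.tmul_mul_tmul, counitL_tmul, counit_mul_box,
      if_neg (fun h => hA h.2.2), zero_smul]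
  · rw [zero_mul, map_zero]

lemma εt_box_vone_one (p : P) : εt k (TwistedAlg T c) (box c (T.vBox.one (T.hor.one p))) =
    srcIdem c p := by
  rw [εt_box_of (T.isHOne_vone_one p), T.left_vone, T.ver.src_one, T.hor.src_one]

lemma εs_box_of {A : B} (hA : T.IsHOne A) :
    εs k (TwistedAlg T c) (box c A) = tgtIdem c (T.ver.tgt (T.hBox.src A)) := by
  classical
  simp only [εs, comul_one, LinearMap.comp_apply, TensorProduct.mk_apply, LinearMap.mulRight_apply,
    Finset.mul_sum, map_sum]
  rw [tgtIdem]
  refine Finset.sum_congr rfl fun x _ => ?_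
  have h_one : T.IsHOne (T.vBox.one (T.vBox.tgt A)) := by
    obtain ⟨p, hp⟩ := hA.bot
    exact hp ▸ T.isHOne_vone_one p
  rw [Finset.sum_eq_single (T.vBox.tgt A)]
  · rw [T.bot_left]
    split_ifs
    · simp [counitR_tmul, counit_mul_box, T.vBox.src_one, hA, h_one]
    · simp
  · intro y _ hy
    split_ifs
    · simp [counitR_tmul, counit_mul_box, T.vBox.src_one, hy.symm]
    · simp
  · simp

lemma εs_box_of_not {A : B} (hA : ¬ T.IsHOne A) : εs k (TwistedAlg T c) (box c A) = 0 := by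
  classical
  simp only [εs, comul_one, LinearMap.comp_apply, TensorProduct.mk_apply, LinearMap.mulRight_apply,
    Finset.mul_sum, map_sum]
  refine Finset.sum_eq_zero fun x _ => Finset.sum_eq_zero fun y _ => ?_
  split_ifs
  · simp [counitR_tmul, counit_mul_box, hA]
  · simp

lemma mul_lTensor_antipode_comul_box (A : B) : LinearMap.mul' k (TwistedAlg T c)
    ((antipode c).lTensor _ (comul (R := k) (box c A))) = εt k _ (box c A) := by
  classical
  rw [comul_box_eq_sum]
  simp only [map_sum]
  by_cases hA : T.IsHOne A
  · rw [εt_box_of hA, srcIdem, ← T.sum_left_top]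
    refine Finset.sum_congr rfl fun X _ => ?_
    split_ifs with h
    · rw [hA.hinv_hcomp h, map_smul, map_smul, LinearMap.lTensor_tmul,
        LinearMap.mul'_apply, antipode_box, T.hBox.inv_inv, mul_smul_comm, box_mul_vinvBox,
        smul_smul, c.τ_inv_comm, ← Units.val_mul, mul_inv_cancel, Units.val_one, one_smul]
    · simp
  · rw [εt_box_of_not hA]
    refine Finset.sum_eq_zero fun X _ => ?_
    split_ifs with h
    · rw [map_smul, map_smul, LinearMap.lTensor_tmul, LinearMap.mul'_apply, antipode_box,
        mul_smul_comm, box_mul_vinvBox_of_ne, smul_zero, smul_zero]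
      intro e
      exact hA (T.isHOne_of_bot (T.bot_eq_one_of_bot_eq h (by rw [e, T.bot_hinv, T.hor.inv_inv])))
    · simp

lemma mul_rTensor_antipode_comul_box (A : B) : LinearMap.mul' k (TwistedAlg T c)
    ((antipode c).rTensor _ (comul (R := k) (box c A))) = εs k _ (box c A) := by
  classical
  rw [comul_box_eq_sum]
  simp only [map_sum]
  by_cases hA : T.IsHOne A
  · rw [εs_box_of hA, ← sum_vone_inv, ← T.sum_left_bot]
    refine Finset.sum_congr rfl fun X _ => ?_
    split_ifs with h
    · rw [hA.hinv_hcomp h, map_smul, map_smul, LinearMap.rTensor_tmul,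
        LinearMap.mul'_apply, antipode_box, smul_mul_assoc, vinvBox_mul_box, T.bot_hinv,
        smul_smul, ← Units.val_mul, mul_inv_cancel, Units.val_one, one_smul]
    · simp
  · rw [εs_box_of_not hA]
    refine Finset.sum_eq_zero fun X _ => ?_
    split_ifs with h
    · rw [map_smul, map_smul, LinearMap.rTensor_tmul, LinearMap.mul'_apply, antipode_box,
        smul_mul_assoc, vinvBox_mul_box_of_ne, smul_zero, smul_zero]
      intro e
      exact hA (T.isHOne_of_top (T.top_eq_one_of_top_eq h (by rw [← e, T.top_hinv])))
    · simp

theorem isAntipode_antipodeEquiv :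
    IsAntipode (antipodeEquiv c : TwistedAlg T c →ₐ[k] (TwistedAlg T c)ᵐᵒᵖ) where
  mul_lTensor_comul := LinearMap.congr_fun
    (f := LinearMap.mul' k _ ∘ₗ (antipode c).lTensor _ ∘ₗ comul)
    (hom_ext mul_lTensor_antipode_comul_box)
  mul_rTensor_comul := LinearMap.congr_fun
    (f := LinearMap.mul' k _ ∘ₗ (antipode c).rTensor _ ∘ₗ comul)
    (hom_ext mul_rTensor_antipode_comul_box)

end TwistedAlg

/-! ### Semisimplicity -/

section Separability

variable {k A M N : Type*}

/-- The action of `A ⊗ A` on linear maps `M → N` in which `a ⊗ b` sends `f` to `m ↦ a • f (b • m)`.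
A separability element turns every `f` into an `A`-linear map in this way. -/
def sandwich [CommRing k] [Ring A] [Algebra k A] [AddCommGroup M] [Module k M] [Module A M]
    [IsScalarTower k A M] [AddCommGroup N] [Module k N] [Module A N] [IsScalarTower k A N]
    (f : M →ₗ[k] N) : A ⊗[k] A →ₗ[k] M →ₗ[k] N :=
  TensorProduct.lift (LinearMap.mk₂ k
    (fun a b => Algebra.lsmul k k N a ∘ₗ f ∘ₗ Algebra.lsmul k k M b)
    (fun _ _ _ => by rw [map_add, LinearMap.add_comp])
    (fun _ _ _ => by rw [map_smul, LinearMap.smul_comp])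
    (fun _ _ _ => by rw [map_add, LinearMap.comp_add, LinearMap.comp_add])
    (fun _ _ _ => by rw [map_smul, LinearMap.comp_smul, LinearMap.comp_smul]))

section CommRing

variable [CommRing k] [Ring A] [Algebra k A] [AddCommGroup M] [Module k M] [Module A M]
  [IsScalarTower k A M] [AddCommGroup N] [Module k N] [Module A N] [IsScalarTower k A N]
  (f : M →ₗ[k] N)

lemma sandwich_tmul_apply (a b : A) (m : M) : sandwich f (a ⊗ₜ[k] b) m = a • f (b • m) := rfl

lemma sandwich_tmul_one_mul (a : A) (t : A ⊗[k] A) (m : M) :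
    sandwich f ((a ⊗ₜ[k] 1) * t) m = a • sandwich f t m := by
  induction t with
  | zero => simp only [mul_zero, map_zero, LinearMap.zero_apply, smul_zero]
  | add s t hs ht => simp only [mul_add, map_add, LinearMap.add_apply, hs, ht, smul_add]
  | tmul x y =>
    simp only [Algebra.TensorProduct.tmul_mul_tmul, one_mul, sandwich_tmul_apply, mul_smul]

lemma sandwich_mul_one_tmul (a : A) (t : A ⊗[k] A) (m : M) :
    sandwich f (t * (1 ⊗ₜ[k] a)) m = sandwich f t (a • m) := by
  induction t with
  | zero => simp only [zero_mul, map_zero, LinearMap.zero_apply]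
  | add s t hs ht => simp only [add_mul, map_add, LinearMap.add_apply, hs, ht]
  | tmul x y =>
    simp only [Algebra.TensorProduct.tmul_mul_tmul, mul_one, sandwich_tmul_apply, mul_smul]

variable {f} in
lemma sandwich_apply_of_equivariant {m : M} (hm : ∀ a : A, f (a • m) = a • f m) (t : A ⊗[k] A) :
    sandwich f t m = LinearMap.mul' k A t • f m := by
  induction t with
  | zero => simp only [map_zero, LinearMap.zero_apply, zero_smul]
  | add s t hs ht => simp only [map_add, LinearMap.add_apply, hs, ht, add_smul]
  | tmul x y => rw [sandwich_tmul_apply, hm, LinearMap.mul'_apply, mul_smul]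

/-- The `A`-linear map obtained by averaging a `k`-linear map over a Casimir element. -/
def casimirAverage {e : A ⊗[k] A} (he : ∀ a : A, (a ⊗ₜ[k] 1) * e = e * (1 ⊗ₜ[k] a)) :
    M →ₗ[A] N where
  toFun := sandwich f e
  map_add' := map_add _
  map_smul' a m := by
    rw [← sandwich_mul_one_tmul, ← he, sandwich_tmul_one_mul, RingHom.id_apply]

end CommRing

variable [Field k] [Ring A] [Algebra k A] [AddCommGroup M] [Module k M] [Module A M]
  [IsScalarTower k A M]

lemma isSemisimpleModule_of_separability (e : A ⊗[k] A) (he : LinearMap.mul' k A e = 1)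
    (hc : ∀ a : A, (a ⊗ₜ[k] 1) * e = e * (1 ⊗ₜ[k] a)) : IsSemisimpleModule A M := by
  refine (isSemisimpleModule_iff A M).mpr ⟨fun W => ?_⟩
  obtain ⟨p, hp⟩ := (W.subtype.restrictScalars k).exists_leftInverse_of_injective
    (LinearMap.ker_eq_bot.mpr W.injective_subtype)
  have hpW (x : W) : p x = x := LinearMap.congr_fun hp x
  refine ⟨_, LinearMap.isCompl_of_proj (f := casimirAverage p hc) fun x => ?_⟩
  have hpx (a : A) : p (a • (x : M)) = a • p x := by
    rw [hpW, ← W.coe_smul, hpW]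
  change sandwich p e x = x
  rw [sandwich_apply_of_equivariant hpx, he, one_smul, hpW]

end Separability

namespace GroupoidOn

variable {Arr Obj : Type u} (G : GroupoidOn Arr Obj)

/-- The order of the vertex group at an object. -/
def vertexOrder (x : Obj) : ℕ := Nat.card {a : Arr // G.src a = x ∧ G.tgt a = x}

lemma vertexOrder_pos [Finite Arr] (x : Obj) : 0 < G.vertexOrder x :=
  have : Nonempty {a : Arr // G.src a = x ∧ G.tgt a = x} :=
    ⟨⟨G.one x, G.src_one x, G.tgt_one x⟩⟩
  Nat.card_pos

open Classical in
lemma sum_comp_left [Fintype Arr] {M : Type*} [AddCommMonoid M] (c : Arr) (F : Arr → M) :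
    ∑ a with G.src a = G.tgt c, F (G.comp c a) = ∑ a with G.src a = G.src c, F a := by
  refine Finset.sum_nbij (G.comp c) ?_ ?_ ?_ (fun _ _ => rfl)
  · intro a ha
    simp only [Finset.mem_filter, Finset.mem_univ, true_and] at ha ⊢
    exact G.src_comp _ _ ha.symm
  · intro a ha b hb h
    simp only [Finset.coe_filter, Finset.mem_univ, true_and, Set.mem_ofPred_eq] at ha hb
    exact G.left_cancel ha.symm hb.symm h
  · intro a ha
    simp only [Finset.coe_filter, Finset.mem_univ, true_and, Set.mem_ofPred_eq] at ha
    refine ⟨G.comp (G.inv c) a, ?_, G.comp_inv_cancel ha.symm⟩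
    simp only [Finset.coe_filter, Finset.mem_univ, true_and, Set.mem_ofPred_eq]
    rw [G.src_comp _ _ ((G.tgt_inv c).trans ha.symm), G.src_inv]

open Classical in
lemma card_hom_eq_vertexOrder [Fintype Arr] (c : Arr) :
    (Finset.univ.filter fun a => G.src a = G.tgt c ∧ G.tgt a = G.src c).card =
      G.vertexOrder (G.src c) := by
  have h := G.sum_comp_left c fun a => if G.tgt a = G.src c then 1 else 0
  rw [vertexOrder, Nat.card_eq_fintype_card, Fintype.card_subtype, ← Finset.filter_filter,
    ← Finset.filter_filter, Finset.card_filter, Finset.card_filter, ← h]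
  refine Finset.sum_congr rfl fun a ha => ?_
  rw [G.tgt_comp _ _ (Finset.mem_filter.mp ha).2.symm]

lemma exists_component_representative :
    ∃ r : Obj → Obj, (∀ x, ∃ c, G.src c = r x ∧ G.tgt c = x) ∧
      ∀ a, r (G.tgt a) = r (G.src a) := by
  let S : Setoid Obj :=
    { r := fun x y => ∃ a, G.src a = x ∧ G.tgt a = y
      iseqv :=
        { refl := fun x => ⟨G.one x, G.src_one x, G.tgt_one x⟩
          symm := by
            rintro _ _ ⟨a, rfl, rfl⟩
            exact ⟨G.inv a, G.src_inv a, G.tgt_inv a⟩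
          trans := by
            rintro _ _ _ ⟨a, rfl, rfl⟩ ⟨b, h, rfl⟩
            exact ⟨G.comp a b, G.src_comp _ _ h.symm, G.tgt_comp _ _ h.symm⟩ } }
  exact ⟨fun x => (Quotient.mk S x).out, fun x => Quotient.mk_out x,
    fun a => congrArg Quotient.out (Quotient.sound ⟨G.inv a, G.src_inv a, G.tgt_inv a⟩)⟩

open Classical in
/-- The weights are concentrated on one object of each connected component, where the arrows from a
given object form a torsor under the vertex group. -/
lemma exists_weight {k : Type*} [Field k] [Fintype Arr] (h : ∀ x, (G.vertexOrder x : k) ≠ 0) :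
    ∃ w : Obj → k, ∀ x, ∑ a with G.src a = x, w (G.tgt a) = 1 := by
  obtain ⟨r, hr, hr'⟩ := G.exists_component_representative
  refine ⟨fun y => if y = r y then (G.vertexOrder y : k)⁻¹ else 0, fun x => ?_⟩
  obtain ⟨c, hc, rfl⟩ := hr x
  calc ∑ a with G.src a = G.tgt c,
          (if G.tgt a = r (G.tgt a) then (G.vertexOrder (G.tgt a) : k)⁻¹ else 0)
      = ∑ a with G.src a = G.tgt c,
          if G.tgt a = G.src c then (G.vertexOrder (G.src c) : k)⁻¹ else 0 := by
        refine Finset.sum_congr rfl fun a ha => ?_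
        rw [hr' a, (Finset.mem_filter.mp ha).2, ← hc]
        split_ifs with e
        · rw [e]
        · rfl
    _ = (G.vertexOrder (G.src c) : k) * (G.vertexOrder (G.src c) : k)⁻¹ := by
        rw [← Finset.sum_filter, Finset.filter_filter, Finset.sum_const,
          G.card_hom_eq_vertexOrder, nsmul_eq_mul]
    _ = 1 := mul_inv_cancel₀ (h _)

end GroupoidOn

namespace TwistedAlg

variable {B H V P : Type u} {T : VacantDoubleGroupoid B H V P} {k : Type u} [Field k]
  {c : T.Cocycle k} [Fintype B] [Fintype H]

variable (c) in
/-- The Casimir element `∑ A ⊗ A⁻¹` weighted by a function of the bottoms of the boxes. -/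
def casimir (w : H → k) : TwistedAlg T c ⊗[k] TwistedAlg T c :=
  ∑ A : B, w (T.vBox.tgt A) • (box c A ⊗ₜ[k] vinvBox c A)

open Classical in
lemma mul'_casimir {w : H → k} (hw : ∀ x, ∑ A with T.vBox.src A = x, w (T.vBox.tgt A) = 1) :
    LinearMap.mul' k _ (casimir c w) = 1 := by
  rw [casimir, map_sum, one_def]
  simp only [map_smul, LinearMap.mul'_apply, box_mul_vinvBox]
  rw [← Finset.sum_fiberwise Finset.univ T.vBox.src]
  refine Finset.sum_congr rfl fun x _ => ?_
  rw [← one_smul k (box c (T.vBox.one x)), ← hw x, Finset.sum_smul]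
  exact Finset.sum_congr rfl fun A hA => by rw [(Finset.mem_filter.mp hA).2]

lemma box_tmul_one_mul_casimir (w : H → k) (C : B) :
    (box c C ⊗ₜ[k] 1) * casimir c w = casimir c w * (1 ⊗ₜ[k] box c C) := by
  classical
  simp only [casimir, Finset.mul_sum, Finset.sum_mul, mul_smul_comm, smul_mul_assoc,
    Algebra.TensorProduct.tmul_mul_tmul, mul_one, one_mul]
  rw [← Finset.sum_filter_of_ne (p := fun A => T.vBox.src A = T.vBox.tgt C),
    ← Finset.sum_filter_of_ne (s := Finset.univ) (p := fun A => T.vBox.src A = T.vBox.src C),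
    ← T.vBox.sum_comp_left]
  · refine Finset.sum_congr rfl fun A hA => ?_
    have h : T.vBox.tgt C = T.vBox.src A := (Finset.mem_filter.mp hA).2.symm
    rw [T.vBox.tgt_comp _ _ h, vinvBox_vcomp h, box_mul_box_of h, smul_mul_assoc, mul_assoc,
      vinvBox_mul_box, h, vinvBox_mul_vone, TensorProduct.tmul_smul, ← TensorProduct.smul_tmul']
  · intro A _ hA
    by_contra h
    exact hA (by rw [vinvBox_mul_box_of_ne h, TensorProduct.tmul_zero, smul_zero])
  · intro A _ hA
    by_contra h
    exact hA (by rw [box_mul_box_of_ne (Ne.symm h), TensorProduct.zero_tmul, smul_zero])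

lemma tmul_one_mul_casimir (w : H → k) (a : TwistedAlg T c) :
    (a ⊗ₜ[k] 1) * casimir c w = casimir c w * (1 ⊗ₜ[k] a) := by
  induction a using induction with
  | h0 => simp only [TensorProduct.zero_tmul, TensorProduct.tmul_zero, zero_mul, mul_zero]
  | hadd a b ha hb =>
    simp only [TensorProduct.add_tmul, TensorProduct.tmul_add, add_mul, mul_add, ha, hb]
  | hbox r A =>
    rw [← TensorProduct.smul_tmul', TensorProduct.tmul_smul, smul_mul_assoc, mul_smul_comm,
      box_tmul_one_mul_casimir]

omit [Fintype B] in
theorem isSemisimpleRing [Finite B] (h : ∀ x : H, (T.vBox.vertexOrder x : k) ≠ 0) :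
    IsSemisimpleRing (TwistedAlg T c) :=
  have := Fintype.ofFinite B
  have ⟨w, hw⟩ := T.vBox.exists_weight h
  isSemisimpleModule_of_separability (casimir c w) (mul'_casimir hw) (tmul_one_mul_casimir w)

end TwistedAlg

/-! ### The unit object -/

namespace TwistedAlg

open Coalgebra WeakBialgebra FinRep

variable {B H V P : Type u} {T : VacantDoubleGroupoid B H V P} {k : Type u} [Field k]
  {c : T.Cocycle k} [Fintype B] [Fintype H]

variable (c) in
/-- The unit object, the target subalgebra with its action. -/
abbrev unitObj : FinRep k (TwistedAlg T c) := tensorUnit k (TwistedAlg T c)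

variable (c) in
/-- The element of the unit object corresponding to a point. -/
def unitElt (p : P) : (unitObj c).V := εt' k _ (box c (T.vBox.one (T.hor.one p)))

lemma incl_unitElt (p : P) : incl k _ (unitElt c p) = srcIdem c p := by
  rw [unitElt, incl_εt', εt_box_vone_one]

lemma εt'_box_of {A : B} (hA : T.IsHOne A) :
    εt' k (TwistedAlg T c) (box c A) = unitElt c (T.ver.src (T.hBox.src A)) := by
  rw [← εt'_εt, εt_box_of hA, ← εt_box_vone_one, εt'_εt, unitElt]

lemma εt'_box_of_not {A : B} (hA : ¬ T.IsHOne A) : εt' k (TwistedAlg T c) (box c A) = 0 := by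
  rw [← εt'_εt, εt_box_of_not hA, map_zero]

lemma unitElt_ne_zero (p : P) : unitElt c p ≠ 0 := by
  intro h
  have h1 : counit (R := k) (incl k _ (unitElt c p)) = 1 := by
    rw [unitElt, incl_εt', counit_εt, counit_box, counitBox, if_pos (T.isHOne_vone_one p)]
  rw [h, map_zero, map_zero] at h1
  exact zero_ne_one h1

lemma span_range_unitElt : Submodule.span k (Set.range (unitElt c)) = ⊤ := by
  refine Submodule.eq_top_iff'.mpr ?_
  rintro ⟨_, a, rfl⟩
  change εt' k _ a ∈ _
  induction a using induction with
  | h0 => rw [map_zero]; exact Submodule.zero_mem _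
  | hadd a b ha hb => rw [map_add]; exact Submodule.add_mem _ ha hb
  | hbox r A =>
    rw [map_smul]
    refine Submodule.smul_mem _ _ ?_
    by_cases hA : T.IsHOne A
    · exact εt'_box_of (c := c) hA ▸ Submodule.subset_span ⟨_, rfl⟩
    · exact εt'_box_of_not (c := c) hA ▸ Submodule.zero_mem _

lemma smul_unitElt (a : TwistedAlg T c) (p : P) : a • unitElt c p = εt' k _ (a * srcIdem c p) := by
  rw [smul_eq_ρ, tensorUnit_ρ, incl_unitElt]

lemma box_smul_unitElt_of {A : B} (hA : T.IsHOne A) :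
    box c A • unitElt c (T.ver.tgt (T.hBox.src A)) = unitElt c (T.ver.src (T.hBox.src A)) := by
  rw [smul_unitElt, box_mul_srcIdem_of (T.bot_left A).symm, εt'_box_of hA]

lemma box_smul_unitElt_of_ne {A : B} {p : P}
    (hA : ¬ (T.IsHOne A ∧ T.ver.tgt (T.hBox.src A) = p)) : box c A • unitElt c p = 0 := by
  rw [smul_unitElt]
  by_cases h : T.hor.src (T.vBox.tgt A) = p
  · rw [box_mul_srcIdem_of h, εt'_box_of_not fun h' => hA ⟨h', (T.bot_left A).trans h⟩]
  · rw [box_mul_srcIdem_of_ne h, map_zero]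

lemma box_hone_smul_unitElt (g : V) :
    box c (T.hBox.one g) • unitElt c (T.ver.tgt g) = unitElt c (T.ver.src g) := by
  simpa only [T.hBox.src_one] using box_smul_unitElt_of (c := c) (T.isHOne_hone g)

variable (c) in
/-- The horizontal identity of the identity of `p`, whose action projects the unit object onto the
line spanned by `unitElt c p`. -/
abbrev pointBox (p : P) : TwistedAlg T c := box c (T.hBox.one (T.ver.one p))

lemma pointBox_smul_unitElt_self (p : P) : pointBox c p • unitElt c p = unitElt c p := by
  simpa only [T.ver.src_one, T.ver.tgt_one] using box_hone_smul_unitElt (c := c) (T.ver.one p)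

lemma pointBox_smul_unitElt_of_ne {p q : P} (h : p ≠ q) : pointBox c p • unitElt c q = 0 :=
  box_smul_unitElt_of_ne fun h' => h (by rw [← h'.2, T.hBox.src_one, T.ver.tgt_one])

lemma pointBox_smul_smul_unitElt_eq_zero {p q : P}
    (h : ∀ g, T.ver.src g = p → T.ver.tgt g ≠ q) (a : TwistedAlg T c) :
    pointBox c p • a • unitElt c q = 0 := by
  induction a using induction with
  | h0 => rw [zero_smul, smul_zero]
  | hadd a b ha hb => rw [add_smul, smul_add, ha, hb, add_zero]
  | hbox r A =>
    rw [smul_assoc, smul_comm]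
    by_cases hA : T.IsHOne A ∧ T.ver.tgt (T.hBox.src A) = q
    · obtain ⟨hA, rfl⟩ := hA
      rw [box_smul_unitElt_of hA, pointBox_smul_unitElt_of_ne fun hp => h _ hp.symm rfl, smul_zero]
    · rw [box_smul_unitElt_of_ne hA, smul_zero, smul_zero]

lemma isConnected_of_isSimpleModule [IsSimpleModule (TwistedAlg T c) (unitObj c).V] :
    T.ver.IsConnected := by
  intro p q
  by_contra! hpq
  obtain ⟨a, ha⟩ := IsSimpleModule.toSpanSingleton_surjective (TwistedAlg T c)
    (unitElt_ne_zero (c := c) q) (unitElt c p)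
  rw [LinearMap.toSpanSingleton_apply] at ha
  have h := pointBox_smul_smul_unitElt_eq_zero hpq a
  rw [ha, pointBox_smul_unitElt_self] at h
  exact unitElt_ne_zero p h

lemma exists_pointBox_smul {z : (unitObj c).V} (hz : z ≠ 0) :
    ∃ (p : P) (r : k), r ≠ 0 ∧ pointBox c p • z = r • unitElt c p := by
  obtain ⟨r, rfl⟩ := Finsupp.mem_span_range_iff_exists_finsupp.mp
    (span_range_unitElt (c := c) ▸ Submodule.mem_top : z ∈ _)
  obtain ⟨p, hp⟩ := Finsupp.ne_iff.mp fun h : r = 0 => hz (by rw [h, Finsupp.sum_zero_index])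
  refine ⟨p, r p, hp, ?_⟩
  rw [Finsupp.sum, Finset.smul_sum, Finset.sum_eq_single p, smul_comm, pointBox_smul_unitElt_self]
  · intro q _ hq
    rw [smul_comm, pointBox_smul_unitElt_of_ne hq.symm, smul_zero]
  · intro h
    rw [Finsupp.notMem_support_iff.mp h, zero_smul, smul_zero]

lemma isSimpleModule_of_isConnected (h : T.ver.IsConnected) :
    IsSimpleModule (TwistedAlg T c) (unitObj c).V := by
  obtain ⟨p₀⟩ := T.nonempty
  refine isSimpleModule_iff_toSpanSingleton_surjective.mpr
    ⟨⟨unitElt c p₀, 0, unitElt_ne_zero p₀⟩, fun z hz => ?_⟩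
  obtain ⟨p, r, hr, hp⟩ := exists_pointBox_smul hz
  rw [← LinearMap.range_eq_top, ← Submodule.restrictScalars_eq_top_iff k (TwistedAlg T c),
    ← top_le_iff, ← span_range_unitElt, Submodule.span_le]
  rintro _ ⟨q, rfl⟩
  obtain ⟨g, rfl, rfl⟩ := h q p
  refine ⟨box c (T.hBox.one g) * r⁻¹ • pointBox c (T.ver.tgt g), ?_⟩
  rw [LinearMap.toSpanSingleton_apply, mul_smul, smul_assoc, hp, inv_smul_smul₀ hr,
    box_hone_smul_unitElt]

theorem simple_unitObj_iff_isConnected : Simple (unitObj c) ↔ T.ver.IsConnected := by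
  rw [FinRep.simple_iff_isSimpleModule]
  exact ⟨fun _ => isConnected_of_isSimpleModule (c := c), isSimpleModule_of_isConnected⟩

end TwistedAlg

theorem mainTheorem8_general {B H V P k : Type u} [Fintype B] [Fintype H] [Field k]
    (T : VacantDoubleGroupoid B H V P) (c : T.Cocycle k) :
    (Simple (𝟙_ (RepTwisted T c)) ↔ T.ver.IsConnected) ∧
    ((∀ x : H, (T.vBox.vertexOrder x : k) ≠ 0) → IsMultifusion k (RepTwisted T c) ∧
      (IsFusion k (RepTwisted T c) ↔ T.ver.IsConnected)) := by
  have hunit : Simple (𝟙_ (RepTwisted T c)) ↔ T.ver.IsConnected :=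
    TwistedAlg.simple_unitObj_iff_isConnected
  refine ⟨hunit, fun h => ?_⟩
  have := TwistedAlg.isSemisimpleRing (c := c) h
  have hmulti : IsMultifusion k (RepTwisted T c) :=
    FinRep.isMultifusion (TwistedAlg.antipodeEquiv c) TwistedAlg.isAntipode_antipodeEquiv
  exact ⟨hmulti, fun hf => hunit.mp hf.simple_unit, fun hc => ⟨hmulti, hunit.mpr hc⟩⟩

end

theorem mainTheorem8 {B H V P k : Type u} [Fintype B] [Fintype H] [Fintype V] [Fintype P]
    [Field k] (T : VacantDoubleGroupoid B H V P) (c : T.Cocycle k) :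
    (Simple (𝟙_ (RepTwisted T c)) ↔ T.ver.IsConnected) ∧
    (CharZero k → IsMultifusion k (RepTwisted T c) ∧
      (IsFusion k (RepTwisted T c) ↔ T.ver.IsConnected)) :=
  have h := mainTheorem8_general T c
  ⟨h.1, fun _ => h.2 fun x => Nat.cast_ne_zero.mpr (T.vBox.vertexOrder_pos x).ne'⟩
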